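/- Let $1<p<\infty$, $\varepsilon_0>0$, $\lambda>0$ and $M\ge 0$. There exist constants $C>0$ and $\gamma>0$, depending only on $p$, $M$, $\varepsilon_0$ and $\lambda$, such that the following holds. Let $a\in L^\infty(\mathbb{R}_+\times(0,1))$ with $\|a\|_{L^\infty(\mathbb{R}_+\times(0,1))}=M$ and $a\ge 0$ almost everywhere, and suppose that for some $x_0\in(0,1)$ with $(x_0-\varepsilon_0,x_0+\varepsilon_0)\subset(0,1)$ one has $a\ge\lambda$ almost everywhere on $\mathbb{R}_+\times(x_0-\varepsilon_0,x_0+\varepsilon_0)$. Then for all $u_0\in W^{1,p}_0(0,1)$ and $u_1\in L^p(0,1)$ the damped wave equation $$u_{tt}-u_{xx}+a\,u_t=0 \ \text{ in } \mathbb{R}_+\times(0,1),\qquad u(t,0)=u(t,1)=0,\qquad u(0,\cdot)=u_0,\quad u_t(0,\cdot)=u_1,$$ has a unique weak solution $u\in C([0,\infty);W^{1,p}_0(0,1))\cap C^1([0,\infty);L^p(0,1))$, and it satisfies, for all $t\ge 0$, $$\|u_t(t,\cdot)\|_{L^p(0,1)}+\|u_x(t,\cdot)\|_{L^p(0,1)}\le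 C e^{-\gamma t}\Big(\|u_1\|_{L^p(0,1)}+\|u_0'\|_{L^p(0,1)}\Big).$$ Here a weak solution is a function $u$ in this class with $u(0,\cdot)=u_0$ and $u_t(0,\cdot)=u_1$ such that, for every $v\in C^1_c(0,1)$, $$\frac{d^2}{dt^2}\int_0^1 u(t,x)v(x)\,dx+\int_0^1 u_x(t,x)v'(x)\,dx+\int_0^1 a(t,x)u_t(t,x)v(x)\,dx=0$$ in the sense of distributions in $t\in(0,\infty)$. -/

import Mathlib

open Set MeasureTheory
open scoped ENNReal

noncomputable section

namespace DampedWave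

/-- Lebesgue measure on the space interval `(0, 1)`. -/
abbrev spaceMeasure : Measure ℝ := volume.restrict (Ioo (0 : ℝ) 1)

/-- Lebesgue measure on `ℝ₊ × (0, 1)`; points are pairs `(t, x)`. -/
abbrev spaceTimeMeasure : Measure (ℝ × ℝ) := volume.restrict (Ioi (0 : ℝ) ×ˢ Ioo (0 : ℝ) 1)

/-- The Lebesgue space `L^p(0, 1)`. -/
abbrev LpSpace (p : ℝ≥0∞) := Lp ℝ p spaceMeasure

/-- `v ∈ C^1_c(0, 1)`. -/
def IsSpaceTest (v : ℝ → ℝ) : Prop :=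
  ContDiff ℝ 1 v ∧ HasCompactSupport v ∧ tsupport v ⊆ Ioo 0 1

/-- `ψ ∈ C^∞_c(0, ∞)`. -/
def IsTimeTest (ψ : ℝ → ℝ) : Prop :=
  ContDiff ℝ (⊤ : ℕ∞) ψ ∧ HasCompactSupport ψ ∧ tsupport ψ ⊆ Ioi 0

/-- `g` is the weak derivative of `f` on `(0, 1)`. -/
def IsWeakDeriv (f g : ℝ → ℝ) : Prop :=
  ∀ φ : ℝ → ℝ, IsSpaceTest φ →
    ∫ x in Ioo (0 : ℝ) 1, f x * deriv φ x = - ∫ x in Ioo (0 : ℝ) 1, g x * φ x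

/-- `f` has a continuous representative on `[0, 1]` that vanishes at `0` and at `1`. -/
def HasZeroTrace (f : ℝ → ℝ) : Prop :=
  ∃ F : ℝ → ℝ, ContinuousOn F (Icc 0 1) ∧ F 0 = 0 ∧ F 1 = 0 ∧ f =ᵐ[spaceMeasure] F

lemma integrable_mul {p : ℝ≥0∞} [hp : Fact (1 ≤ p)] (f : LpSpace p) {w : ℝ → ℝ}
    (hw : Continuous w) (hc : HasCompactSupport w) :
    Integrable (fun x => f x * w x) spaceMeasure := by
  have hf : Integrable f spaceMeasure := (Lp.memLp f).integrable hp.out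
  obtain ⟨K, hK⟩ := hc.exists_bound_of_continuous hw
  exact hf.mul_bdd (c := K) hw.aestronglyMeasurable (Filter.Eventually.of_forall hK)

/-- The Sobolev space `W^{1,p}_0(0, 1)`, as the space of pairs `(f, f')` of a function and its
weak derivative, both in `L^p(0, 1)`, where `f` vanishes at `0` and `1`. Its norm,
`max ‖f‖ ‖f'‖`, is equivalent to the usual norm of `W^{1,p}`. -/
def W0 (p : ℝ≥0∞) [Fact (1 ≤ p)] : Submodule ℝ (LpSpace p × LpSpace p) where
  carrier := {q | IsWeakDeriv q.1 q.2 ∧ HasZeroTrace q.1}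
  zero_mem' := by
    have h0 := Lp.coeFn_zero ℝ p spaceMeasure
    refine ⟨fun φ _ => ?_, fun _ => 0, continuousOn_const, rfl, rfl, h0⟩
    have h : ∀ w : ℝ → ℝ, ∫ x in Ioo (0 : ℝ) 1, (0 : LpSpace p) x * w x = 0 := fun w => by
      refine integral_eq_zero_of_ae ?_
      filter_upwards [h0] with x hx
      rw [hx]; simp
    simp only [Prod.fst_zero, Prod.snd_zero, h, neg_zero]
  add_mem' := by
    rintro ⟨f₁, g₁⟩ ⟨f₂, g₂⟩ ⟨h₁, F₁, c₁, z₁, o₁, e₁⟩ ⟨h₂, F₂, c₂, z₂, o₂, e₂⟩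
    refine ⟨fun φ hφ => ?_, F₁ + F₂, c₁.add c₂, by simp [z₁, z₂], by simp [o₁, o₂],
      (Lp.coeFn_add f₁ f₂).trans (e₁.add e₂)⟩
    have key : ∀ (f g : LpSpace p) (w : ℝ → ℝ), Continuous w → HasCompactSupport w →
        ∫ x in Ioo (0 : ℝ) 1, (f + g) x * w x
          = (∫ x in Ioo (0 : ℝ) 1, f x * w x) + ∫ x in Ioo (0 : ℝ) 1, g x * w x := by
      intro f g w hw hc
      rw [← integral_add (integrable_mul f hw hc) (integrable_mul g hw hc)]
      refine integral_congr_ae ?_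
      filter_upwards [Lp.coeFn_add f g] with x hx
      rw [hx, Pi.add_apply, add_mul]
    have e₁ := h₁ φ hφ
    have e₂ := h₂ φ hφ
    simp only [Prod.mk_add_mk] at e₁ e₂ ⊢
    rw [key _ _ _ (hφ.1.continuous_deriv le_rfl) hφ.2.1.deriv,
      key _ _ _ hφ.1.continuous hφ.2.1, e₁, e₂]
    ring
  smul_mem' := by
    rintro c ⟨f, g⟩ ⟨h, F, hF, z, o, e⟩
    refine ⟨fun φ hφ => ?_, c • F, hF.const_smul c, by simp [z], by simp [o],
      (Lp.coeFn_smul c f).trans (e.const_smul c)⟩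
    have key : ∀ (f : LpSpace p) (w : ℝ → ℝ),
        ∫ x in Ioo (0 : ℝ) 1, (c • f) x * w x = c * ∫ x in Ioo (0 : ℝ) 1, f x * w x := by
      intro f w
      rw [← integral_const_mul]
      refine integral_congr_ae ?_
      filter_upwards [Lp.coeFn_smul c f] with x hx
      rw [hx, Pi.smul_apply, smul_eq_mul, mul_assoc]
    have e := h φ hφ
    simp only [Prod.smul_mk] at e ⊢
    rw [key, key, e]
    ring

variable {p : ℝ≥0∞} [Fact (1 ≤ p)]

/-- The function underlying an element of `W^{1,p}_0(0, 1)`. -/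
def fn (w : W0 p) : LpSpace p := w.1.1

/-- The weak derivative `∂ₓ w` of an element of `W^{1,p}_0(0, 1)`. -/
def dx (w : W0 p) : LpSpace p := w.1.2

/-- The time derivative `∂ₜ u(t, ·)` in `L^p(0, 1)`, one-sided at `t = 0`. -/
def timeDeriv (u : ℝ → W0 p) (t : ℝ) : LpSpace p :=
  derivWithin (fun s => fn (u s)) (Ici 0) t

/-- `u` is a weak solution on `[0, ∞)` of `u_tt - u_xx + a u_t = 0` with homogeneous Dirichlet
boundary conditions and initial data `u₀`, `u₁`. Only the values `u t` with `0 ≤ t` matter. -/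
structure IsWeakSolution (a : Lp ℝ ∞ spaceTimeMeasure) (u₀ : W0 p) (u₁ : LpSpace p)
    (u : ℝ → W0 p) : Prop where
  /-- `u ∈ C([0, ∞); W^{1,p}_0(0, 1))` -/
  continuousOn : ContinuousOn u (Ici 0)
  /-- `u ∈ C^1([0, ∞); L^p(0, 1))` -/
  contDiffOn : ContDiffOn ℝ 1 (fun t => fn (u t)) (Ici 0)
  init : u 0 = u₀
  init_deriv : timeDeriv u 0 = u₁
  /-- For every `v ∈ C^1_c(0, 1)`, the identity
  `d²/dt² ∫ u v dx + ∫ u_x v_x dx + ∫ a u_t v dx = 0` holds as distributions in `t ∈ (0, ∞)`. -/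
  weak_eq : ∀ v : ℝ → ℝ, IsSpaceTest v → ∀ ψ : ℝ → ℝ, IsTimeTest ψ →
    (∫ t in Ioi (0 : ℝ), deriv (deriv ψ) t * ∫ x in Ioo (0 : ℝ) 1, fn (u t) x * v x)
      + (∫ t in Ioi (0 : ℝ), ψ t * ∫ x in Ioo (0 : ℝ) 1, dx (u t) x * deriv v x)
      + (∫ t in Ioi (0 : ℝ), ψ t * ∫ x in Ioo (0 : ℝ) 1, a (t, x) * timeDeriv u t x * v x) = 0

end DampedWave

end

/-!
The equation is solved on the circle `ℝ / 2ℤ`, the double of the interval. With the even extension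
of `uₓ` and the odd extension of `uₜ`, the function `w = even uₓ + odd uₜ` collects the two Riemann
invariants `uₓ ± uₜ`, and the damped wave equation becomes the transport equation
`wₜ - wₓ = -(a / 2) (w - w(-·))`. In the moving frame, and after multiplication by `exp (M t / 2)`,
this is a linear evolution equation `z' = A(t) z` whose generator (`gen`) is bounded and, since
`0 ≤ a ≤ M`, positive; it multiplies the constants and the mean value by `M / 2`. Hence the solution
operators of `w` (`semi`) are doubly stochastic, and by Jensen's inequality they are contractions of
`L^p` for every `p` (`IsDoublyStochastic.norm_le`).

Probabilistically, `w` describes a particle that travels around the circle and is reflected at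
rate `a / 2`. While the particle passes through the damped region `(x₀ - ε, x₀ + ε)`, the random
time of the jump spreads its position over an interval of length comparable to `ε`. Iterating over a
fixed number `N` of periods covers the whole circle (`exists_integral_translate_le`). This is a
Doeblin minorization: the solution operator over `N` periods dominates `δ` times the mean value.
Subtracting this part leaves `1 - δ` times a doubly stochastic operator, so that functions of mean
value zero contract by `1 - δ` (`exists_contraction`), with `δ` depending only on `M`, `ε` and `λ`.
Since `w` has mean value `∫ uₓ = 0`, exponential decay follows (`exists_decay`).

Weak solutions are tied to the evolution equation through Fourier coefficients. By the lemma of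
du Bois-Reymond, `W^{1,p}_0` consists of the primitives of functions of mean value zero
(`mem_W0_iff`), and the functions `sin (π n x)` suffice as test functions
(`isWeakDeriv_iff_coef`). So the weak formulation is equivalent to a system of scalar integral
equations for the cosine coefficients of `uₓ` and the sine coefficients of `uₜ` (`weak_eq_iff`,
`cosCoef_dx_iff`), and multiplication by exponentials turns it into the evolution equation
(`isEvolution_frame_iff`). Existence comes from a Picard iteration and uniqueness from Grönwall's
inequality.
-/

noncomputable section

namespace DampedWave

open Filter Topology

open scoped BoundedContinuousFunction

/-! ### Linear evolution equations with bounded, strongly measurable coefficients -/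

section Evolution

variable {E : Type*} [NormedAddCommGroup E] [NormedSpace ℝ E]

/-- A family of operators that is bounded by `K` and strongly measurable in time, in the strong
operator topology. -/
structure IsCoefficient (A : ℝ → E →L[ℝ] E) (K : ℝ) : Prop where
  norm_le : ∀ s, ‖A s‖ ≤ K
  meas : ∀ x, StronglyMeasurable fun s => A s x

/-- `z` solves `z' = A z`, `z 0 = z₀` on `[0, ∞)`, in the integrated form. -/
structure IsEvolution (A : ℝ → E →L[ℝ] E) (z₀ : E) (z : ℝ → E) : Prop where
  cont : ContinuousOn z (Ici 0)
  eq : ∀ t, 0 ≤ t → z t = z₀ + ∫ s in (0 : ℝ)..t, A s (z s)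

variable {A : ℝ → E →L[ℝ] E} {K : ℝ}

lemma IsCoefficient.nonneg (hA : IsCoefficient A K) : 0 ≤ K :=
  (norm_nonneg _).trans (hA.norm_le 0)

lemma IsCoefficient.apply_le (hA : IsCoefficient A K) (s : ℝ) (x : E) : ‖A s x‖ ≤ K * ‖x‖ :=
  (A s).le_of_opNorm_le (hA.norm_le s) x

lemma IsCoefficient.stronglyMeasurable_apply (hA : IsCoefficient A K) {z : ℝ → E}
    (hz : Continuous z) : StronglyMeasurable fun s => A s (z s) := by
  have h : StronglyMeasurable (Function.uncurry fun r s => A s (z r)) :=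
    stronglyMeasurable_uncurry_of_continuous_of_stronglyMeasurable
      (fun s => (A s).continuous.comp hz) (fun r => hA.meas (z r))
  exact h.comp_measurable (measurable_id.prodMk measurable_id)

lemma continuous_comp_max {F : Type*} [TopologicalSpace F] {z : ℝ → F} (hz : ContinuousOn z (Ici 0)) :
    Continuous fun s => z (max s 0) :=
  hz.comp_continuous (by fun_prop) fun s => le_max_right s 0

lemma IsCoefficient.intervalIntegrable (hA : IsCoefficient A K) {z : ℝ → E}
    (hz : ContinuousOn z (Ici 0)) {a b : ℝ} (ha : 0 ≤ a) (hb : 0 ≤ b) :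
    IntervalIntegrable (fun s => A s (z s)) volume a b := by
  have hc := continuous_comp_max hz
  have h1 : IntervalIntegrable (fun s => A s (z (max s 0))) volume a b := by
    refine IntervalIntegrable.mono_fun (g := fun s => A s (z (max s 0)))
      (f := fun s => K * ‖z (max s 0)‖) ((continuous_const.mul hc.norm).intervalIntegrable a b)
      (hA.stronglyMeasurable_apply hc).aestronglyMeasurable ?_
    exact Eventually.of_forall fun s => (hA.apply_le s _).trans (Real.le_norm_self _)
  refine h1.congr fun s hs => ?_
  have : 0 ≤ s := (le_min ha hb).trans hs.1.le
  simp [max_eq_left this]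

/-- Grönwall's inequality in integral form. -/
lemma le_mul_exp_of_le_integral {n : ℝ → ℝ} (hn : ContinuousOn n (Ici 0)) {c k : ℝ}
    (hk : 0 ≤ k) (h : ∀ t, 0 ≤ t → n t ≤ c + k * ∫ s in (0 : ℝ)..t, n s) {t : ℝ} (ht : 0 ≤ t) :
    n t ≤ c * Real.exp (k * t) := by
  have hc : Continuous fun s => n (max s 0) := hn.comp_continuous (by fun_prop) fun s => le_max_right s 0
  set m : ℝ → ℝ := fun t => c + k * ∫ s in (0 : ℝ)..t, n (max s 0) with hm
  have hd : ∀ t, HasDerivAt m (k * n (max t 0)) t := fun t =>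
    ((hc.integral_hasStrictDerivAt 0 t).hasDerivAt.const_mul k).const_add c
  have hnm : ∀ t, 0 ≤ t → n t ≤ m t := fun t ht => by
    refine (h t ht).trans_eq ?_
    rw [hm]
    simp only
    congr 2
    refine intervalIntegral.integral_congr fun s hs => ?_
    rw [uIcc_of_le ht] at hs
    simp [max_eq_left hs.1]
  have hF : ∀ t, HasDerivAt (fun t => Real.exp (-(k * t)) * m t)
      (Real.exp (-(k * t)) * (-(k * 1)) * m t + Real.exp (-(k * t)) * (k * n (max t 0))) t :=
    fun t => (((hasDerivAt_id t).const_mul k).neg.exp).mul (hd t)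
  have hanti : AntitoneOn (fun t => Real.exp (-(k * t)) * m t) (Ici 0) := by
    refine antitoneOn_of_deriv_nonpos (convex_Ici 0)
      (fun t _ => (hF t).continuousAt.continuousWithinAt)
      (fun t _ => (hF t).differentiableAt.differentiableWithinAt) fun t ht => ?_
    rw [interior_Ici] at ht
    have ht' : 0 ≤ t := le_of_lt ht
    rw [(hF t).deriv, max_eq_left ht']
    have := mul_nonneg (Real.exp_pos (-(k * t))).le (mul_nonneg hk (sub_nonneg.2 (hnm t ht')))
    nlinarith
  have h0 := hanti self_mem_Ici ht ht
  have hm0 : m 0 = c := by simp [hm]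
  simp only [hm0, mul_zero, neg_zero, Real.exp_zero, one_mul] at h0
  refine (hnm t ht).trans ?_
  rw [Real.exp_neg, inv_mul_le_iff₀ (Real.exp_pos _)] at h0
  linarith

lemma IsEvolution.norm_le (hA : IsCoefficient A K) {z₀ : E} {z : ℝ → E} (hz : IsEvolution A z₀ z)
    {t : ℝ} (ht : 0 ≤ t) : ‖z t‖ ≤ ‖z₀‖ * Real.exp (K * t) := by
  refine le_mul_exp_of_le_integral hz.cont.norm hA.nonneg (fun t ht => ?_) ht
  rw [hz.eq t ht]
  refine (norm_add_le _ _).trans (add_le_add_right ?_ _)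
  rw [← intervalIntegral.integral_const_mul]
  refine intervalIntegral.norm_integral_le_of_norm_le ht
    (Eventually.of_forall fun s _ => hA.apply_le s _) ?_
  refine ContinuousOn.intervalIntegrable (continuousOn_const.mul (hz.cont.norm.mono ?_))
  rw [uIcc_of_le ht]
  exact Icc_subset_Ici_self

lemma IsEvolution.sub (hA : IsCoefficient A K) {z₀ y₀ : E} {z y : ℝ → E} (hz : IsEvolution A z₀ z)
    (hy : IsEvolution A y₀ y) : IsEvolution A (z₀ - y₀) fun t => z t - y t := by
  refine ⟨hz.cont.sub hy.cont, fun t ht => ?_⟩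
  simp only [map_sub]
  rw [intervalIntegral.integral_sub (hA.intervalIntegrable hz.cont le_rfl ht)
    (hA.intervalIntegrable hy.cont le_rfl ht), hz.eq t ht, hy.eq t ht]
  abel

lemma IsEvolution.add (hA : IsCoefficient A K) {z₀ y₀ : E} {z y : ℝ → E} (hz : IsEvolution A z₀ z)
    (hy : IsEvolution A y₀ y) : IsEvolution A (z₀ + y₀) fun t => z t + y t := by
  refine ⟨hz.cont.add hy.cont, fun t ht => ?_⟩
  simp only [map_add]
  rw [intervalIntegral.integral_add (hA.intervalIntegrable hz.cont le_rfl ht)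
    (hA.intervalIntegrable hy.cont le_rfl ht), hz.eq t ht, hy.eq t ht]
  abel

lemma IsEvolution.smul (c : ℝ) {z₀ : E} {z : ℝ → E} (hz : IsEvolution A z₀ z) :
    IsEvolution A (c • z₀) fun t => c • z t := by
  refine ⟨hz.cont.const_smul c, fun t ht => ?_⟩
  simp only [map_smul]
  rw [intervalIntegral.integral_smul, hz.eq t ht, smul_add]

lemma IsEvolution.unique (hA : IsCoefficient A K) {z₀ : E} {z y : ℝ → E} (hz : IsEvolution A z₀ z)
    (hy : IsEvolution A z₀ y) {t : ℝ} (ht : 0 ≤ t) : z t = y t := by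
  have := (hz.sub hA hy).norm_le hA ht
  rw [sub_self, norm_zero, zero_mul] at this
  exact sub_eq_zero.1 (norm_le_zero_iff.1 this)

/-- A solution restarted at time `t₀`. -/
lemma IsEvolution.shift (hA : IsCoefficient A K) {z₀ : E} {z : ℝ → E} (hz : IsEvolution A z₀ z)
    {t₀ : ℝ} (h0 : 0 ≤ t₀) :
    IsEvolution (fun s => A (s + t₀)) (z t₀) fun t => z (t + t₀) := by
  refine ⟨hz.cont.comp (by fun_prop) fun t (ht : 0 ≤ t) => add_nonneg ht h0, fun t ht => ?_⟩
  rw [hz.eq _ (add_nonneg ht h0), hz.eq _ h0, add_assoc]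
  congr 1
  rw [intervalIntegral.integral_comp_add_right (fun s => A s (z s)), zero_add,
    intervalIntegral.integral_add_adjacent_intervals
      (hA.intervalIntegrable hz.cont le_rfl h0)
      (hA.intervalIntegrable hz.cont h0 (add_nonneg ht h0))]

/-- The time-weighted Picard map for `z' = A z`: `y` is a fixed point if and only if
`t ↦ exp (L t) y(t)` is a solution. The weight makes it a contraction on the bounded functions on
the whole half line. -/
def picard (A : ℝ → E →L[ℝ] E) (L : ℝ) (z₀ : E) (y : ℝ → E) (t : ℝ) : E :=
  Real.exp (-(L * max t 0)) • (z₀ + ∫ s in (0 : ℝ)..max t 0, Real.exp (L * s) • A s (y s))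

lemma picard_integrable (hA : IsCoefficient A K) (L : ℝ) {y : ℝ → E} (hy : Continuous y)
    (a b : ℝ) : IntervalIntegrable (fun s => Real.exp (L * s) • A s (y s)) volume a b := by
  refine IntervalIntegrable.mono_fun (f := fun s => Real.exp (L * s) * (K * ‖y s‖))
    (Continuous.intervalIntegrable (by fun_prop) a b) ?_ ?_
  · exact (StronglyMeasurable.smul (Continuous.stronglyMeasurable (by fun_prop))
      (hA.stronglyMeasurable_apply hy)).aestronglyMeasurable
  · refine Eventually.of_forall fun s => ?_
    have h := hA.apply_le s (y s)
    simp only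
    rw [norm_smul, norm_mul, Real.norm_of_nonneg (mul_nonneg hA.nonneg (norm_nonneg _))]
    gcongr

lemma picard_continuous (hA : IsCoefficient A K) (L : ℝ) (z₀ : E) {y : ℝ → E}
    (hy : Continuous y) : Continuous (picard A L z₀ y) := by
  have h := intervalIntegral.continuous_primitive (picard_integrable hA L hy) 0
  refine Continuous.smul (by fun_prop) (continuous_const.add ?_)
  exact h.comp (by fun_prop : Continuous fun t : ℝ => max t 0)

lemma norm_weighted_integral_le (hA : IsCoefficient A K) {L : ℝ} (hL : 0 < L) {y : ℝ → E} {C : ℝ}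
    (hC : ∀ s, ‖y s‖ ≤ C) {t : ℝ} (ht : 0 ≤ t) :
    ‖Real.exp (-(L * t)) • ∫ s in (0 : ℝ)..t, Real.exp (L * s) • A s (y s)‖ ≤ K * C / L := by
  have hC0 : 0 ≤ C := (norm_nonneg _).trans (hC 0)
  have h1 : ‖∫ s in (0 : ℝ)..t, Real.exp (L * s) • A s (y s)‖
      ≤ ∫ s in (0 : ℝ)..t, Real.exp (L * s) * (K * C) := by
    refine intervalIntegral.norm_integral_le_of_norm_le ht
      (Eventually.of_forall fun s _ => ?_) (Continuous.intervalIntegrable (by fun_prop) _ _)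
    rw [norm_smul, Real.norm_of_nonneg (Real.exp_pos _).le]
    exact mul_le_mul_of_nonneg_left ((hA.apply_le s _).trans
      (mul_le_mul_of_nonneg_left (hC s) hA.nonneg)) (Real.exp_pos _).le
  have h2 : ∫ s in (0 : ℝ)..t, Real.exp (L * s) * (K * C)
      = (Real.exp (L * t) - 1) / L * (K * C) := by
    rw [intervalIntegral.integral_mul_const, intervalIntegral.integral_comp_mul_left _ hL.ne',
      integral_exp]
    simp [div_eq_inv_mul]
  rw [norm_smul, Real.norm_of_nonneg (Real.exp_pos _).le]
  refine (mul_le_mul_of_nonneg_left (h1.trans_eq h2) (Real.exp_pos _).le).trans ?_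
  have h3 : Real.exp (-(L * t)) * ((Real.exp (L * t) - 1) / L * (K * C))
      = (1 - Real.exp (-(L * t))) * (K * C / L) := by
    rw [Real.exp_neg]
    field_simp
  rw [h3]
  have h4 : 0 ≤ K * C / L := div_nonneg (mul_nonneg hA.nonneg hC0) hL.le
  nlinarith [mul_nonneg (Real.exp_pos (-(L * t))).le h4]

/-- The Picard map on bounded continuous functions. -/
def picardBCF (hA : IsCoefficient A K) {L : ℝ} (hL : 0 < L) (z₀ : E) (y : ℝ →ᵇ E) : ℝ →ᵇ E :=
  BoundedContinuousFunction.ofNormedAddCommGroup (picard A L z₀ y)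
    (picard_continuous hA L z₀ y.continuous) (‖z₀‖ + K * ‖y‖ / L) fun t => by
      have hm : 0 ≤ max t 0 := le_max_right _ _
      rw [picard, smul_add]
      refine (norm_add_le _ _).trans (add_le_add ?_
        (norm_weighted_integral_le hA hL (fun s => y.norm_coe_le_norm s) hm))
      rw [norm_smul, Real.norm_of_nonneg (Real.exp_pos _).le]
      refine mul_le_of_le_one_left (norm_nonneg _) (Real.exp_le_one_iff.2 ?_)
      have := mul_nonneg hL.le hm
      linarith

lemma picardBCF_contracting (hA : IsCoefficient A K) {L : ℝ} (hL : 0 < L) (hKL : 2 * K ≤ L)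
    (z₀ : E) : ContractingWith (1 / 2) (picardBCF hA hL z₀) := by
  refine ⟨by norm_num, LipschitzWith.of_dist_le_mul fun y y' => ?_⟩
  rw [BoundedContinuousFunction.dist_le (by positivity)]
  intro t
  have hm : 0 ≤ max t 0 := le_max_right _ _
  change dist (picard A L z₀ y t) (picard A L z₀ y' t) ≤ _
  have he : picard A L z₀ y t - picard A L z₀ y' t = Real.exp (-(L * max t 0)) •
      ∫ s in (0 : ℝ)..max t 0, Real.exp (L * s) • A s ((y - y') s) := by
    rw [picard, picard, ← smul_sub, add_sub_add_left_eq_sub,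
      ← intervalIntegral.integral_sub (picard_integrable hA L y.continuous _ _)
        (picard_integrable hA L y'.continuous _ _)]
    simp only [← smul_sub, ← map_sub, BoundedContinuousFunction.sub_apply]
  rw [dist_eq_norm, he]
  refine (norm_weighted_integral_le hA hL (fun s => (y - y').norm_coe_le_norm s) hm).trans ?_
  rw [dist_eq_norm]
  have : K / L ≤ 1 / 2 := by rw [div_le_div_iff₀ hL two_pos]; linarith
  calc K * ‖y - y'‖ / L = K / L * ‖y - y'‖ := by ring
    _ ≤ 1 / 2 * ‖y - y'‖ := by gcongr
    _ = _ := by norm_num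

lemma isEvolution_of_isFixedPt {L : ℝ} {z₀ : E} {y : ℝ → E} (hy : Continuous y)
    (h : ∀ t, picard A L z₀ y t = y t) : IsEvolution A z₀ fun t => Real.exp (L * t) • y t := by
  refine ⟨by fun_prop, fun t ht => ?_⟩
  simp only [map_smul]
  rw [← h t, picard, max_eq_left ht, smul_smul, ← Real.exp_add]
  simp

lemma exists_isEvolution [CompleteSpace E] (hA : IsCoefficient A K) (z₀ : E) :
    ∃ z, IsEvolution A z₀ z := by
  have hL : 0 < 2 * K + 1 := by linarith [hA.nonneg]
  have hc := picardBCF_contracting hA hL (by linarith) z₀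
  refine ⟨_, isEvolution_of_isFixedPt (L := 2 * K + 1)
    (y := ⇑(ContractingWith.fixedPoint (picardBCF hA hL z₀) hc)) (BoundedContinuousFunction.continuous _) fun t => ?_⟩
  exact congrArg (fun f : ℝ →ᵇ E => f t) hc.fixedPoint_isFixedPt

lemma exists_isEvolution_nonneg [CompleteSpace E] [PartialOrder E] [IsOrderedAddMonoid E] [IsOrderedModule ℝ E]
    [OrderClosedTopology E] (hA : IsCoefficient A K) (hpos : ∀ s x, 0 ≤ x → 0 ≤ A s x) {z₀ : E}
    (h0 : 0 ≤ z₀) : ∃ z, IsEvolution A z₀ z ∧ ∀ t, 0 ≤ z t := by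
  have hL : 0 < 2 * K + 1 := by linarith [hA.nonneg]
  have hc := picardBCF_contracting hA hL (by linarith) z₀
  -- The Picard iterates starting from `0` are nonnegative, hence so is their limit.
  have hit : ∀ n t, 0 ≤ ((picardBCF hA hL z₀)^[n] 0) t := by
    intro n
    induction n with
    | zero => intro t; simp
    | succ n ih =>
      intro t
      rw [Function.iterate_succ_apply']
      refine smul_nonneg (Real.exp_pos _).le (add_nonneg h0 ?_)
      rw [intervalIntegral.integral_of_le (le_max_right _ _)]
      exact integral_nonneg fun s => smul_nonneg (Real.exp_pos _).le (hpos s _ (ih s))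
  have hlim : ∀ t, 0 ≤ (ContractingWith.fixedPoint (picardBCF hA hL z₀) hc : ℝ →ᵇ E) t := fun t =>
    ge_of_tendsto' (((continuous_eval_const t).tendsto _).comp
      (hc.tendsto_iterate_fixedPoint 0)) fun n => hit n t
  refine ⟨_, isEvolution_of_isFixedPt (L := 2 * K + 1)
    (y := ⇑(ContractingWith.fixedPoint (picardBCF hA hL z₀) hc)) (BoundedContinuousFunction.continuous _) fun t => ?_,
    fun t => smul_nonneg (Real.exp_pos _).le (hlim t)⟩
  exact congrArg (fun f : ℝ →ᵇ E => f t) hc.fixedPoint_isFixedPt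

end Evolution

/-! ### Integration by parts and the lemma of du Bois-Reymond -/

/-- Integration by parts when one factor is the primitive of a merely integrable function. -/
lemma integral_deriv_mul_primitive {𝕜 : Type*} [RCLike 𝕜] {φ φ' q : ℝ → 𝕜} {t : ℝ} (ht : 0 ≤ t)
    (hφ : ∀ x, HasDerivAt φ (φ' x) x) (hφ' : Continuous φ')
    (hq : IntervalIntegrable q volume 0 t) :
    ∫ s in (0 : ℝ)..t, (φ' s * (∫ r in (0 : ℝ)..s, q r) + φ s * q s)
      = φ t * ∫ r in (0 : ℝ)..t, q r := by
  have hφc : Continuous φ := continuous_iff_continuousAt.2 fun x => (hφ x).continuousAt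
  have hqi : Integrable q (volume.restrict (Ioc 0 t)) := (intervalIntegrable_iff_integrableOn_Ioc_of_le ht).1 hq
  have hφi : Integrable φ' (volume.restrict (Ioc 0 t)) :=
    (intervalIntegrable_iff_integrableOn_Ioc_of_le ht).1 (hφ'.intervalIntegrable 0 t)
  have hint : Integrable (Function.uncurry fun s r => (Iic s).indicator (fun r => φ' s * q r) r)
      ((volume.restrict (Ioc 0 t)).prod (volume.restrict (Ioc 0 t))) := by
    have h := (hφi.mul_prod hqi).indicator (measurableSet_le measurable_snd measurable_fst)
    refine h.congr (Eventually.of_forall fun z => ?_)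
    simp only [indicator, Function.uncurry, mem_ofPred_eq, mem_Iic]
  have hprim : ContinuousOn (fun s => ∫ r in (0 : ℝ)..s, q r) (uIcc 0 t) := by
    rw [uIcc_of_le ht]
    exact intervalIntegral.continuousOn_primitive_interval
      ((integrableOn_Icc_iff_integrableOn_Ioc).2 hqi |>.mono_set (by rw [uIcc_of_le ht]))
      |>.mono (by rw [uIcc_of_le ht])
  have hadd : ∫ s in (0 : ℝ)..t, (φ' s * (∫ r in (0 : ℝ)..s, q r) + φ s * q s)
      = (∫ s in (0 : ℝ)..t, φ' s * ∫ r in (0 : ℝ)..s, q r) + ∫ s in (0 : ℝ)..t, φ s * q s :=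
    intervalIntegral.integral_add ((hφ'.continuousOn.mul hprim).intervalIntegrable)
      (hq.continuousOn_mul hφc.continuousOn)
  rw [hadd]
  have h1 : ∫ s in (0 : ℝ)..t, φ' s * ∫ r in (0 : ℝ)..s, q r
      = ∫ s in Ioc 0 t, ∫ r in Ioc 0 t, (Iic s).indicator (fun r => φ' s * q r) r := by
    rw [intervalIntegral.integral_of_le ht]
    refine setIntegral_congr_fun measurableSet_Ioc fun s hs => ?_
    rw [setIntegral_indicator measurableSet_Iic, integral_const_mul,
      intervalIntegral.integral_of_le hs.1.le]
    congr 3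
    ext r
    simp only [mem_Ioc, mem_inter_iff, mem_Iic]
    have := hs.2
    constructor
    · rintro ⟨a, b⟩; exact ⟨⟨a, b.trans this⟩, b⟩
    · rintro ⟨⟨a, _⟩, c⟩; exact ⟨a, c⟩
  have h2 : ∫ r in Ioc 0 t, ∫ s in Ioc 0 t, (Iic s).indicator (fun r => φ' s * q r) r
      = ∫ r in (0 : ℝ)..t, (φ t * q r - φ r * q r) := by
    rw [intervalIntegral.integral_of_le ht]
    refine setIntegral_congr_fun measurableSet_Ioc fun r hr => ?_
    have h3 : ∀ s, (Iic s).indicator (fun r => φ' s * q r) r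
        = (Ici r).indicator (fun s => φ' s * q r) s := fun s => by
      simp only [indicator, mem_Iic, mem_Ici]
    simp_rw [h3]
    rw [setIntegral_indicator measurableSet_Ici, integral_mul_const]
    have h4 : Ioc 0 t ∩ Ici r = Icc r t := by
      ext s
      simp only [mem_Ioc, mem_inter_iff, mem_Ici, mem_Icc]
      have := hr.1
      constructor
      · rintro ⟨⟨_, b⟩, c⟩; exact ⟨c, b⟩
      · rintro ⟨a, b⟩; exact ⟨⟨this.trans_le a, b⟩, a⟩
    rw [h4, integral_Icc_eq_integral_Ioc, ← intervalIntegral.integral_of_le hr.2,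
      intervalIntegral.integral_eq_sub_of_hasDerivAt (fun x _ => hφ x)
        (hφ'.intervalIntegrable _ _), sub_mul]
  rw [h1, integral_integral_swap hint, h2, intervalIntegral.integral_sub (hq.const_mul _)
    (hq.continuousOn_mul hφc.continuousOn), intervalIntegral.integral_const_mul]
  ring

/-- The lemma of du Bois-Reymond on an open interval, with smooth test functions. -/
lemma ae_eq_const_of_integral_mul_deriv_eq_zero {I : Set ℝ} (hI : IsOpen I) (hc : I.OrdConnected)
    {k : ℝ → ℝ} (hk : LocallyIntegrableOn k I)
    (h : ∀ φ : ℝ → ℝ, ContDiff ℝ (⊤ : ℕ∞) φ → HasCompactSupport φ → tsupport φ ⊆ I →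
      ∫ x, k x * deriv φ x = 0) :
    ∃ c, ∀ᵐ x, x ∈ I → k x = c := by
  rcases I.eq_empty_or_nonempty with rfl | ⟨x₀, hx₀⟩
  · exact ⟨0, by simp⟩
  obtain ⟨r, hr, hball⟩ := Metric.isOpen_iff.1 hI x₀ hx₀
  let B : ContDiffBump x₀ := ⟨r / 4, r / 2, by linarith, by linarith⟩
  set η : ℝ → ℝ := B.normed volume with hη
  have hηs : ContDiff ℝ (⊤ : ℕ∞) η := B.contDiff_normed
  have hηc : HasCompactSupport η := B.hasCompactSupport_normed
  have hηI : tsupport η ⊆ I := by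
    rw [hη, B.tsupport_normed_eq]
    exact (Metric.closedBall_subset_ball (by simp only [B]; linarith)).trans hball
  have hη1 : ∫ x, η x = 1 := B.integral_normed
  have hint : ∀ θ : ℝ → ℝ, Continuous θ → HasCompactSupport θ → tsupport θ ⊆ I →
      Integrable fun x => θ x * k x := by
    intro θ hθ hθc hθI
    have h1 : IntegrableOn k (tsupport θ) := hk.integrableOn_compact_subset hθI hθc
    obtain ⟨C, hC⟩ := hθc.exists_bound_of_continuous hθ
    have h2 : IntegrableOn (fun x => θ x * k x) (tsupport θ) :=
      h1.bdd_mul hθ.aestronglyMeasurable (Eventually.of_forall hC)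
    refine (integrableOn_iff_integrable_of_support_subset fun x hx => ?_).1 h2
    exact subset_tsupport θ fun hx0 => hx (by simp [hx0])
  refine ⟨∫ x, η x * k x, ?_⟩
  set c := ∫ x, η x * k x with hcdef
  have hmain := hI.ae_eq_zero_of_integral_contDiff_smul_eq_zero (f := fun x => k x - c) (μ := volume)
    (hk.sub ((continuous_const.locallyIntegrable).locallyIntegrableOn I)) ?_
  · filter_upwards [hmain] with x hx hxI
    exact sub_eq_zero.1 (hx hxI)
  intro θ hθs hθc hθI
  have hθi : Integrable θ := hθs.continuous.integrable_of_hasCompactSupport hθc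
  have hηi : Integrable η := hηs.continuous.integrable_of_hasCompactSupport hηc
  set m := ∫ x, θ x with hm
  -- the mean-zero function `χ = θ - m η` has a compactly supported primitive `φ`
  set χ : ℝ → ℝ := fun x => θ x - m * η x with hχ
  have hχs : ContDiff ℝ (⊤ : ℕ∞) χ := hθs.sub (contDiff_const.mul hηs)
  have hχ0 : ∫ x, χ x = 0 := by
    rw [hχ, integral_sub hθi (hηi.const_mul m), integral_const_mul, hη1]; simp [hm]
  have hχi : Integrable χ := hθi.sub (hηi.const_mul m)
  set S := tsupport θ ∪ tsupport η with hS
  have hSc : IsCompact S := hθc.isCompact.union hηc.isCompact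
  have hSne : S.Nonempty := by
    by_contra hne
    rw [not_nonempty_iff_eq_empty, hS, union_empty_iff] at hne
    have : η = 0 := tsupport_eq_empty_iff.1 hne.2
    rw [this] at hη1
    simp at hη1
  have hSI : S ⊆ I := union_subset hθI hηI
  have hab : Icc (sInf S) (sSup S) ⊆ I :=
    hc.out (hSI (hSc.sInf_mem hSne)) (hSI (hSc.sSup_mem hSne))
  have hSab : S ⊆ Icc (sInf S) (sSup S) := fun x hx =>
    ⟨csInf_le hSc.bddBelow hx, le_csSup hSc.bddAbove hx⟩
  have hχout : ∀ x, x ∉ Icc (sInf S) (sSup S) → χ x = 0 := fun x hx => by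
    have hxS : x ∉ S := fun h => hx (hSab h)
    rw [hS, mem_union, not_or] at hxS
    simp [hχ, image_eq_zero_of_notMem_tsupport hxS.1, image_eq_zero_of_notMem_tsupport hxS.2]
  set φ : ℝ → ℝ := fun x => ∫ s in Iic x, χ s with hφ
  have hφd : ∀ x, HasDerivAt φ (χ x) x := fun x => by
    have h1 : ∀ y, φ y = φ 0 + ∫ s in (0 : ℝ)..y, χ s := fun y => by
      have := intervalIntegral.integral_Iic_sub_Iic (a := 0) (b := y) (hχi.integrableOn)
        (hχi.integrableOn)
      rw [← this]; simp [hφ]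
    have h2 := ((hχs.continuous.integral_hasStrictDerivAt 0 x).hasDerivAt).const_add (φ 0)
    exact h2.congr_of_eventuallyEq (Eventually.of_forall h1)
  have hφ' : deriv φ = χ := funext fun x => (hφd x).deriv
  have hφs : ContDiff ℝ (⊤ : ℕ∞) φ := by
    refine contDiff_infty_iff_deriv.2 ⟨fun x => (hφd x).differentiableAt, ?_⟩
    rw [hφ']; exact hχs
  have hφout : ∀ x, x ∉ Icc (sInf S) (sSup S) → φ x = 0 := fun x hx => by
    rw [mem_Icc, not_and_or, not_le, not_le] at hx
    rcases hx with hx | hx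
    · refine setIntegral_eq_zero_of_forall_eq_zero fun s hs => hχout s fun h => ?_
      exact absurd (h.1.trans hs) (not_le.2 hx)
    · rw [hφ]
      simp only
      rw [← hχ0, setIntegral_eq_integral_of_forall_compl_eq_zero]
      intro s hs
      refine hχout s fun h => hs (h.2.trans hx.le)
  have hφI : tsupport φ ⊆ Icc (sInf S) (sSup S) :=
    closure_minimal (fun x hx => by_contra fun h => hx (hφout x h)) isClosed_Icc
  have hφc : HasCompactSupport φ := isCompact_Icc.of_isClosed_subset (isClosed_tsupport φ) hφI
  have key := h φ hφs hφc (hφI.trans hab)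
  rw [hφ'] at key
  have h1 := hint θ hθs.continuous hθc hθI
  have h2 := hint η hηs.continuous hηc hηI
  have h3 : ∫ x, k x * χ x = (∫ x, θ x * k x) - m * c := by
    rw [hcdef, ← integral_const_mul, ← integral_sub h1 (h2.const_mul m)]
    refine integral_congr_ae (Eventually.of_forall fun x => ?_)
    simp only [hχ]; ring
  have h4 : ∫ x, θ x • (k x - c) = (∫ x, θ x * k x) - m * c := by
    rw [hm, ← integral_mul_const, ← integral_sub h1 (hθi.mul_const c)]
    refine integral_congr_ae (Eventually.of_forall fun x => ?_)
    simp only [smul_eq_mul]; ring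
  rw [h4, ← h3, key]

/-! ### Multiplication operators, pairings and integrals in Lebesgue spaces -/

/-- A bounded measurable function. -/
structure BddMeasurable {α F : Type*} [MeasurableSpace α] [NormedAddCommGroup F]
    (v : α → F) : Prop where
  meas : StronglyMeasurable v
  bdd : ∃ C, ∀ x, ‖v x‖ ≤ C

section Lp

variable {α : Type*} [MeasurableSpace α] {μ : Measure α} {p : ℝ≥0∞}

lemma BddMeasurable.of_continuous {α F : Type*} [TopologicalSpace α] [MeasurableSpace α]
    [OpensMeasurableSpace α] [SecondCountableTopology α] [NormedAddCommGroup F]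
    {v : α → F} (hv : Continuous v) {C : ℝ} (hC : ∀ x, ‖v x‖ ≤ C) : BddMeasurable v :=
  ⟨hv.stronglyMeasurable, C, hC⟩

lemma memLp_bdd_mul {b : α → ℝ} (hb : BddMeasurable b) {f : α → ℝ} (hf : MemLp f p μ) :
    MemLp (fun x => b x * f x) p μ := by
  obtain ⟨C, hC⟩ := hb.bdd
  refine hf.of_le_mul (c := C) (hb.meas.aestronglyMeasurable.mul hf.1)
    (Eventually.of_forall fun x => ?_)
  rw [norm_mul]
  exact mul_le_mul_of_nonneg_right (hC x) (norm_nonneg _)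

/-- The product of a bounded measurable function and an element of `L^p`. -/
def mulFun (b : α → ℝ) (hb : BddMeasurable b) (f : Lp ℝ p μ) : Lp ℝ p μ :=
  (memLp_bdd_mul hb (Lp.memLp f)).toLp _

lemma coeFn_mulFun (b : α → ℝ) (hb : BddMeasurable b) (f : Lp ℝ p μ) :
    mulFun b hb f =ᵐ[μ] fun x => b x * f x := MemLp.coeFn_toLp _

lemma norm_mulFun_le {b : α → ℝ} (hb : BddMeasurable b) {C : ℝ} (hC : ∀ x, |b x| ≤ C)
    (f : Lp ℝ p μ) : ‖mulFun b hb f‖ ≤ C * ‖f‖ := by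
  refine Lp.norm_le_mul_norm_of_ae_le_mul ?_
  filter_upwards [coeFn_mulFun b hb f] with x hx
  rw [hx, norm_mul]
  exact mul_le_mul_of_nonneg_right (hC x) (norm_nonneg _)

variable [hp1 : Fact (1 ≤ p)]

/-- Multiplication by a bounded measurable function, as an operator on `L^p`. -/
def mulOp (b : α → ℝ) (hb : BddMeasurable b) : Lp ℝ p μ →L[ℝ] Lp ℝ p μ :=
  LinearMap.mkContinuousOfExistsBound
    { toFun := mulFun b hb
      map_add' := fun f g => by
        refine Lp.ext ?_
        filter_upwards [coeFn_mulFun b hb (f + g), Lp.coeFn_add f g,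
          Lp.coeFn_add (mulFun b hb f) (mulFun b hb g), coeFn_mulFun b hb f,
          coeFn_mulFun b hb g] with x h1 h2 h3 h4 h5
        rw [h1, h2, h3, Pi.add_apply, Pi.add_apply, h4, h5, mul_add]
      map_smul' := fun c f => by
        refine Lp.ext ?_
        filter_upwards [coeFn_mulFun b hb (c • f), Lp.coeFn_smul c f,
          Lp.coeFn_smul c (mulFun b hb f), coeFn_mulFun b hb f] with x h1 h2 h3 h4
        rw [h1, h2, RingHom.id_apply, h3, Pi.smul_apply, Pi.smul_apply, h4, smul_eq_mul,
          smul_eq_mul]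
        ring }
    (by
      obtain ⟨C, hC⟩ := hb.bdd
      exact ⟨C, fun f => norm_mulFun_le hb hC f⟩)

lemma coeFn_mulOp (b : α → ℝ) (hb : BddMeasurable b) (f : Lp ℝ p μ) :
    mulOp b hb f =ᵐ[μ] fun x => b x * f x := coeFn_mulFun b hb f

lemma norm_mulOp_le {b : α → ℝ} (hb : BddMeasurable b) {C : ℝ} (hC : ∀ x, |b x| ≤ C)
    (f : Lp ℝ p μ) : ‖mulOp b hb f‖ ≤ C * ‖f‖ := norm_mulFun_le hb hC f

/-- A map into a separable metric space is measurable if its distances to all points are. -/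
lemma measurable_of_measurable_dist {X E : Type*} [MeasurableSpace X] [PseudoMetricSpace E]
    [SecondCountableTopology E] [MeasurableSpace E] [BorelSpace E] {F : X → E}
    (h : ∀ g, Measurable fun x => dist (F x) g) : Measurable F := by
  refine measurable_of_isOpen fun U hU => ?_
  have hr : ∀ u : E, ∃ r, u ∈ U → 0 < r ∧ Metric.ball u r ⊆ U := fun u => by
    by_cases hu : u ∈ U
    · obtain ⟨r, h1, h2⟩ := Metric.isOpen_iff.1 hU u hu
      exact ⟨r, fun _ => ⟨h1, h2⟩⟩
    · exact ⟨0, fun h => absurd h hu⟩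
  choose r hr using hr
  obtain ⟨T, hTU, hT, hTe⟩ := TopologicalSpace.isOpen_biUnion_countable U
    (fun u => Metric.ball u (r u)) fun u _ => Metric.isOpen_ball
  have hUe : U = ⋃ u ∈ T, Metric.ball u (r u) := by
    rw [hTe]
    refine Subset.antisymm (fun u hu => ?_) (iUnion₂_subset fun u hu => (hr u hu).2)
    exact mem_iUnion₂.2 ⟨u, hu, Metric.mem_ball_self (hr u hu).1⟩
  rw [hUe, preimage_iUnion₂]
  exact MeasurableSet.biUnion hT fun u _ => measurableSet_lt (h u) measurable_const

/-- A jointly measurable function with sections in `L^p` is a strongly measurable map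
into `L^p`. -/
lemma stronglyMeasurable_toLp [SFinite μ] [IsSeparable μ] (hp : p ≠ ∞)
    {X : Type*} [MeasurableSpace X] {f : X → α → ℝ} (hf : Measurable (Function.uncurry f))
    {F : X → Lp ℝ p μ} (hF : ∀ x, F x =ᵐ[μ] f x) : StronglyMeasurable F := by
  have : Fact (p ≠ ∞) := ⟨hp⟩
  let _ : MeasurableSpace (Lp ℝ p μ) := borel _
  have : BorelSpace (Lp ℝ p μ) := ⟨rfl⟩
  refine Measurable.stronglyMeasurable (measurable_of_measurable_dist fun g => ?_)
  have hp0 : p ≠ 0 := (one_pos.trans_le hp1.out).ne'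
  have hg := (Lp.stronglyMeasurable g).measurable
  have he : ∀ x, dist (F x) g
      = ((∫⁻ y, ‖f x y - g y‖ₑ ^ p.toReal ∂μ) ^ (1 / p.toReal)).toReal := fun x => by
    rw [Lp.dist_def, eLpNorm_congr_ae ((hF x).sub (ae_eq_refl (g : α → ℝ))),
      eLpNorm_eq_lintegral_rpow_enorm_toReal hp0 hp]
    rfl
  simp_rw [he]
  refine ((Measurable.lintegral_prod_right' (f := fun z : X × α => ‖f z.1 z.2 - g z.2‖ₑ ^ p.toReal)
    ?_).pow_const _).ennreal_toReal
  exact ((hf.sub (hg.comp measurable_snd)).enorm).pow_const _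

lemma integrable_of_lp [IsFiniteMeasure μ] (f : Lp ℝ p μ) : Integrable f μ :=
  (Lp.memLp f).integrable hp1.out

lemma integral_norm_le_norm [IsProbabilityMeasure μ] (f : Lp ℝ p μ) :
    ∫ x, ‖f x‖ ∂μ ≤ ‖f‖ := by
  rw [Lp.norm_def, integral_norm_eq_lintegral_enorm (Lp.aestronglyMeasurable f)]
  refine ENNReal.toReal_mono (Lp.eLpNorm_ne_top f) ?_
  rw [← eLpNorm_one_eq_lintegral_enorm]
  exact eLpNorm_le_eLpNorm_of_exponent_le hp1.out (Lp.aestronglyMeasurable f)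

section Pairing

variable [IsProbabilityMeasure μ] {𝕜 : Type*} [RCLike 𝕜]

lemma integrable_pairing {v : α → 𝕜} (hv : BddMeasurable v) (f : Lp ℝ p μ) :
    Integrable (fun x => (f x : 𝕜) * v x) μ := by
  obtain ⟨C, hC⟩ := hv.bdd
  exact (integrable_of_lp f).ofReal.mul_bdd (c := C) hv.meas.aestronglyMeasurable
    (Eventually.of_forall hC)

/-- The functional `f ↦ ∫ f v` on `L^p`, for a bounded measurable function `v`. -/
def pairing (v : α → 𝕜) (hv : BddMeasurable v) : Lp ℝ p μ →L[ℝ] 𝕜 :=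
  LinearMap.mkContinuousOfExistsBound
    { toFun := fun f => ∫ x, (f x : 𝕜) * v x ∂μ
      map_add' := fun f g => by
        rw [← integral_add (integrable_pairing hv f) (integrable_pairing hv g)]
        refine integral_congr_ae ?_
        filter_upwards [Lp.coeFn_add f g] with x hx
        rw [hx, Pi.add_apply, RCLike.ofReal_add, add_mul]
      map_smul' := fun c f => by
        rw [RingHom.id_apply, ← integral_smul]
        refine integral_congr_ae ?_
        filter_upwards [Lp.coeFn_smul c f] with x hx
        rw [hx, Pi.smul_apply, smul_eq_mul, RCLike.ofReal_mul, mul_assoc, RCLike.real_smul_eq_coe_mul] }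
    (by
      obtain ⟨C, hC⟩ := hv.bdd
      refine ⟨C, fun f => ?_⟩
      have hC0 : 0 ≤ C := by
        by_contra hneg
        have : IsEmpty α := ⟨fun x => hneg ((norm_nonneg _).trans (hC x))⟩
        have h1 : μ univ = 0 := by simp [univ_eq_empty_iff.2 this]
        simp at h1
      calc ‖∫ x, (f x : 𝕜) * v x ∂μ‖ ≤ ∫ x, C * ‖f x‖ ∂μ := by
            refine norm_integral_le_of_norm_le ((integrable_of_lp f).norm.const_mul C)
              (Eventually.of_forall fun x => ?_)
            rw [norm_mul, mul_comm, RCLike.norm_ofReal, Real.norm_eq_abs]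
            exact mul_le_mul_of_nonneg_right (hC x) (abs_nonneg _)
        _ = C * ∫ x, ‖f x‖ ∂μ := integral_const_mul _ _
        _ ≤ C * ‖f‖ := mul_le_mul_of_nonneg_left (integral_norm_le_norm f) hC0)

lemma pairing_real_apply (v : α → ℝ) (hv : BddMeasurable v) (f : Lp ℝ p μ) :
    pairing v hv f = ∫ x, f x * v x ∂μ := rfl

end Pairing

/-- A Bochner integral in `L^p` is computed pointwise. -/
lemma coeFn_intervalIntegral [IsProbabilityMeasure μ] {F : ℝ → Lp ℝ p μ} {f : ℝ → α → ℝ}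
    (hf : Measurable (Function.uncurry f)) (hF : ∀ r, F r =ᵐ[μ] f r) {a b : ℝ} (hab : a ≤ b)
    (hi : IntervalIntegrable F volume a b) :
    (∫ r in a..b, F r : Lp ℝ p μ) =ᵐ[μ] fun y => ∫ r in a..b, f r y := by
  have hi' : Integrable F (volume.restrict (Ioc a b)) :=
    (intervalIntegrable_iff_integrableOn_Ioc_of_le hab).1 hi
  have hprod : Integrable (Function.uncurry f) ((volume.restrict (Ioc a b)).prod μ) := by
    rw [integrable_prod_iff hf.aestronglyMeasurable]
    refine ⟨Eventually.of_forall fun r => (integrable_of_lp (F r)).congr (hF r), ?_⟩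
    refine hi'.norm.mono' ?_ (Eventually.of_forall fun r => ?_)
    · exact (hf.norm.stronglyMeasurable.integral_prod_right').aestronglyMeasurable
    · rw [Real.norm_of_nonneg (integral_nonneg fun _ => norm_nonneg _)]
      refine le_of_eq_of_le (integral_congr_ae ?_) (integral_norm_le_norm (F r))
      filter_upwards [hF r] with y hy
      rw [hy]; rfl
  simp only [intervalIntegral.integral_of_le hab]
  refine Integrable.ae_eq_of_forall_setIntegral_eq _ _ (integrable_of_lp _)
    hprod.integral_prod_right fun s hs _ => ?_
  have hv : BddMeasurable (s.indicator fun _ => (1 : ℝ)) :=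
    ⟨stronglyMeasurable_const.indicator hs, 1, fun x => by
      by_cases hx : x ∈ s <;> simp [hx]⟩
  have hpair : ∀ g : Lp ℝ p μ, pairing _ hv g = ∫ x in s, g x ∂μ := fun g => by
    rw [pairing_real_apply, ← integral_indicator hs]
    refine integral_congr_ae (Eventually.of_forall fun x => ?_)
    by_cases hx : x ∈ s <;> simp [hx]
  rw [← hpair, ← ContinuousLinearMap.integral_comp_comm _ hi']
  simp_rw [hpair]
  have h1 : ∀ r, ∫ x in s, F r x ∂μ = ∫ x in s, f r x ∂μ := fun r =>
    integral_congr_ae (ae_restrict_of_ae (hF r))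
  simp_rw [h1]
  refine integral_integral_swap ?_
  exact hprod.mono_measure (by
    conv_lhs => rw [← Measure.restrict_univ (μ := volume.restrict (Ioc a b))]
    rw [Measure.prod_restrict]
    exact Measure.restrict_le_self)

end Lp

/-! ### Doubly stochastic operators and Doeblin's condition -/

section Stochastic

variable {α : Type*} [MeasurableSpace α] {μ : Measure α} [IsProbabilityMeasure μ] {p : ℝ≥0∞}
  [hp1 : Fact (1 ≤ p)]

lemma bddMeasurable_const {α F : Type*} [MeasurableSpace α] [NormedAddCommGroup F] (c : F) :
    BddMeasurable fun _ : α => c :=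
  ⟨stronglyMeasurable_const, ‖c‖, fun _ => le_rfl⟩

/-- The mean value, as a functional on `L^p`. -/
def mean : Lp ℝ p μ →L[ℝ] ℝ := pairing (fun _ => 1) (bddMeasurable_const 1)

lemma mean_apply (f : Lp ℝ p μ) : mean f = ∫ x, f x ∂μ := by
  simp [mean, pairing_real_apply]

/-- The constant function `1` in `L^p`. -/
def one : Lp ℝ p μ := Lp.const p μ 1

lemma coeFn_one : (one : Lp ℝ p μ) =ᵐ[μ] fun _ => 1 := Lp.coeFn_const p μ 1

lemma mean_one : mean (one : Lp ℝ p μ) = 1 := by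
  rw [mean_apply, integral_congr_ae coeFn_one]
  simp

lemma one_nonneg : (0 : Lp ℝ p μ) ≤ one := by
  rw [← Lp.coeFn_le]
  filter_upwards [Lp.coeFn_zero ℝ p μ, coeFn_one (μ := μ) (p := p)] with x h1 h2
  rw [h1, h2]; exact zero_le_one

lemma mean_nonneg {f : Lp ℝ p μ} (hf : 0 ≤ f) : 0 ≤ mean f := by
  rw [mean_apply]
  exact integral_nonneg_of_ae ((Lp.coeFn_nonneg f).2 hf)

instance : IsOrderedModule ℝ (Lp ℝ p μ) :=
  IsOrderedModule.of_smul_nonneg fun c hc f hf => by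
    rw [← Lp.coeFn_nonneg] at hf ⊢
    filter_upwards [Lp.coeFn_smul c f, hf] with x h1 h2
    rw [h1]
    exact mul_nonneg hc h2

/-- A positive operator that preserves the constants and the mean value. -/
structure IsDoublyStochastic (Q : Lp ℝ p μ →L[ℝ] Lp ℝ p μ) : Prop where
  nonneg : ∀ f, 0 ≤ f → 0 ≤ Q f
  map_one : Q one = one
  mean_map : ∀ f, mean (Q f) = mean f

/-- The tangent lines of `x ↦ x ^ q` lie below its graph. -/
lemma tangent_le_rpow {q x c : ℝ} (hq : 1 ≤ q) (hx : 0 ≤ x) (hc : 0 ≤ c) :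
    (1 - q) * c ^ q + q * c ^ (q - 1) * x ≤ x ^ q := by
  have hq0 : 0 < q := by linarith
  have h := Real.geom_mean_le_arith_mean2_weighted (w₁ := 1 / q) (w₂ := 1 - 1 / q)
    (p₁ := x ^ q) (p₂ := c ^ q) (by positivity)
    (by rw [sub_nonneg, div_le_one hq0]; exact hq) (by positivity) (by positivity) (by ring)
  rw [← Real.rpow_mul hx, ← Real.rpow_mul hc, mul_one_div_cancel hq0.ne', Real.rpow_one] at h
  have h2 : q * (1 - 1 / q) = q - 1 := by field_simp
  rw [h2] at h
  have h3 := mul_le_mul_of_nonneg_left h hq0.le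
  have h4 : q * (1 / q * x ^ q + (1 - 1 / q) * c ^ q) = x ^ q + (q - 1) * c ^ q := by
    field_simp
  rw [h4] at h3
  nlinarith

lemma norm_le_norm_of_integral_rpow_le {μ : Measure α} (hp : p ≠ ∞) {f g : Lp ℝ p μ}
    (h : ∫ x, ‖f x‖ ^ p.toReal ∂μ ≤ ∫ x, ‖g x‖ ^ p.toReal ∂μ) : ‖f‖ ≤ ‖g‖ := by
  have hp0 : p ≠ 0 := (one_pos.trans_le hp1.out).ne'
  rw [Lp.norm_def, Lp.norm_def, (Lp.memLp f).eLpNorm_eq_integral_rpow_norm hp0 hp,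
    (Lp.memLp g).eLpNorm_eq_integral_rpow_norm hp0 hp]
  refine ENNReal.toReal_mono ENNReal.ofReal_ne_top (ENNReal.ofReal_le_ofReal ?_)
  exact Real.rpow_le_rpow (integral_nonneg fun x => by positivity) h
    (inv_nonneg.2 ENNReal.toReal_nonneg)

/-- Jensen's inequality for a doubly stochastic operator, on bounded nonnegative functions. -/
lemma IsDoublyStochastic.norm_le_of_nonneg (hp : p ≠ ∞) {Q : Lp ℝ p μ →L[ℝ] Lp ℝ p μ}
    (hQ : IsDoublyStochastic Q) {f : Lp ℝ p μ} (hf : 0 ≤ f) {C : ℝ} (hC : ∀ᵐ x ∂μ, f x ≤ C) :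
    ‖Q f‖ ≤ ‖f‖ := by
  set q := p.toReal with hq
  have hq1 : 1 ≤ q := by
    have := ENNReal.toReal_mono hp hp1.out
    simpa using this
  have hp0 : p ≠ 0 := (one_pos.trans_le hp1.out).ne'
  have hfa := (Lp.coeFn_nonneg f).2 hf
  have hQfa := (Lp.coeFn_nonneg (Q f)).2 (hQ.nonneg f hf)
  have hgm : MemLp (fun x => f x ^ q) p μ := by
    refine MemLp.of_bound
      ((Lp.stronglyMeasurable f).measurable.pow_const q).aestronglyMeasurable (C ^ q) ?_
    filter_upwards [hfa, hC] with x h0 h1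
    simp only [Pi.zero_apply] at h0
    rw [Real.norm_of_nonneg (by positivity)]
    exact Real.rpow_le_rpow h0 h1 (by linarith)
  set g : Lp ℝ p μ := hgm.toLp _ with hg
  have hga : g =ᵐ[μ] fun x => f x ^ q := hgm.coeFn_toLp
  have htan : ∀ c : ℝ, 0 ≤ c → ∀ᵐ x ∂μ, (1 - q) * c ^ q + q * c ^ (q - 1) * Q f x ≤ Q g x := by
    intro c hc
    have h1 : ((1 - q) * c ^ q) • one + (q * c ^ (q - 1)) • f ≤ g := by
      rw [← Lp.coeFn_le]
      filter_upwards [Lp.coeFn_add (((1 - q) * c ^ q) • one) ((q * c ^ (q - 1)) • f),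
        Lp.coeFn_smul ((1 - q) * c ^ q) (one : Lp ℝ p μ), Lp.coeFn_smul (q * c ^ (q - 1)) f,
        coeFn_one (μ := μ) (p := p), hga, hfa] with x a1 a2 a3 a4 a5 a6
      rw [a1, Pi.add_apply, a2, a3, Pi.smul_apply, Pi.smul_apply, a4, a5]
      simpa using tangent_le_rpow hq1 a6 hc
    have h2 := hQ.nonneg _ (sub_nonneg.2 h1)
    rw [map_sub, sub_nonneg, map_add, map_smul, map_smul, hQ.map_one, ← Lp.coeFn_le] at h2
    filter_upwards [h2, Lp.coeFn_add (((1 - q) * c ^ q) • one) ((q * c ^ (q - 1)) • Q f),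
        Lp.coeFn_smul ((1 - q) * c ^ q) (one : Lp ℝ p μ), Lp.coeFn_smul (q * c ^ (q - 1)) (Q f),
        coeFn_one (μ := μ) (p := p)] with x a0 a1 a2 a3 a4
    rw [a1, Pi.add_apply, a2, a3, Pi.smul_apply, Pi.smul_apply, a4] at a0
    simpa using a0
  -- The tangents at rational points suffice to recover `x ↦ x ^ q`.
  have hpow : ∀ᵐ x ∂μ, ‖Q f x‖ ^ q ≤ Q g x := by
    have hall : ∀ᵐ x ∂μ, ∀ r : ℚ,
        (1 - q) * |(r : ℝ)| ^ q + q * |(r : ℝ)| ^ (q - 1) * Q f x ≤ Q g x :=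
      ae_all_iff.2 fun r => htan _ (abs_nonneg _)
    filter_upwards [hall, hQfa] with x hx h0
    simp only [Pi.zero_apply] at h0
    have hclosed : IsClosed {r : ℝ |
        (1 - q) * |r| ^ q + q * |r| ^ (q - 1) * Q f x ≤ Q g x} := by
      refine isClosed_le ?_ continuous_const
      have c1 : Continuous fun r : ℝ => |r| ^ q :=
        (Real.continuous_rpow_const (by linarith)).comp continuous_abs
      have c2 : Continuous fun r : ℝ => |r| ^ (q - 1) :=
        (Real.continuous_rpow_const (by linarith)).comp continuous_abs
      fun_prop
    have h1 := hclosed.closure_subset_iff.2 (range_subset_iff.2 hx)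
      (Rat.denseRange_cast (𝕜 := ℝ) (Q f x))
    rw [mem_ofPred_eq, abs_of_nonneg h0] at h1
    rw [Real.norm_of_nonneg h0]
    refine le_of_eq_of_le ?_ h1
    rcases eq_or_lt_of_le h0 with h | h
    · have hq0 : q ≠ 0 := by linarith
      simp [← h, Real.zero_rpow hq0]
    · rw [Real.rpow_sub_one h.ne']
      field_simp
      ring
  refine norm_le_norm_of_integral_rpow_le hp ?_
  calc ∫ x, ‖Q f x‖ ^ q ∂μ ≤ ∫ x, Q g x ∂μ :=
        integral_mono_ae ((Lp.memLp (Q f)).integrable_norm_rpow hp0 hp) (integrable_of_lp _) hpow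
    _ = ∫ x, g x ∂μ := by rw [← mean_apply, hQ.mean_map, mean_apply]
    _ = ∫ x, ‖f x‖ ^ q ∂μ := by
        refine integral_congr_ae ?_
        filter_upwards [hga, hfa] with x h1 h2
        simp only [Pi.zero_apply] at h2
        rw [h1, Real.norm_of_nonneg h2]

/-- A doubly stochastic operator is a contraction of `L^p`. -/
lemma IsDoublyStochastic.norm_le (hp : p ≠ ∞) {Q : Lp ℝ p μ →L[ℝ] Lp ℝ p μ}
    (hQ : IsDoublyStochastic Q) (f : Lp ℝ p μ) : ‖Q f‖ ≤ ‖f‖ := by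
  refine (Lp.simpleFunc.denseRange (E := ℝ) (μ := μ) hp).induction_on
    (p := fun f => ‖Q f‖ ≤ ‖f‖) f
    (isClosed_le (Q.continuous.norm) continuous_norm) fun s => ?_
  set f : Lp ℝ p μ := s.1 with hfs
  obtain ⟨C, hC⟩ : ∃ C : ℝ, ∀ᵐ x ∂μ, |f| x ≤ C := by
    obtain ⟨C, hC⟩ := (Lp.simpleFunc.toSimpleFunc s).exists_forall_norm_le
    refine ⟨C, ?_⟩
    filter_upwards [Lp.simpleFunc.toSimpleFunc_eq_toFun s, Lp.coeFn_abs f] with x h1 h2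
    rw [h2, ← Real.norm_eq_abs, hfs, ← h1]
    exact hC x
  have h1 : |Q f| ≤ Q |f| := by
    refine abs_le'.2 ⟨?_, ?_⟩
    · have := hQ.nonneg _ (sub_nonneg.2 (le_abs_self f))
      rwa [map_sub, sub_nonneg] at this
    · have := hQ.nonneg _ (sub_nonneg.2 (neg_le_abs f))
      rwa [map_sub, map_neg, sub_nonneg] at this
  calc ‖Q f‖ ≤ ‖Q |f|‖ := norm_le_norm_of_abs_le_abs (h1.trans (le_abs_self _))
    _ ≤ ‖|f|‖ := hQ.norm_le_of_nonneg hp (abs_nonneg f) hC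
    _ = ‖f‖ := norm_abs_eq_norm f

/-- Doeblin's condition: a doubly stochastic operator with a uniform lower bound contracts the
functions of mean zero. -/
lemma IsDoublyStochastic.norm_le_of_doeblin (hp : p ≠ ∞) {S : Lp ℝ p μ →L[ℝ] Lp ℝ p μ}
    (hS : IsDoublyStochastic S) {δ : ℝ} (hδ : δ < 1)
    (hlow : ∀ f, 0 ≤ f → (δ * mean f) • one ≤ S f) {f : Lp ℝ p μ} (hf : mean f = 0) :
    ‖S f‖ ≤ (1 - δ) * ‖f‖ := by
  have hδ' : 0 < 1 - δ := by linarith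
  let Q : Lp ℝ p μ →L[ℝ] Lp ℝ p μ := (1 - δ)⁻¹ • (S - (δ • mean).smulRight one)
  have hQa : ∀ g, Q g = (1 - δ)⁻¹ • (S g - (δ * mean g) • one) := fun g => rfl
  have hQ : IsDoublyStochastic Q := by
    refine ⟨fun g hg => ?_, ?_, fun g => ?_⟩
    · rw [hQa]
      exact smul_nonneg (inv_nonneg.2 hδ'.le) (sub_nonneg.2 (hlow g hg))
    · rw [hQa, hS.map_one, mean_one, mul_one, ← one_smul ℝ (one : Lp ℝ p μ), smul_smul, ← sub_smul,
        smul_smul, mul_one, inv_mul_cancel₀ hδ'.ne']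
    · rw [hQa, map_smul, map_sub, map_smul, mean_one, hS.mean_map, smul_eq_mul, smul_eq_mul]
      field_simp
  have h1 := hQ.norm_le hp f
  rw [hQa, hf, mul_zero, zero_smul, sub_zero, norm_smul, norm_inv, Real.norm_of_nonneg hδ'.le,
    inv_mul_le_iff₀ hδ'] at h1
  exact h1

end Stochastic

/-! ### Integrals with values in an ordered Banach space -/

section OrderedIntegral

variable {E : Type*} [NormedAddCommGroup E] [NormedSpace ℝ E] [PartialOrder E]
  [IsOrderedAddMonoid E] [IsOrderedModule ℝ E] [OrderClosedTopology E]

lemma intervalIntegral_nonneg {F : ℝ → E} {a b : ℝ} (hab : a ≤ b)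
    (h : ∀ x ∈ Ioc a b, 0 ≤ F x) : 0 ≤ ∫ x in a..b, F x := by
  rw [intervalIntegral.integral_of_le hab]
  exact integral_nonneg_of_ae ((ae_restrict_iff' measurableSet_Ioc).2 (Eventually.of_forall h))

lemma intervalIntegral_mono {F G : ℝ → E} {a b : ℝ} (hab : a ≤ b)
    (hF : IntervalIntegrable F volume a b) (hG : IntervalIntegrable G volume a b)
    (h : ∀ x ∈ Ioc a b, F x ≤ G x) : ∫ x in a..b, F x ≤ ∫ x in a..b, G x := by
  rw [← sub_nonneg, ← intervalIntegral.integral_sub hG hF]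
  exact intervalIntegral_nonneg hab fun x hx => sub_nonneg.2 (h x hx)

lemma intervalIntegral_mono_interval {F : ℝ → E} (hF : Continuous F) (h : ∀ x, 0 ≤ F x)
    {a b c d : ℝ} (hca : c ≤ a) (hbd : b ≤ d) :
    ∫ x in a..b, F x ≤ ∫ x in c..d, F x := by
  have hi : ∀ u v, IntervalIntegrable F volume u v := fun u v => hF.intervalIntegrable u v
  have e : ∫ x in c..d, F x
      = (∫ x in c..a, F x) + (∫ x in a..b, F x) + ∫ x in b..d, F x := by
    rw [intervalIntegral.integral_add_adjacent_intervals (hi _ _) (hi _ _),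
      intervalIntegral.integral_add_adjacent_intervals (hi _ _) (hi _ _)]
  rw [e]
  have h1 := intervalIntegral_nonneg hca fun x _ => h x
  have h2 := intervalIntegral_nonneg hbd fun x _ => h x
  calc ∫ x in a..b, F x = 0 + (∫ x in a..b, F x) + 0 := by abel
    _ ≤ _ := by gcongr

lemma const_smul_le_intervalIntegral [CompleteSpace E] {G : ℝ → E} (hG : Continuous G) {v : E}
    {a b : ℝ} (hab : a ≤ b) (h : ∀ x ∈ Ioc a b, v ≤ G x) : (b - a) • v ≤ ∫ x in a..b, G x := by
  rw [← intervalIntegral.integral_const]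
  exact intervalIntegral_mono hab intervalIntegrable_const (hG.intervalIntegrable _ _) h

/-- Averaging over two intervals, of lengths `h ≤ L`, dominates an average over an interval of
length `L + h / 3`. -/
lemma smul_integral_le_integral_integral [CompleteSpace E] {F : ℝ → E} (hF : Continuous F)
    (hpos : ∀ x, 0 ≤ F x) {h L : ℝ} (hh : 0 < h) (hL : h ≤ L) :
    (h / 3) • ∫ x in (0 : ℝ)..L + h / 3, F (x + h / 3)
      ≤ ∫ σ in (0 : ℝ)..h, ∫ η in (0 : ℝ)..L, F (σ + η) := by
  have hi : ∀ u v, IntervalIntegrable F volume u v := fun u v => hF.intervalIntegrable u v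
  set G : ℝ → E := fun σ => ∫ η in σ..σ + L, F η with hGdef
  have hGe : ∀ σ, ∫ η in (0 : ℝ)..L, F (σ + η) = G σ := fun σ => by
    rw [intervalIntegral.integral_comp_add_left, add_zero]
  have hG : Continuous G := by
    have hc := intervalIntegral.continuous_primitive hi 0
    have : G = fun σ => (∫ η in (0 : ℝ)..σ + L, F η) - ∫ η in (0 : ℝ)..σ, F η := by
      ext σ
      rw [intervalIntegral.integral_interval_sub_left (hi _ _) (hi _ _)]
    rw [this]
    exact (hc.comp (continuous_add_const L)).sub hc
  have hGpos : ∀ σ, 0 ≤ G σ := fun σ => intervalIntegral_nonneg (by linarith) fun x _ => hpos x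
  simp_rw [hGe]
  rw [intervalIntegral.integral_comp_add_right, zero_add]
  have hGi : ∀ u v, IntervalIntegrable G volume u v := fun u v => hG.intervalIntegrable u v
  have e : ∫ σ in (0 : ℝ)..h, G σ = (∫ σ in (0 : ℝ)..h / 3, G σ)
      + (∫ σ in h / 3..2 * h / 3, G σ) + ∫ σ in 2 * h / 3..h, G σ := by
    rw [intervalIntegral.integral_add_adjacent_intervals (hGi _ _) (hGi _ _),
      intervalIntegral.integral_add_adjacent_intervals (hGi _ _) (hGi _ _)]
  have h1 : (h / 3) • ∫ x in h / 3..L, F x ≤ ∫ σ in (0 : ℝ)..h / 3, G σ := by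
    have := const_smul_le_intervalIntegral hG (v := ∫ x in h / 3..L, F x) (a := 0) (b := h / 3)
      (by linarith) fun σ hσ =>
        intervalIntegral_mono_interval hF hpos hσ.2 (by linarith [hσ.1])
    rwa [sub_zero] at this
  have h2 : (h / 3) • ∫ x in L..L + h / 3 + h / 3, F x ≤ ∫ σ in 2 * h / 3..h, G σ := by
    have := const_smul_le_intervalIntegral hG (v := ∫ x in L..L + h / 3 + h / 3, F x)
      (a := 2 * h / 3) (b := h) (by linarith) fun σ hσ =>
        intervalIntegral_mono_interval hF hpos (by linarith [hσ.2]) (by linarith [hσ.1])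
    rwa [show h - 2 * h / 3 = h / 3 by ring] at this
  have h3 : 0 ≤ ∫ σ in h / 3..2 * h / 3, G σ :=
    intervalIntegral_nonneg (by linarith) fun x _ => hGpos x
  rw [← intervalIntegral.integral_add_adjacent_intervals (hi (h / 3) L) (hi L _), smul_add, e]
  calc _ = (h / 3) • (∫ x in h / 3..L, F x) + 0
        + (h / 3) • ∫ x in L..L + h / 3 + h / 3, F x := by abel
    _ ≤ _ := by gcongr

end OrderedIntegral

/-! ### Translations and reflection on the circle -/

instance : Fact ((0 : ℝ) < 2) := ⟨two_pos⟩

/-- The circle of length `2`, the double of the interval `(0, 1)`. -/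
abbrev Circ := AddCircle (2 : ℝ)

/-- The invariant probability measure on the circle. -/
abbrev circMeasure : Measure Circ := AddCircle.haarAddCircle

instance : circMeasure.IsAddHaarMeasure := by
  unfold circMeasure AddCircle.haarAddCircle; infer_instance

/-- The Lebesgue space `L^p` of the circle. -/
abbrev CircLp (p : ℝ≥0∞) := Lp ℝ p circMeasure

section Circle

variable {p : ℝ≥0∞} [hp1 : Fact (1 ≤ p)]

/-- The translation `f ↦ f(· + s)`. -/
def translate (s : ℝ) : CircLp p →ₗᵢ[ℝ] CircLp p :=
  Lp.compMeasurePreservingₗᵢ ℝ (fun x : Circ => x + (s : Circ))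
    (measurePreserving_add_right circMeasure _)

/-- The reflection `f ↦ f(-·)`. -/
def reflect : CircLp p →ₗᵢ[ℝ] CircLp p :=
  Lp.compMeasurePreservingₗᵢ ℝ (fun x : Circ => -x) (Measure.measurePreserving_neg circMeasure)

lemma translate_ae (s : ℝ) {F : CircLp p} {f : Circ → ℝ} (h : F =ᵐ[circMeasure] f) :
    translate s F =ᵐ[circMeasure] fun x => f (x + (s : Circ)) :=
  (Lp.coeFn_compMeasurePreserving F _).trans
    ((measurePreserving_add_right circMeasure (s : Circ)).quasiMeasurePreserving.ae_eq_comp h)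

lemma reflect_ae {F : CircLp p} {f : Circ → ℝ} (h : F =ᵐ[circMeasure] f) :
    reflect F =ᵐ[circMeasure] fun x => f (-x) :=
  (Lp.coeFn_compMeasurePreserving F _).trans
    ((Measure.measurePreserving_neg circMeasure).quasiMeasurePreserving.ae_eq_comp h)

lemma translate_trans (s r : ℝ) (f : CircLp p) : translate s (translate r f) = translate (s + r) f := by
  refine Lp.ext ((translate_ae s (translate_ae r (ae_eq_refl _))).trans ?_)
  refine EventuallyEq.trans (Eventually.of_forall fun x => ?_)
    (translate_ae (s + r) (ae_eq_refl (f : Circ → ℝ))).symm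
  simp only [AddCircle.coe_add, add_assoc]

lemma translate_eq_self {s : ℝ} (hs : (s : Circ) = 0) (f : CircLp p) : translate s f = f := by
  refine Lp.ext ((translate_ae s (ae_eq_refl _)).trans (Eventually.of_forall fun x => ?_))
  simp [hs]

lemma translate_zero (f : CircLp p) : translate 0 f = f := translate_eq_self (by simp) f

lemma translate_neg_trans (s : ℝ) (f : CircLp p) : translate (-s) (translate s f) = f := by
  rw [translate_trans, neg_add_cancel, translate_zero]

lemma translate_trans_neg (s : ℝ) (f : CircLp p) : translate s (translate (-s) f) = f := by
  rw [translate_trans, add_neg_cancel, translate_zero]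

lemma translate_nonneg (s : ℝ) {f : CircLp p} (hf : 0 ≤ f) : 0 ≤ translate s f := by
  rw [← Lp.coeFn_nonneg] at hf ⊢
  have h1 := (measurePreserving_add_right circMeasure (s : Circ)).quasiMeasurePreserving.ae hf
  filter_upwards [translate_ae s (ae_eq_refl (f : Circ → ℝ)), h1] with x h2 h3
  rw [h2]; exact h3

lemma continuous_translate (hp : p ≠ ∞) {Z : Type*} [TopologicalSpace Z] {f : Z → CircLp p}
    {s : Z → ℝ} (hf : Continuous f) (hs : Continuous s) : Continuous fun z => translate (s z) (f z) := by
  have hg : Continuous fun z => (ContinuousMap.mk (fun x : Circ => x + ((s z : ℝ) : Circ))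
      (by fun_prop) : C(Circ, Circ)) :=
    ContinuousMap.continuous_of_continuous_uncurry _ (by
      simp only [Function.uncurry_def, ContinuousMap.coe_mk]
      have : Continuous fun z => ((s z : ℝ) : Circ) := (AddCircle.continuous_mk' 2).comp hs
      fun_prop)
  exact hf.compMeasurePreservingLp hg (fun z => measurePreserving_add_right circMeasure _) hp

lemma circ_intervalIntegral {F : Type*} [NormedAddCommGroup F] [NormedSpace ℝ F] (a : ℝ)
    (g : Circ → F) : ∫ r in a..a + 2, g (r : Circ) = (2 : ℝ) • ∫ y, g y ∂circMeasure := by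
  rw [AddCircle.intervalIntegral_preimage, AddCircle.integral_haarAddCircle, smul_smul,
    mul_inv_cancel₀ two_ne_zero, one_smul]

/-- The average of all translates of `f` is its mean value. -/
lemma integral_translate (hp : p ≠ ∞) (f : CircLp p) (d : ℝ) :
    ∫ σ in (0 : ℝ)..2, translate (σ + d) f = (2 * mean f) • one := by
  have hfm := (Lp.stronglyMeasurable f).measurable
  have hc : Continuous fun σ : ℝ => translate (σ + d) f :=
    continuous_translate hp continuous_const (by fun_prop)
  refine Lp.ext ((coeFn_intervalIntegral (f := fun σ x => f (x + ((σ + d : ℝ) : Circ)))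
    (hfm.comp ?_) (fun σ => translate_ae _ (ae_eq_refl _)) two_pos.le (hc.intervalIntegrable _ _)).trans ?_)
  · have : Measurable fun z : ℝ × Circ => ((z.1 + d : ℝ) : Circ) :=
      AddCircle.measurable_mk'.comp (by fun_prop)
    exact measurable_snd.add this
  filter_upwards [Lp.coeFn_smul (2 * mean f) (one : CircLp p), coeFn_one (μ := circMeasure) (p := p)]
    with x h1 h2
  rw [h1, Pi.smul_apply, h2, smul_eq_mul, mul_one]
  have h3 := circ_intervalIntegral 0 (fun y : Circ => f (x + (y + (d : Circ))))
  simp only [AddCircle.coe_add]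
  rw [zero_add] at h3
  rw [h3, mean_apply]
  have h4 : ∀ y : Circ, x + (y + (d : Circ)) = (x + d) + y := fun y => by abel
  simp_rw [h4]
  rw [integral_add_left_eq_self (fun y => f y), smul_eq_mul]

end Circle

/-! ### The damped transport equation on the circle -/

section Evolve

variable {E : Type*} [NormedAddCommGroup E] [NormedSpace ℝ E] [CompleteSpace E]
  {A : ℝ → E →L[ℝ] E} {K : ℝ}

/-- The solution operator of `z' = A z` from time `0` to time `max t 0`. -/
def evolve (hA : IsCoefficient A K) (t : ℝ) : E →L[ℝ] E :=
  LinearMap.mkContinuousOfExistsBound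
    { toFun := fun z₀ => (exists_isEvolution hA z₀).choose (max t 0)
      map_add' := fun x y => (exists_isEvolution hA (x + y)).choose_spec.unique hA
        ((exists_isEvolution hA x).choose_spec.add hA (exists_isEvolution hA y).choose_spec)
        (le_max_right _ _)
      map_smul' := fun c x => (exists_isEvolution hA (c • x)).choose_spec.unique hA
        ((exists_isEvolution hA x).choose_spec.smul c) (le_max_right _ _) }
    ⟨Real.exp (K * max t 0), fun x =>
      ((exists_isEvolution hA x).choose_spec.norm_le hA (le_max_right _ _)).trans_eq
        (mul_comm _ _)⟩

lemma evolve_eq (hA : IsCoefficient A K) {z₀ : E} {z : ℝ → E} (hz : IsEvolution A z₀ z) {t : ℝ}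
    (ht : 0 ≤ t) : evolve hA t z₀ = z t := by
  have h : evolve hA t z₀ = (exists_isEvolution hA z₀).choose (max t 0) := rfl
  rw [h, max_eq_left ht]
  exact (exists_isEvolution hA z₀).choose_spec.unique hA hz ht

end Evolve

/-- A damping coefficient on the circle: a measurable function of time and space with values in
`[0, M]` that is even in space. -/
structure IsDamping (b : ℝ → Circ → ℝ) (M : ℝ) : Prop where
  meas : Measurable (Function.uncurry b)
  nonneg : ∀ t x, 0 ≤ b t x
  le : ∀ t x, b t x ≤ M
  even : ∀ t x, b t (-x) = b t x

section Damping

variable {p : ℝ≥0∞} [hp1 : Fact (1 ≤ p)] {b : ℝ → Circ → ℝ} {M : ℝ}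

lemma IsDamping.M_nonneg (hb : IsDamping b M) : 0 ≤ M := (hb.nonneg 0 0).trans (hb.le 0 0)

lemma IsDamping.shift (hb : IsDamping b M) (t₀ : ℝ) : IsDamping (fun t => b (t + t₀)) M :=
  ⟨hb.meas.comp ((measurable_fst.add_const t₀).prodMk measurable_snd), fun _ _ => hb.nonneg _ _,
    fun _ _ => hb.le _ _, fun _ _ => hb.even _ _⟩

lemma IsDamping.bddMeasurable_half (hb : IsDamping b M) (s : ℝ) :
    BddMeasurable fun x => b s x / 2 := by
  refine ⟨((hb.meas.comp measurable_prodMk_left).div_const 2).stronglyMeasurable, M, fun x => ?_⟩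
  rw [Real.norm_of_nonneg (div_nonneg (hb.nonneg s x) two_pos.le)]
  linarith [hb.nonneg s x, hb.le s x]

lemma IsDamping.bddMeasurable_compl (hb : IsDamping b M) (s : ℝ) :
    BddMeasurable fun x => (M - b s x) / 2 := by
  refine ⟨(((hb.meas.comp measurable_prodMk_left).const_sub M).div_const 2).stronglyMeasurable, M,
    fun x => ?_⟩
  rw [Real.norm_of_nonneg (div_nonneg (sub_nonneg.2 (hb.le s x)) two_pos.le)]
  linarith [hb.nonneg s x, hb.le s x]

/-- The operator `w ↦ (M / 2) w - (b / 2) (w - w(-·))`, written so as to show its positivity. It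
generates the jumps of the reflected transport process, sped up by the factor `exp (M t / 2)`. -/
def jump (hb : IsDamping b M) (s : ℝ) : CircLp p →L[ℝ] CircLp p :=
  mulOp _ (hb.bddMeasurable_compl s)
    + (mulOp _ (hb.bddMeasurable_half s)).comp reflect.toContinuousLinearMap

/-- The operator `jump` seen in the frame that moves with the waves. -/
def gen (hb : IsDamping b M) (s : ℝ) : CircLp p →L[ℝ] CircLp p :=
  (translate (-s)).toContinuousLinearMap.comp
    ((jump hb s).comp (translate s).toContinuousLinearMap)

lemma gen_apply (hb : IsDamping b M) (s : ℝ) (f : CircLp p) :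
    gen hb s f = translate (-s) (jump hb s (translate s f)) := rfl

lemma coeFn_jump (hb : IsDamping b M) (s : ℝ) {F : CircLp p} {f : Circ → ℝ}
    (h : F =ᵐ[circMeasure] f) : jump hb s F =ᵐ[circMeasure]
      fun x => (M - b s x) / 2 * f x + b s x / 2 * f (-x) := by
  filter_upwards [Lp.coeFn_add (mulOp _ (hb.bddMeasurable_compl s) F)
    (mulOp _ (hb.bddMeasurable_half s) (reflect F)), coeFn_mulOp _ (hb.bddMeasurable_compl s) F,
    coeFn_mulOp _ (hb.bddMeasurable_half s) (reflect F), h, reflect_ae h] with x h1 h2 h3 h4 h5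
  refine h1.trans ?_
  rw [Pi.add_apply, h2, h3, h4, h5]

lemma coeFn_gen (hb : IsDamping b M) (s : ℝ) (f : CircLp p) :
    gen hb s f =ᵐ[circMeasure] fun y => (M - b s (y - (s : Circ))) / 2 * f y
      + b s (y - (s : Circ)) / 2 * f (((2 * s : ℝ) : Circ) - y) := by
  refine (translate_ae (-s) (coeFn_jump hb s (translate_ae s (ae_eq_refl _)))).trans
    (Eventually.of_forall fun y => ?_)
  have h1 : y + ((-s : ℝ) : Circ) = y - (s : Circ) := by rw [AddCircle.coe_neg, sub_eq_add_neg]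
  have h2 : -(y - (s : Circ)) + (s : Circ) = ((2 * s : ℝ) : Circ) - y := by
    rw [two_mul, AddCircle.coe_add]; abel
  simp only [h1, h2, sub_add_cancel]

lemma norm_jump_le (hb : IsDamping b M) (s : ℝ) (f : CircLp p) : ‖jump hb s f‖ ≤ M * ‖f‖ := by
  have h1 : ‖mulOp _ (hb.bddMeasurable_compl s) f‖ ≤ M / 2 * ‖f‖ :=
    norm_mulOp_le _ (fun x => by
      rw [abs_of_nonneg (div_nonneg (sub_nonneg.2 (hb.le s x)) two_pos.le)]
      linarith [hb.nonneg s x]) f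
  have h2 : ‖mulOp _ (hb.bddMeasurable_half s) (reflect f)‖ ≤ M / 2 * ‖reflect f‖ :=
    norm_mulOp_le _ (fun x => by
      rw [abs_of_nonneg (div_nonneg (hb.nonneg s x) two_pos.le)]
      linarith [hb.le s x]) _
  rw [LinearIsometry.norm_map] at h2
  refine (norm_add_le _ _).trans ((add_le_add h1 h2).trans_eq (by ring))

lemma isCoefficient_gen (hp : p ≠ ∞) (hb : IsDamping b M) :
    IsCoefficient (gen hb : ℝ → CircLp p →L[ℝ] CircLp p) M := by
  refine ⟨fun s => ContinuousLinearMap.opNorm_le_bound _ hb.M_nonneg fun f => ?_, fun f => ?_⟩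
  · rw [gen_apply, LinearIsometry.norm_map]
    exact (norm_jump_le hb s _).trans_eq (by rw [LinearIsometry.norm_map])
  · have hfm := (Lp.stronglyMeasurable f).measurable
    refine stronglyMeasurable_toLp hp (f := fun s y => (M - b s (y - (s : Circ))) / 2 * f y
      + b s (y - (s : Circ)) / 2 * f (((2 * s : ℝ) : Circ) - y)) ?_ fun s => coeFn_gen hb s f
    have m1 : Measurable fun z : ℝ × Circ => b z.1 (z.2 - (z.1 : Circ)) :=
      hb.meas.comp (measurable_fst.prodMk
        (measurable_snd.sub (AddCircle.measurable_mk'.comp measurable_fst)))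
    have m2 : Measurable fun z : ℝ × Circ => f (((2 * z.1 : ℝ) : Circ) - z.2) :=
      hfm.comp ((AddCircle.measurable_mk'.comp (measurable_fst.const_mul 2)).sub measurable_snd)
    exact (((m1.const_sub M).div_const 2).mul (hfm.comp measurable_snd)).add
      ((m1.div_const 2).mul m2)

lemma gen_nonneg (hb : IsDamping b M) (s : ℝ) {f : CircLp p} (hf : 0 ≤ f) : 0 ≤ gen hb s f := by
  rw [gen_apply]
  refine translate_nonneg _ ?_
  have h1 := (Lp.coeFn_nonneg _).2 (translate_nonneg s hf)
  have h2 := (Measure.measurePreserving_neg circMeasure).quasiMeasurePreserving.ae h1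
  rw [← Lp.coeFn_nonneg]
  filter_upwards [coeFn_jump hb s (ae_eq_refl (translate s f : Circ → ℝ)), h1, h2] with x a1 a2 a3
  rw [a1]
  have := hb.nonneg s x
  have := hb.le s x
  exact add_nonneg (mul_nonneg (by linarith) a2) (mul_nonneg (by linarith) a3)

lemma mean_translate (s : ℝ) (f : CircLp p) : mean (translate s f) = mean f := by
  rw [mean_apply, mean_apply, integral_congr_ae (translate_ae s (ae_eq_refl _)),
    integral_add_right_eq_self (fun y => f y)]

lemma translate_one (s : ℝ) : translate s (one : CircLp p) = one :=
  Lp.ext ((translate_ae s coeFn_one).trans coeFn_one.symm)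

lemma gen_one (hb : IsDamping b M) (s : ℝ) : gen hb s (one : CircLp p) = (M / 2) • one := by
  rw [gen_apply, translate_one]
  have : jump hb s (one : CircLp p) = (M / 2) • one := by
    refine Lp.ext ?_
    filter_upwards [coeFn_jump hb s (coeFn_one (μ := circMeasure) (p := p)),
      Lp.coeFn_smul (M / 2) (one : CircLp p), coeFn_one (μ := circMeasure) (p := p)] with x h1 h2 h3
    rw [h1, h2, Pi.smul_apply, h3, smul_eq_mul]
    ring
  rw [this, map_smul, translate_one]

lemma mean_jump (hb : IsDamping b M) (s : ℝ) (g : CircLp p) :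
    mean (jump hb s g) = M / 2 * mean g := by
  have i0 : Integrable (fun x => M / 2 * g x) circMeasure := (integrable_of_lp g).const_mul _
  have i1 : Integrable (fun x => g x * (b s x / 2)) circMeasure :=
    integrable_pairing (𝕜 := ℝ) (hb.bddMeasurable_half s) g
  have i2 : Integrable (fun x => g (-x) * (b s (-x) / 2)) circMeasure :=
    i1.comp_neg
  have i3 : ∫ x, g (-x) * (b s (-x) / 2) ∂circMeasure = ∫ x, g x * (b s x / 2) ∂circMeasure :=
    integral_neg_eq_self (fun x => g x * (b s x / 2)) circMeasure
  have e : ∀ᵐ x ∂circMeasure, jump hb s g x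
      = M / 2 * g x - g x * (b s x / 2) + g (-x) * (b s (-x) / 2) := by
    filter_upwards [coeFn_jump hb s (ae_eq_refl (g : Circ → ℝ))] with x hx
    rw [hx, hb.even]; ring
  have i4 : Integrable (fun x => M / 2 * g x - g x * (b s x / 2)) circMeasure := i0.sub i1
  rw [mean_apply, mean_apply, integral_congr_ae e, integral_add i4 i2, integral_sub i0 i1,
    integral_const_mul, i3]
  ring

lemma mean_gen (hb : IsDamping b M) (s : ℝ) (f : CircLp p) :
    mean (gen hb s f) = M / 2 * mean f := by
  rw [gen_apply, mean_translate, mean_jump, mean_translate]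

/-- The solution operator, rescaled so as to be doubly stochastic. -/
def semi (hp : p ≠ ∞) (hb : IsDamping b M) (t : ℝ) : CircLp p →L[ℝ] CircLp p :=
  Real.exp (-(M / 2 * t)) • evolve (isCoefficient_gen hp hb) t

lemma exists_isEvolution_exp {F : Type*} [NormedAddCommGroup F] [NormedSpace ℝ F] [CompleteSpace F]
    {A : ℝ → F →L[ℝ] F} {κ : ℝ} {v : F} (h : ∀ s, A s v = κ • v) :
    IsEvolution A v fun t => Real.exp (κ * t) • v := by
  refine ⟨by fun_prop, fun t ht => ?_⟩
  simp only [map_smul, h, smul_smul]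
  rw [intervalIntegral.integral_smul_const,
    intervalIntegral.integral_eq_sub_of_hasDerivAt (f := fun s => Real.exp (κ * s))
      (fun x _ => by simpa using ((hasDerivAt_id x).const_mul κ).exp)
      (Continuous.intervalIntegrable (by fun_prop) _ _), sub_smul]
  simp

lemma isDoublyStochastic_semi (hp : p ≠ ∞) (hb : IsDamping b M) {t : ℝ} (ht : 0 ≤ t) :
    IsDoublyStochastic (semi hp hb t : CircLp p →L[ℝ] CircLp p) := by
  have hA := isCoefficient_gen hp hb
  refine ⟨fun f hf => ?_, ?_, fun f => ?_⟩
  · obtain ⟨z, hz, hz0⟩ := exists_isEvolution_nonneg hA (fun s x => gen_nonneg hb s) hf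
    change 0 ≤ Real.exp (-(M / 2 * t)) • evolve hA t f
    rw [evolve_eq hA hz ht]
    exact smul_nonneg (Real.exp_pos _).le (hz0 t)
  · change Real.exp (-(M / 2 * t)) • evolve hA t one = one
    rw [evolve_eq hA (exists_isEvolution_exp (gen_one hb)) ht, smul_smul, ← Real.exp_add,
      neg_add_cancel, Real.exp_zero, one_smul]
  · obtain ⟨z, hz⟩ := exists_isEvolution hA f
    change mean (Real.exp (-(M / 2 * t)) • evolve hA t f) = mean f
    rw [evolve_eq hA hz ht, map_smul]
    -- The mean value solves `m' = (M / 2) m`.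
    have hB : IsCoefficient (fun _ : ℝ => (M / 2) • ContinuousLinearMap.id ℝ ℝ) ‖(M / 2) • ContinuousLinearMap.id ℝ ℝ‖ :=
      ⟨fun _ => le_rfl, fun _ => stronglyMeasurable_const⟩
    have h1 : IsEvolution (fun _ : ℝ => (M / 2) • ContinuousLinearMap.id ℝ ℝ) (mean f)
        fun t => mean (z t) := by
      refine ⟨mean.continuous.comp_continuousOn hz.cont, fun t ht => ?_⟩
      rw [hz.eq t ht, map_add, ← ContinuousLinearMap.intervalIntegral_comp_comm _
        (hA.intervalIntegrable hz.cont le_rfl ht)]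
      simp only [mean_gen]
      rfl
    have h2 : IsEvolution (fun _ : ℝ => (M / 2) • ContinuousLinearMap.id ℝ ℝ) (mean f)
        fun t => Real.exp (M / 2 * t) • mean f := exists_isEvolution_exp fun _ => rfl
    have h3 : mean (z t) = _ := h1.unique hB h2 ht
    rw [h3, smul_smul, ← Real.exp_add, neg_add_cancel, Real.exp_zero, one_smul]

end Damping

/-! ### The minorization and the decay of functions of mean zero -/

section Doeblin

variable {p : ℝ≥0∞} [hp1 : Fact (1 ≤ p)] {b : ℝ → Circ → ℝ} {M : ℝ}

lemma translate_mono (s : ℝ) {f g : CircLp p} (h : f ≤ g) : translate s f ≤ translate s g := by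
  rw [← sub_nonneg, ← map_sub]
  exact translate_nonneg s (sub_nonneg.2 h)

lemma bddMeasurable_ball (x₀ : Circ) (ε : ℝ) :
    BddMeasurable ((Metric.ball x₀ ε).indicator fun _ => (1 : ℝ)) :=
  ⟨stronglyMeasurable_const.indicator measurableSet_ball, 1, fun x => by
    by_cases hx : x ∈ Metric.ball x₀ ε <;> simp [hx]⟩

/-- The part of the generator that stems from jumps inside a ball. -/
def ballJump (x₀ : Circ) (ε : ℝ) (r : ℝ) (g : CircLp p) : CircLp p :=
  translate (-r) (mulOp _ (bddMeasurable_ball x₀ ε) (reflect (translate r g)))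

lemma coeFn_ballJump (x₀ : Circ) (ε : ℝ) (r : ℝ) (g : CircLp p) :
    ballJump x₀ ε r g =ᵐ[circMeasure] fun y =>
      (Metric.ball x₀ ε).indicator (fun _ => (1 : ℝ)) (y - (r : Circ))
        * g (((2 * r : ℝ) : Circ) - y) := by
  have h1 : mulOp _ (bddMeasurable_ball x₀ ε) (reflect (translate r g)) =ᵐ[circMeasure]
      fun x => (Metric.ball x₀ ε).indicator (fun _ => (1 : ℝ)) x * g (-x + (r : Circ)) := by
    filter_upwards [coeFn_mulOp _ (bddMeasurable_ball x₀ ε) (reflect (translate r g)),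
      reflect_ae (translate_ae r (ae_eq_refl (g : Circ → ℝ)))] with x h1 h2
    rw [h1, h2]
  refine (translate_ae (-r) h1).trans (Eventually.of_forall fun y => ?_)
  have h1 : y + ((-r : ℝ) : Circ) = y - (r : Circ) := by rw [AddCircle.coe_neg, sub_eq_add_neg]
  have h2 : -(y - (r : Circ)) + (r : Circ) = ((2 * r : ℝ) : Circ) - y := by
    rw [two_mul, AddCircle.coe_add]; abel
  simp only [h1, h2]

lemma smul_ballJump_le_gen (hb : IsDamping b M) {x₀ : Circ} {ε lam : ℝ}
    (hlow : ∀ t x, ‖x - x₀‖ < ε → lam ≤ b t x) (r : ℝ) {g : CircLp p} (hg : 0 ≤ g) :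
    (lam / 2) • ballJump x₀ ε r g ≤ gen hb r g := by
  rw [gen_apply, ballJump, ← map_smul]
  refine translate_mono _ ?_
  set h := translate r g
  have h0 := (Lp.coeFn_nonneg _).2 (translate_nonneg r hg)
  have h1 := (Measure.measurePreserving_neg circMeasure).quasiMeasurePreserving.ae h0
  rw [← Lp.coeFn_le]
  filter_upwards [coeFn_jump hb r (ae_eq_refl (h : Circ → ℝ)), h0, h1,
    coeFn_mulOp _ (bddMeasurable_ball x₀ ε) (reflect h),
    Lp.coeFn_smul (lam / 2) (mulOp _ (bddMeasurable_ball x₀ ε) (reflect h)),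
    reflect_ae (ae_eq_refl (h : Circ → ℝ))] with x a1 a2 a3 a4 a5 a6
  rw [a1, a5, Pi.smul_apply, a4, a6, smul_eq_mul]
  simp only [Pi.zero_apply] at a2 a3
  have hle := hb.le r x
  have hnn := hb.nonneg r x
  have hA : 0 ≤ (M - b r x) / 2 * h x := mul_nonneg (by linarith) a2
  by_cases hx : x ∈ Metric.ball x₀ ε
  · rw [indicator_of_mem hx, one_mul]
    have := hlow r x (by rwa [mem_ball_iff_norm] at hx)
    have hB : lam / 2 * h (-x) ≤ b r x / 2 * h (-x) :=
      mul_le_mul_of_nonneg_right (by linarith) a3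
    linarith
  · rw [indicator_of_notMem hx, zero_mul, mul_zero]
    exact add_nonneg hA (mul_nonneg (by linarith) a3)

lemma norm_ballJump_le (x₀ : Circ) (ε : ℝ) (r : ℝ) (g : CircLp p) :
    ‖ballJump x₀ ε r g‖ ≤ ‖g‖ := by
  rw [ballJump, LinearIsometry.norm_map]
  refine (norm_mulOp_le (C := 1) _ (fun x => ?_) _).trans ?_
  · by_cases hx : x ∈ Metric.ball x₀ ε <;> simp [hx]
  · rw [LinearIsometry.norm_map, LinearIsometry.norm_map, one_mul]

lemma measurable_ballJump (x₀ : Circ) (ε : ℝ) (g : CircLp p) :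
    Measurable (Function.uncurry fun (r : ℝ) (y : Circ) =>
      (Metric.ball x₀ ε).indicator (fun _ => (1 : ℝ)) (y - (r : Circ))
        * g (((2 * r : ℝ) : Circ) - y)) := by
  have hg := (Lp.stronglyMeasurable g).measurable
  refine Measurable.mul ?_ ?_
  · exact (bddMeasurable_ball x₀ ε).meas.measurable.comp
      (measurable_snd.sub (AddCircle.measurable_mk'.comp measurable_fst))
  · exact hg.comp ((AddCircle.measurable_mk'.comp (measurable_fst.const_mul 2)).sub measurable_snd)

lemma intervalIntegrable_ballJump (hp : p ≠ ∞) (x₀ : Circ) (ε : ℝ) (g : CircLp p) (u v : ℝ) :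
    IntervalIntegrable (fun r => ballJump x₀ ε r g) volume u v := by
  have hm : StronglyMeasurable fun r => ballJump x₀ ε r g :=
    stronglyMeasurable_toLp hp (measurable_ballJump x₀ ε g) fun r => coeFn_ballJump x₀ ε r g
  refine (intervalIntegrable_const (c := ‖g‖)).mono_fun hm.aestronglyMeasurable
    (Eventually.of_forall fun r => ?_)
  rw [norm_norm]
  exact norm_ballJump_le x₀ ε r g

/-- Jumps inside a ball, at all times of one period, spread `g` over an interval. -/
lemma integral_ballJump (hp : p ≠ ∞) (x₀ a : ℝ) {ε : ℝ} (hε : 0 < ε) (hε1 : ε ≤ 1)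
    (g : CircLp p) : ∫ r in a..a + 2, ballJump (x₀ : Circ) ε r g
      = ∫ s in -ε..ε, translate (-(2 * x₀) - 2 * s) g := by
  have hgm := (Lp.stronglyMeasurable g).measurable
  have hc : Continuous fun s : ℝ => translate (-(2 * x₀) - 2 * s) g :=
    continuous_translate hp continuous_const (by fun_prop)
  have h1 := coeFn_intervalIntegral (measurable_ballJump (x₀ : Circ) ε g)
    (fun r => coeFn_ballJump (x₀ : Circ) ε r g) (by linarith : a ≤ a + 2)
    (intervalIntegrable_ballJump hp _ ε g _ _)
  have h2 := coeFn_intervalIntegral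
    (f := fun (s : ℝ) (x : Circ) => g (x + ((-(2 * x₀) - 2 * s : ℝ) : Circ)))
    (hgm.comp (measurable_snd.add (AddCircle.measurable_mk'.comp
      ((measurable_fst.const_mul 2).const_sub (-(2 * x₀))))))
    (fun s => translate_ae _ (ae_eq_refl (g : Circ → ℝ))) (by linarith : -ε ≤ ε)
    (hc.intervalIntegrable _ _)
  refine Lp.ext (h1.trans (EventuallyEq.trans (Eventually.of_forall fun y => ?_) h2.symm))
  induction y using QuotientAddGroup.induction_on with
  | H η =>
  have hper : Function.Periodic (fun r : ℝ =>
      (Metric.ball (x₀ : Circ) ε).indicator (fun _ => (1 : ℝ)) ((η : Circ) - (r : Circ))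
        * g (((2 * r : ℝ) : Circ) - (η : Circ))) 2 := fun r => by
    have e1 : ((r + 2 : ℝ) : Circ) = (r : Circ) := by
      rw [AddCircle.coe_add, AddCircle.coe_period, add_zero]
    have e2 : ((2 * (r + 2) : ℝ) : Circ) = ((2 * r : ℝ) : Circ) := by
      rw [two_mul, AddCircle.coe_add, e1, ← AddCircle.coe_add, ← two_mul]
    simp only [e1, e2]
  have e3 := hper.intervalIntegral_add_eq a (η - x₀ - 1)
  have e4 : η - x₀ - 1 + 2 = η - x₀ - (-1) := by ring
  rw [e4, ← intervalIntegral.integral_comp_sub_left] at e3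
  refine e3.trans ?_
  have e5 : ∀ s ∈ Ioc (-1 : ℝ) 1,
      (Metric.ball (x₀ : Circ) ε).indicator (fun _ => (1 : ℝ))
        ((η : Circ) - ((η - x₀ - s : ℝ) : Circ))
        * g (((2 * (η - x₀ - s) : ℝ) : Circ) - (η : Circ))
      = (Ioo (-ε) ε).indicator (fun s => g ((η : Circ) + ((-(2 * x₀) - 2 * s : ℝ) : Circ))) s := by
    intro s hs
    have f1 : (η : Circ) - ((η - x₀ - s : ℝ) : Circ) = (x₀ : Circ) + (s : Circ) := by
      rw [← AddCircle.coe_sub, ← AddCircle.coe_add]; congr 1; ring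
    have f2 : ((2 * (η - x₀ - s) : ℝ) : Circ) - (η : Circ)
        = (η : Circ) + ((-(2 * x₀) - 2 * s : ℝ) : Circ) := by
      rw [← AddCircle.coe_sub, ← AddCircle.coe_add]; congr 1; ring
    have f3 : ‖(s : Circ)‖ = |s| :=
      (AddCircle.norm_coe_eq_abs_iff (p := 2) two_ne_zero).2
        (by rw [abs_of_pos (two_pos : (0 : ℝ) < 2), abs_le]; constructor <;> linarith [hs.1, hs.2])
    have f4 : (x₀ : Circ) + (s : Circ) ∈ Metric.ball (x₀ : Circ) ε ↔ s ∈ Ioo (-ε) ε := by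
      rw [mem_ball_iff_norm, add_sub_cancel_left, f3, abs_lt, mem_Ioo]
    rw [f1, f2]
    by_cases hsε : s ∈ Ioo (-ε) ε
    · rw [indicator_of_mem (f4.2 hsε), indicator_of_mem hsε, one_mul]
    · rw [indicator_of_notMem (fun h => hsε (f4.1 h)), indicator_of_notMem hsε, zero_mul]
  rw [intervalIntegral.integral_of_le (by norm_num), setIntegral_congr_fun measurableSet_Ioc e5,
    setIntegral_indicator measurableSet_Ioo, intervalIntegral.integral_of_le (by linarith),
    integral_Ioc_eq_integral_Ioo]
  congr 2
  ext s
  simp only [mem_inter_iff, mem_Ioc, mem_Ioo]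
  constructor
  · exact fun h => h.2
  · exact fun h => ⟨⟨by linarith [h.1], by linarith [h.2]⟩, h⟩

/-- A lower bound for the solution after one more period. -/
lemma smul_integral_translate_le (hp : p ≠ ∞) (hb : IsDamping b M) {x₀ ε lam : ℝ} (hε : 0 < ε)
    (hε1 : ε ≤ 1) (hlow : ∀ t x, ‖x - (x₀ : Circ)‖ < ε → lam ≤ b t x)
    {f : CircLp p} {z : ℝ → CircLp p} (hz : IsEvolution (gen hb) f z) (hpos : ∀ t, 0 ≤ z t)
    {a : ℝ} (ha : 0 ≤ a) :
    (lam / 4) • ∫ σ in (0 : ℝ)..4 * ε, translate (σ - (2 * x₀ + 2 * ε)) (z a) ≤ z (a + 2) := by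
  have hA := isCoefficient_gen hp hb
  have hsub : ∀ t, a ≤ t → z t = z a + ∫ r in a..t, gen hb r (z r) := fun t ht => by
    rw [hz.eq t (ha.trans ht), hz.eq a ha, add_assoc,
      intervalIntegral.integral_add_adjacent_intervals (hA.intervalIntegrable hz.cont le_rfl ha)
        (hA.intervalIntegrable hz.cont ha (ha.trans ht))]
  have hmono : ∀ t, a ≤ t → z a ≤ z t := fun t ht => by
    rw [hsub t ht]
    exact le_add_of_nonneg_right (intervalIntegral_nonneg ht fun r _ => gen_nonneg hb r (hpos r))
  have h1 : ∫ r in a..a + 2, (lam / 2) • ballJump (x₀ : Circ) ε r (z a)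
      ≤ ∫ r in a..a + 2, gen hb r (z r) := by
    have ha2 : a ≤ a + 2 := by linarith
    refine intervalIntegral_mono ha2 ((intervalIntegrable_ballJump hp (x₀ : Circ) ε (z a) a (a + 2)).smul (lam / 2))
      (hA.intervalIntegrable hz.cont ha (by linarith)) fun r hr => ?_
    refine (smul_ballJump_le_gen hb hlow r (hpos a)).trans ?_
    rw [← sub_nonneg, ← map_sub]
    exact gen_nonneg hb r (sub_nonneg.2 (hmono r hr.1.le))
  rw [intervalIntegral.integral_smul, integral_ballJump hp x₀ a hε hε1] at h1
  have h2 : ∫ s in -ε..ε, translate (-(2 * x₀) - 2 * s) (z a)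
      = (2 : ℝ)⁻¹ • ∫ σ in (0 : ℝ)..4 * ε, translate (σ - (2 * x₀ + 2 * ε)) (z a) := by
    have e := intervalIntegral.integral_comp_sub_mul (a := -ε) (b := ε)
      (fun σ => translate (σ - (2 * x₀ + 2 * ε)) (z a)) (two_ne_zero (α := ℝ)) (2 * ε)
    rw [show 2 * ε - 2 * ε = 0 by ring, show 2 * ε - 2 * -ε = 4 * ε by ring] at e
    rw [← e]
    refine intervalIntegral.integral_congr fun s _ => ?_
    rw [show 2 * ε - 2 * s - (2 * x₀ + 2 * ε) = -(2 * x₀) - 2 * s by ring]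
  rw [h2, smul_smul, show lam / 2 * 2⁻¹ = lam / 4 by ring] at h1
  rw [hsub (a + 2) (by linarith)]
  exact h1.trans (le_add_of_nonneg_left (hpos a))

/-- The solution at time `2 (n + 1)` dominates an average of translates of the initial value over an
interval whose length grows linearly with `n`. -/
lemma exists_integral_translate_le (hp : p ≠ ∞) (hb : IsDamping b M) {x₀ ε lam : ℝ} (hε : 0 < ε)
    (hε1 : ε ≤ 1) (hlam : 0 < lam) (hlow : ∀ t x, ‖x - (x₀ : Circ)‖ < ε → lam ≤ b t x)
    {f : CircLp p} (hf : 0 ≤ f) {z : ℝ → CircLp p} (hz : IsEvolution (gen hb) f z)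
    (hpos : ∀ t, 0 ≤ z t) (n : ℕ) :
    ∃ d : ℝ, ((lam / 4) ^ (n + 1) * (4 * ε / 3) ^ n) •
      ∫ σ in (0 : ℝ)..4 * ε + n * (4 * ε / 3), translate (σ + d) f ≤ z (2 * (n + 1)) := by
  have h0 : z 0 = f := by rw [hz.eq 0 le_rfl]; simp
  have hcont : ∀ c : ℝ, Continuous fun σ : ℝ => translate (σ + c) f := fun c =>
    continuous_translate hp continuous_const (by fun_prop)
  induction n with
  | zero =>
    refine ⟨-(2 * x₀ + 2 * ε), ?_⟩
    have h := smul_integral_translate_le hp hb hε hε1 hlow hz hpos le_rfl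
    rw [h0] at h
    simpa [sub_eq_add_neg] using h
  | succ n ih =>
    obtain ⟨d, hd⟩ := ih
    set c := (lam / 4) ^ (n + 1) * (4 * ε / 3) ^ n with hcdef
    set L := 4 * ε + n * (4 * ε / 3) with hL
    have hc : 0 ≤ c := by positivity
    have hLε : 4 * ε ≤ L := by rw [hL]; have : (0 : ℝ) ≤ n * (4 * ε / 3) := by positivity
                               linarith
    set d' := d - (2 * x₀ + 2 * ε) with hd'
    refine ⟨d' + 4 * ε / 3, ?_⟩
    have h := smul_integral_translate_le hp hb hε hε1 hlow hz hpos
      (a := 2 * (n + 1)) (by positivity)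
    have e1 : (2 * ((n : ℝ) + 1) + 2) = 2 * (((n + 1 : ℕ) : ℝ) + 1) := by push_cast; ring
    rw [e1] at h
    refine le_trans ?_ h
    have h1 : ∫ σ in (0 : ℝ)..4 * ε, translate (σ - (2 * x₀ + 2 * ε))
          (c • ∫ η in (0 : ℝ)..L, translate (η + d) f)
        ≤ ∫ σ in (0 : ℝ)..4 * ε, translate (σ - (2 * x₀ + 2 * ε)) (z (2 * (n + 1))) := by
      refine intervalIntegral_mono (by linarith)
        ((continuous_translate hp continuous_const (by fun_prop)).intervalIntegrable _ _)
        ((continuous_translate hp continuous_const (by fun_prop)).intervalIntegrable _ _)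
        fun σ _ => translate_mono _ hd
    have h2 : ∀ σ : ℝ, translate (σ - (2 * x₀ + 2 * ε)) (c • ∫ η in (0 : ℝ)..L, translate (η + d) f)
        = c • ∫ η in (0 : ℝ)..L, translate ((σ + η) + d') f := fun σ => by
      rw [map_smul]
      congr 1
      have := (translate (p := p) (σ - (2 * x₀ + 2 * ε))).toContinuousLinearMap.intervalIntegral_comp_comm
        ((hcont d).intervalIntegrable (μ := volume) 0 L)
      refine this.symm.trans (intervalIntegral.integral_congr fun η _ => ?_)
      simp only [LinearIsometry.coe_toContinuousLinearMap, translate_trans, hd']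
      congr 2
      ring
    simp_rw [h2] at h1
    rw [intervalIntegral.integral_smul] at h1
    have h3 := smul_integral_le_integral_integral (hcont d')
      (fun x => translate_nonneg _ hf) (by linarith : 0 < 4 * ε) hLε
    have h4 := smul_le_smul_of_nonneg_left (smul_le_smul_of_nonneg_left h3 hc) (by positivity : 0 ≤ lam / 4)
    refine le_trans (le_of_eq ?_) (h4.trans (smul_le_smul_of_nonneg_left h1 (by positivity)))
    rw [smul_smul, smul_smul]
    congr 1
    · rw [hcdef]; ring
    · have e2 : 4 * ε + ((n + 1 : ℕ) : ℝ) * (4 * ε / 3) = L + 4 * ε / 3 := by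
        rw [hL]; push_cast; ring
      rw [e2]
      refine intervalIntegral.integral_congr fun σ _ => ?_
      rw [show σ + 4 * ε / 3 + d' = σ + (d' + 4 * ε / 3) by ring]

/-- Uniform contraction on functions of mean zero: the constants depend only on the bound `M` and on
the size `ε` and the strength `lam` of the damping. -/
lemma exists_contraction (M : ℝ) {ε lam : ℝ} (hε : 0 < ε) (hε1 : ε ≤ 1) (hlam : 0 < lam) :
    ∃ (N : ℕ) (θ : ℝ), 0 < N ∧ 0 < θ ∧ θ < 1 ∧ ∀ (p : ℝ≥0∞) [Fact (1 ≤ p)] (hp : p ≠ ∞)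
      (b : ℝ → Circ → ℝ) (hb : IsDamping b M) (x₀ : ℝ),
      (∀ t x, ‖x - (x₀ : Circ)‖ < ε → lam ≤ b t x) →
      ∀ f : CircLp p, mean f = 0 → ‖semi hp hb (2 * N) f‖ ≤ θ * ‖f‖ := by
  obtain ⟨n, hn⟩ := exists_nat_ge (2 / (4 * ε / 3))
  have hL : 2 ≤ 4 * ε + n * (4 * ε / 3) := by
    rw [div_le_iff₀ (by positivity)] at hn
    linarith
  set c := (lam / 4) ^ (n + 1) * (4 * ε / 3) ^ n with hcdef
  have hc : 0 < c := by positivity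
  set δ₀ := Real.exp (-(M / 2 * (2 * (n + 1)))) * (c * 2) with hδ₀
  have hδ₀pos : 0 < δ₀ := by positivity
  refine ⟨n + 1, 1 - min δ₀ (1 / 2), n.succ_pos, ?_, ?_, ?_⟩
  · linarith [min_le_right δ₀ (1 / 2)]
  · linarith [lt_min hδ₀pos (by norm_num : (0 : ℝ) < 1 / 2)]
  intro p _ hp b hb x₀ hlow f hf
  refine (isDoublyStochastic_semi hp hb (by positivity)).norm_le_of_doeblin hp
    (by linarith [min_le_right δ₀ (1 / 2)]) (fun g hg => ?_) hf
  have hA := isCoefficient_gen (p := p) hp hb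
  obtain ⟨z, hz, hpos⟩ := exists_isEvolution_nonneg hA (fun s x => gen_nonneg hb s) hg
  obtain ⟨d, hd⟩ := exists_integral_translate_le hp hb hε hε1 hlam hlow hg hz hpos n
  have h1 : (2 * mean g) • one ≤ ∫ σ in (0 : ℝ)..4 * ε + n * (4 * ε / 3), translate (σ + d) g := by
    rw [← integral_translate hp g d]
    exact intervalIntegral_mono_interval
      (continuous_translate hp continuous_const (by fun_prop))
      (fun x => translate_nonneg _ hg) le_rfl hL
  have h2 := smul_le_smul_of_nonneg_left
    ((smul_le_smul_of_nonneg_left h1 hc.le).trans hd) (Real.exp_pos (-(M / 2 * (2 * (n + 1))))).le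
  have h3 : semi hp hb (2 * ((n + 1 : ℕ) : ℝ)) g
      = Real.exp (-(M / 2 * (2 * (n + 1)))) • z (2 * (n + 1)) := by
    change Real.exp _ • evolve hA _ g = _
    rw [evolve_eq hA hz (by positivity)]
    push_cast
    rfl
  rw [h3]
  refine le_trans ?_ h2
  rw [smul_smul, smul_smul]
  refine smul_le_smul_of_nonneg_right ?_ one_nonneg
  have := mul_le_mul_of_nonneg_right (min_le_left δ₀ (1 / 2)) (mean_nonneg hg)
  refine this.trans_eq ?_
  rw [hδ₀]; ring

end Doeblin

/-! ### Exponential decay on the circle -/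

section Decay

variable {p : ℝ≥0∞} [hp1 : Fact (1 ≤ p)] {b : ℝ → Circ → ℝ} {M : ℝ}

lemma semi_eq (hp : p ≠ ∞) (hb : IsDamping b M) {f : CircLp p} {z : ℝ → CircLp p}
    (hz : IsEvolution (gen hb) f z) {t : ℝ} (ht : 0 ≤ t) :
    semi hp hb t f = Real.exp (-(M / 2 * t)) • z t := by
  change Real.exp _ • evolve _ t f = _
  rw [evolve_eq (isCoefficient_gen hp hb) hz ht]

/-- The moving frame has period `2`, so that restarting at an even time only shifts the damping. -/
lemma semi_add (hp : p ≠ ∞) (hb : IsDamping b M) (N : ℕ) {t : ℝ} (ht : 0 ≤ t) (f : CircLp p) :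
    semi hp hb (t + 2 * N) f = semi hp (hb.shift (2 * N)) t (semi hp hb (2 * N) f) := by
  have hA := isCoefficient_gen (p := p) hp hb
  obtain ⟨z, hz⟩ := exists_isEvolution hA f
  have hN : (0 : ℝ) ≤ 2 * N := by positivity
  have hs := hz.shift hA hN
  have hcoe : ((2 * (N : ℝ) : ℝ) : Circ) = 0 := by
    have : (2 * (N : ℝ) : ℝ) = N • (2 : ℝ) := by rw [nsmul_eq_mul, mul_comm]
    rw [this, AddCircle.coe_nsmul, AddCircle.coe_period, smul_zero]
  have hgen : (fun s => gen (p := p) hb (s + 2 * N)) = gen (hb.shift (2 * N)) := by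
    funext s
    refine ContinuousLinearMap.ext fun g => ?_
    rw [gen_apply, gen_apply]
    have h1 : translate (s + 2 * N) g = translate s g := by
      rw [← translate_trans, translate_eq_self hcoe]
    have h2 : ∀ k : CircLp p, translate (-(s + 2 * N)) k = translate (-s) k := fun k => by
      rw [neg_add, ← translate_trans, translate_eq_self (s := -(2 * (N : ℝ)))]
      rw [AddCircle.coe_neg, hcoe, neg_zero]
    rw [h1, h2]
    rfl
  rw [hgen] at hs
  rw [semi_eq hp hb hz (by positivity), semi_eq hp hb hz hN, map_smul,
    semi_eq hp (hb.shift (2 * N)) hs ht, smul_smul, ← Real.exp_add]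
  congr 2
  ring

/-- Exponential decay of solutions of mean zero. -/
lemma exists_decay (M : ℝ) {ε lam : ℝ} (hε : 0 < ε) (hε1 : ε ≤ 1) (hlam : 0 < lam) :
    ∃ C γ : ℝ, 0 < C ∧ 0 < γ ∧ ∀ (p : ℝ≥0∞) [Fact (1 ≤ p)] (hp : p ≠ ∞)
      (b : ℝ → Circ → ℝ) (hb : IsDamping b M) (x₀ : ℝ),
      (∀ t x, ‖x - (x₀ : Circ)‖ < ε → lam ≤ b t x) →
      ∀ f : CircLp p, mean f = 0 → ∀ t, 0 ≤ t →
        ‖semi hp hb t f‖ ≤ C * Real.exp (-γ * t) * ‖f‖ := by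
  obtain ⟨N, θ, hN, hθ0, hθ1, hcon⟩ := exists_contraction M hε hε1 hlam
  have hN' : (0 : ℝ) < 2 * N := by positivity
  refine ⟨θ⁻¹, -Real.log θ / (2 * N), inv_pos.2 hθ0,
    div_pos (neg_pos.2 (Real.log_neg hθ0 hθ1)) hN', ?_⟩
  intro p _ hp b hb x₀ hlow f hf t ht
  have key : ∀ (k : ℕ) (b : ℝ → Circ → ℝ) (hb : IsDamping b M),
      (∀ t x, ‖x - (x₀ : Circ)‖ < ε → lam ≤ b t x) → ∀ f : CircLp p, mean f = 0 →
      ∀ s, 0 ≤ s → ‖semi hp hb (s + 2 * N * k) f‖ ≤ θ ^ k * ‖f‖ := by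
    intro k
    induction k with
    | zero =>
      intro b hb _ f _ s hs
      simpa using (isDoublyStochastic_semi hp hb hs).norm_le hp f
    | succ k ih =>
      intro b hb hlow f hf s hs
      have e : s + 2 * N * ((k + 1 : ℕ) : ℝ) = (s + 2 * N * k) + 2 * N := by push_cast; ring
      rw [e, semi_add hp hb N (by positivity)]
      have hm : mean (semi hp hb (2 * N) f) = 0 := by
        rw [(isDoublyStochastic_semi hp hb hN'.le).mean_map, hf]
      refine (ih _ (hb.shift (2 * N)) (fun t x hx => hlow _ x hx) _ hm s hs).trans ?_
      calc θ ^ k * ‖semi hp hb (2 * N) f‖ ≤ θ ^ k * (θ * ‖f‖) := by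
            have := hcon p hp b hb x₀ hlow f hf
            gcongr
        _ = θ ^ (k + 1) * ‖f‖ := by ring
  set k := ⌊t / (2 * N)⌋₊ with hk
  have hk1 : 2 * N * (k : ℝ) ≤ t := by
    have := Nat.floor_le (div_nonneg ht hN'.le)
    rw [le_div_iff₀ hN'] at this
    linarith
  have hk2 : t / (2 * N) - 1 ≤ k := by
    have := Nat.lt_floor_add_one (t / (2 * N))
    linarith
  have h1 := key k b hb hlow f hf (t - 2 * N * k) (by linarith)
  rw [sub_add_cancel] at h1
  refine h1.trans (mul_le_mul_of_nonneg_right ?_ (norm_nonneg _))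
  have h2 : θ ^ k ≤ θ ^ (t / (2 * N) - 1) := by
    rw [← Real.rpow_natCast]
    exact Real.rpow_le_rpow_of_exponent_ge hθ0 hθ1.le hk2
  refine h2.trans_eq ?_
  rw [Real.rpow_sub_one hθ0.ne', Real.rpow_def_of_pos hθ0, div_eq_inv_mul]
  congr 2
  field_simp

end Decay

/-! ### Fourier coefficients on the circle -/

section Fourier

variable {p : ℝ≥0∞} [hp1 : Fact (1 ≤ p)]

lemma bddMeasurable_fourier (n : ℤ) : BddMeasurable fun x : Circ => fourier n x :=
  BddMeasurable.of_continuous (fourier n).continuous (C := 1) fun x => by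
    rw [fourier_apply]; exact (Circle.norm_coe _).le

/-- The functional `f ↦ ∫ f eₙ` with `eₙ x = exp (i π n x)`. -/
def fcoef (n : ℤ) : CircLp p →L[ℝ] ℂ := pairing _ (bddMeasurable_fourier n)

lemma fcoef_apply (n : ℤ) (f : CircLp p) :
    fcoef n f = ∫ x, (f x : ℂ) * fourier n x ∂circMeasure := rfl

lemma fourier_coe (n : ℤ) (x : ℝ) :
    fourier n (x : Circ) = Complex.exp ((Real.pi * n * x : ℝ) * Complex.I) := by
  rw [fourier_coe_apply]
  congr 1
  push_cast
  ring

lemma fcoef_translate (n : ℤ) (s : ℝ) (f : CircLp p) :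
    fcoef n (translate s f) = Complex.exp (-(Real.pi * n * s : ℝ) * Complex.I) * fcoef n f := by
  have h : ∀ᵐ x ∂circMeasure, (translate s f x : ℂ) * fourier n x
      = (fun y : Circ => Complex.exp (-(Real.pi * n * s : ℝ) * Complex.I)
        * ((f y : ℂ) * fourier n y)) (x + (s : Circ)) := by
    filter_upwards [translate_ae s (ae_eq_refl (f : Circ → ℝ))] with x hx
    have e : fourier n x = Complex.exp (-(Real.pi * n * s : ℝ) * Complex.I)
        * fourier n (x + (s : Circ)) := by
      induction x using QuotientAddGroup.induction_on with
      | H x =>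
        change fourier n (x : Circ) = _ * fourier n ((x : Circ) + (s : Circ))
        rw [← AddCircle.coe_add, fourier_coe, fourier_coe, ← Complex.exp_add]
        congr 1
        push_cast
        ring
    rw [hx, e]
    ring
  rw [fcoef_apply, integral_congr_ae h, integral_add_right_eq_self
    (fun y : Circ => Complex.exp (-(Real.pi * n * s : ℝ) * Complex.I) * ((f y : ℂ) * fourier n y)),
    integral_const_mul, fcoef_apply]

/-- An integrable function on the circle is determined by its Fourier coefficients. -/
lemma eq_zero_of_fcoef (f : CircLp p) (h : ∀ n, fcoef n f = 0) : f = 0 := by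
  have hf := integrable_of_lp f
  have hbm : ∀ φ : C(Circ, ℂ), BddMeasurable fun x => φ x := fun φ =>
    BddMeasurable.of_continuous φ.continuous (C := ‖φ‖) φ.norm_coe_le_norm
  let L : C(Circ, ℂ) →ₗ[ℂ] ℂ :=
    { toFun := fun φ => ∫ x, (f x : ℂ) * φ x ∂circMeasure
      map_add' := fun φ ψ => by
        have i : ∀ φ : C(Circ, ℂ), Integrable (fun x => (f x : ℂ) * φ x) circMeasure :=
          fun φ => integrable_pairing (hbm φ) f
        rw [← integral_add (i φ) (i ψ)]
        simp only [ContinuousMap.add_apply, mul_add]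
      map_smul' := fun c φ => by
        rw [RingHom.id_apply, smul_eq_mul, ← integral_const_mul]
        refine integral_congr_ae (Eventually.of_forall fun x => ?_)
        simp only [ContinuousMap.smul_apply, smul_eq_mul]
        ring }
  have hLc : Continuous L := by
    refine (L.mkContinuous (∫ x, ‖f x‖ ∂circMeasure) fun φ => ?_).continuous
    calc ‖∫ x, (f x : ℂ) * φ x ∂circMeasure‖ ≤ ∫ x, ‖f x‖ * ‖φ‖ ∂circMeasure := by
          refine norm_integral_le_of_norm_le (hf.norm.mul_const _) (Eventually.of_forall fun x => ?_)
          rw [norm_mul, Complex.norm_real]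
          exact mul_le_mul_of_nonneg_left (φ.norm_coe_le_norm x) (norm_nonneg _)
      _ = _ := integral_mul_const _ _
  have hker : ∀ φ, L φ = 0 := by
    have h1 : Submodule.span ℂ (range (fourier (T := 2))) ≤ LinearMap.ker L := by
      rw [Submodule.span_le]
      rintro _ ⟨n, rfl⟩
      exact h n
    have h2 := Submodule.topologicalClosure_minimal _ h1
      (isClosed_singleton.preimage hLc : IsClosed (L ⁻¹' {0}))
    rw [span_fourier_closure_eq_top] at h2
    exact fun φ => h2 (Submodule.mem_top (x := φ))
  rw [Lp.eq_zero_iff_ae_eq_zero]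
  refine ae_eq_zero_of_forall_setIntegral_isClosed_eq_zero hf fun s hs => ?_
  -- Approximate the indicator of a closed set by continuous functions.
  have hlim : Tendsto (fun k : ℕ => ∫ x, f x * (thickenedIndicator (δ := 1 / ((k : ℝ) + 1))
      (by positivity) s x : ℝ) ∂circMeasure) atTop
      (𝓝 (∫ x, f x * (s.indicator (fun _ => (1 : ℝ)) x) ∂circMeasure)) := by
    refine tendsto_integral_of_dominated_convergence (fun x => ‖f x‖) (fun k => ?_) hf.norm
      (fun k => Eventually.of_forall fun x => ?_) (Eventually.of_forall fun x => ?_)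
    · exact hf.1.mul (Continuous.aestronglyMeasurable (by fun_prop))
    · rw [norm_mul]
      refine mul_le_of_le_one_right (norm_nonneg _) ?_
      rw [Real.norm_of_nonneg NNReal.zero_le_coe]
      exact_mod_cast thickenedIndicator_le_one _ s x
    · have h1 := thickenedIndicator_tendsto_indicator_closure
        (δseq := fun k : ℕ => 1 / ((k : ℝ) + 1)) (fun k => by positivity)
        tendsto_one_div_add_atTop_nhds_zero_nat s
      rw [tendsto_pi_nhds] at h1
      have h2 := (NNReal.continuous_coe.tendsto _).comp (h1 x)
      rw [hs.closure_eq] at h2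
      refine Tendsto.const_mul _ (h2.trans_eq ?_)
      by_cases hx : x ∈ s <;> simp [hx]
  have hz : ∀ k : ℕ, ∫ x, f x * (thickenedIndicator (δ := 1 / ((k : ℝ) + 1))
      (by positivity) s x : ℝ) ∂circMeasure = 0 := fun k => by
    have h1 := hker ⟨fun x => ((thickenedIndicator (δ := 1 / ((k : ℝ) + 1))
      (by positivity) s x : ℝ) : ℂ), by fun_prop⟩
    have h2 : ∫ x, (f x : ℂ) * ((thickenedIndicator (δ := 1 / ((k : ℝ) + 1))
      (by positivity) s x : ℝ) : ℂ) ∂circMeasure = 0 := h1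
    simp_rw [← Complex.ofReal_mul] at h2
    rw [integral_complex_ofReal] at h2
    exact_mod_cast h2
  simp_rw [hz] at hlim
  have h3 := tendsto_nhds_unique hlim tendsto_const_nhds
  rw [← h3, ← integral_indicator hs.measurableSet]
  refine integral_congr_ae (Eventually.of_forall fun x => ?_)
  by_cases hx : x ∈ s <;> simp [hx]

end Fourier

/-! ### Even and odd extension from the interval to the circle -/

instance : IsProbabilityMeasure spaceMeasure :=
  ⟨by rw [Measure.restrict_apply_univ, Real.volume_Ioo]; norm_num⟩

section Fold

lemma norm_coe_of_mem {x : ℝ} (hx : x ∈ Icc (-1 : ℝ) 1) : ‖(x : Circ)‖ = |x| :=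
  (AddCircle.norm_coe_eq_abs_iff (p := 2) two_ne_zero).2
    (by rw [abs_of_pos (two_pos : (0 : ℝ) < 2), abs_le]; constructor <;> linarith [hx.1, hx.2])

/-- Every point of the circle is `± ‖y‖`. -/
lemma eq_coe_norm_or (y : Circ) : y = (‖y‖ : ℝ) ∨ y = ((-‖y‖ : ℝ) : Circ) := by
  obtain ⟨x, hx, rfl⟩ : ∃ x ∈ Ioc (-1 : ℝ) 1, (x : Circ) = y := by
    have := AddCircle.coe_image_Ioc_eq (2 : ℝ) (-1)
    have h : y ∈ ((↑) : ℝ → Circ) '' Ioc (-1 : ℝ) (-1 + 2) := by rw [this]; trivial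
    norm_num at h
    simpa using h
  rw [norm_coe_of_mem ⟨hx.1.le, hx.2⟩]
  rcases le_total 0 x with h | h
  · left; rw [abs_of_nonneg h]
  · right; rw [abs_of_nonpos h, neg_neg]

lemma measurePreserving_norm : MeasurePreserving (fun y : Circ => ‖y‖) circMeasure spaceMeasure := by
  refine ⟨continuous_norm.measurable, ?_⟩
  ext A hA
  rw [Measure.map_apply continuous_norm.measurable hA]
  have hpre : MeasurableSet ((fun y : Circ => ‖y‖) ⁻¹' A) := continuous_norm.measurable hA
  have h1 := AddCircle.add_projection_respects_measure (2 : ℝ) (-1) hpre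
  have h2 : ((QuotientAddGroup.mk ⁻¹' ((fun y : Circ => ‖y‖) ⁻¹' A)) ∩ Ioc (-1) (-1 + 2) : Set ℝ)
      =ᵐ[volume] (A ∩ Ioo 0 1 ∪ -(A ∩ Ioo 0 1) : Set ℝ) := by
    have h0 : ∀ᵐ x : ℝ, x ∉ ({0, 1} : Set ℝ) :=
      measure_eq_zero_iff_ae_notMem.1 ((Set.toFinite _).measure_zero volume)
    filter_upwards [h0] with x hx
    simp only [mem_insert_iff, mem_singleton_iff, not_or] at hx
    apply propext
    change (‖(x : Circ)‖ ∈ A ∧ x ∈ Ioc (-1 : ℝ) (-1 + 2)) ↔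
      ((x ∈ A ∧ x ∈ Ioo (0 : ℝ) 1) ∨ (-x ∈ A ∧ -x ∈ Ioo (0 : ℝ) 1))
    rw [show (-1 : ℝ) + 2 = 1 by norm_num]
    constructor
    · rintro ⟨hA, h1, h2⟩
      rw [norm_coe_of_mem ⟨h1.le, h2⟩] at hA
      rcases lt_or_gt_of_ne hx.1 with h | h
      · right
        rw [abs_of_neg h] at hA
        exact ⟨hA, by linarith, by linarith⟩
      · left
        rw [abs_of_pos h] at hA
        exact ⟨hA, h, lt_of_le_of_ne h2 hx.2⟩
    · rintro (⟨hA, h1, h2⟩ | ⟨hA, h1, h2⟩)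
      · refine ⟨?_, by linarith, h2.le⟩
        rwa [norm_coe_of_mem ⟨by linarith, h2.le⟩, abs_of_pos h1]
      · refine ⟨?_, by linarith, by linarith⟩
        rwa [norm_coe_of_mem ⟨by linarith, by linarith⟩, abs_of_neg (by linarith)]
  rw [measure_congr h2] at h1
  have hAm : MeasurableSet (A ∩ Ioo (0 : ℝ) 1) := hA.inter measurableSet_Ioo
  have hdisj : Disjoint (A ∩ Ioo (0 : ℝ) 1) (-(A ∩ Ioo (0 : ℝ) 1)) := by
    rw [Set.disjoint_left]
    rintro x ⟨_, h1, _⟩ ⟨_, h2, _⟩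
    linarith
  rw [measure_union hdisj hAm.neg, Measure.measure_neg, ← two_mul,
    AddCircle.volume_eq_smul_haarAddCircle, Measure.smul_apply, smul_eq_mul] at h1
  rw [Measure.restrict_apply hA]
  have h3 : ENNReal.ofReal 2 = 2 := by norm_num
  rw [h3] at h1
  exact (ENNReal.mul_right_inj two_ne_zero ENNReal.ofNat_ne_top).1 h1

lemma ae_norm_mem : ∀ᵐ y ∂circMeasure, ‖y‖ ∈ Ioo (0 : ℝ) 1 :=
  measurePreserving_norm.quasiMeasurePreserving.ae
    (ae_restrict_mem measurableSet_Ioo : ∀ᵐ x ∂spaceMeasure, x ∈ Ioo (0 : ℝ) 1)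

/-- The set of points `y` of the circle with `y = ‖y‖`, that is, the half circle `[0, 1]`. -/
def halfCircle : Set Circ := {y | y = ((‖y‖ : ℝ) : Circ)}

lemma measurableSet_halfCircle : MeasurableSet halfCircle :=
  (isClosed_eq continuous_id ((AddCircle.continuous_mk' 2).comp continuous_norm)).measurableSet

/-- The odd sign function on the circle: `1` on `(0, 1)`, `-1` on `(-1, 0)`, and `0` at `0` and
`1`. -/
def sgn (y : Circ) : ℝ :=
  halfCircle.indicator (fun _ => 1) y - halfCircle.indicator (fun _ => 1) (-y)

lemma sgn_neg (y : Circ) : sgn (-y) = -sgn y := by simp [sgn]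

lemma bddMeasurable_sgn : BddMeasurable sgn := by
  have h : Measurable (halfCircle.indicator fun _ => (1 : ℝ)) :=
    measurable_const.indicator measurableSet_halfCircle
  refine ⟨(h.sub (h.comp measurable_neg)).stronglyMeasurable, 1, fun y => ?_⟩
  by_cases h1 : y ∈ halfCircle <;> by_cases h2 : -y ∈ halfCircle <;> simp [sgn, h1, h2]

/-- The points of the open half circles. -/
lemma sgn_cases {y : Circ} (hy : ‖y‖ ∈ Ioo (0 : ℝ) 1) :
    (y = ((‖y‖ : ℝ) : Circ) ∧ sgn y = 1) ∨ (y = ((-‖y‖ : ℝ) : Circ) ∧ sgn y = -1) := by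
  have hne : y ≠ -y := fun h => by
    have h2 : y = ((‖y‖ : ℝ) : Circ) := by
      rcases eq_coe_norm_or y with h1 | h1
      · exact h1
      · rw [AddCircle.coe_neg] at h1
        exact h.trans ((congrArg Neg.neg h1).trans (neg_neg _))
    have h3 : ((‖y‖ + ‖y‖ : ℝ) : Circ) = 0 := by
      rw [AddCircle.coe_add, ← h2]
      nth_rewrite 1 [h]
      exact neg_add_cancel y
    rw [AddCircle.coe_eq_zero_iff] at h3
    obtain ⟨k, hk⟩ := h3
    rw [zsmul_eq_mul] at hk
    have h4 : (0 : ℝ) < k := by nlinarith [hy.1]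
    have h5 : (k : ℝ) < 1 := by nlinarith [hy.2]
    have h4' : (0 : ℤ) < k := by exact_mod_cast h4
    have h5' : k < (1 : ℤ) := by exact_mod_cast h5
    omega
  rcases eq_coe_norm_or y with h1 | h1
  · left
    have hm : y ∈ halfCircle := h1
    have hm' : -y ∉ halfCircle := fun h => by
      change -y = ((‖-y‖ : ℝ) : Circ) at h
      rw [norm_neg, ← h1] at h
      exact hne h.symm
    exact ⟨h1, by simp [sgn, hm, hm']⟩
  · right
    have h1' : -y = ((‖y‖ : ℝ) : Circ) := by
      rw [AddCircle.coe_neg] at h1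
      nth_rewrite 1 [h1]
      exact neg_neg _
    have hm : y ∉ halfCircle := fun h => by
      change y = ((‖y‖ : ℝ) : Circ) at h
      rw [← h1'] at h
      exact hne h
    have hm' : -y ∈ halfCircle := by
      change -y = ((‖-y‖ : ℝ) : Circ)
      rw [norm_neg, ← h1']
    exact ⟨h1, by simp [sgn, hm, hm']⟩

lemma ae_abs_sgn : ∀ᵐ y ∂circMeasure, |sgn y| = 1 := by
  filter_upwards [ae_norm_mem] with y hy
  rcases sgn_cases hy with h | h <;> simp [h.2]

variable {p : ℝ≥0∞} [hp1 : Fact (1 ≤ p)]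

/-- The even extension of a function on `(0, 1)` to the circle. -/
def evenExt : LpSpace p →ₗᵢ[ℝ] CircLp p :=
  Lp.compMeasurePreservingₗᵢ ℝ (fun y : Circ => ‖y‖) measurePreserving_norm

lemma evenExt_ae {G : LpSpace p} {g : ℝ → ℝ} (h : G =ᵐ[spaceMeasure] g) :
    evenExt G =ᵐ[circMeasure] fun y => g ‖y‖ :=
  (Lp.coeFn_compMeasurePreserving G _).trans
    (measurePreserving_norm.quasiMeasurePreserving.ae_eq_comp h)

/-- The odd extension of a function on `(0, 1)` to the circle. -/
def oddExt : LpSpace p →ₗᵢ[ℝ] CircLp p where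
  toLinearMap := ((mulOp sgn bddMeasurable_sgn).comp
    evenExt.toContinuousLinearMap : LpSpace p →L[ℝ] CircLp p)
  norm_map' := fun h => by
    rw [← evenExt.norm_map h]
    change ‖mulOp sgn bddMeasurable_sgn (evenExt h)‖ = _
    have e : ∀ᵐ y ∂circMeasure, ‖mulOp sgn bddMeasurable_sgn (evenExt h) y‖ = ‖evenExt h y‖ := by
      filter_upwards [coeFn_mulOp sgn bddMeasurable_sgn (evenExt h), ae_abs_sgn] with y h1 h2
      rw [h1, norm_mul, Real.norm_eq_abs (sgn y), h2, one_mul]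
    exact le_antisymm (Lp.norm_le_norm_of_ae_le (e.mono fun _ hy => hy.le))
      (Lp.norm_le_norm_of_ae_le (e.mono fun _ hy => hy.ge))

lemma oddExt_ae {H : LpSpace p} {h : ℝ → ℝ} (hh : H =ᵐ[spaceMeasure] h) :
    oddExt H =ᵐ[circMeasure] fun y => sgn y * h ‖y‖ := by
  filter_upwards [coeFn_mulOp sgn bddMeasurable_sgn (evenExt H), evenExt_ae hh] with y h1 h2
  refine h1.trans ?_
  rw [h2]

lemma reflect_evenExt (g : LpSpace p) : reflect (evenExt g) = evenExt g := by
  refine Lp.ext ((reflect_ae (evenExt_ae (ae_eq_refl _))).trans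
    (EventuallyEq.trans (Eventually.of_forall fun y => ?_) (evenExt_ae (ae_eq_refl _)).symm))
  simp only [norm_neg]

lemma reflect_oddExt (h : LpSpace p) : reflect (oddExt h) = -oddExt h := by
  refine Lp.ext ((reflect_ae (oddExt_ae (ae_eq_refl _))).trans ?_)
  filter_upwards [oddExt_ae (ae_eq_refl (h : ℝ → ℝ)), Lp.coeFn_neg (oddExt h)] with y h1 h2
  rw [h2, Pi.neg_apply, h1, norm_neg, sgn_neg, neg_mul]

/-- The map `(g, h) ↦ even g + odd h`; with `g = uₓ` and `h = uₜ` it collects the two Riemann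
invariants into one function on the circle. -/
def ext (g h : LpSpace p) : CircLp p := evenExt g + oddExt h

lemma reflect_ext (g h : LpSpace p) : reflect (ext g h) = evenExt g - oddExt h := by
  rw [ext, map_add, reflect_evenExt, reflect_oddExt, sub_eq_add_neg]

lemma evenExt_eq (g h : LpSpace p) : evenExt g = (2 : ℝ)⁻¹ • (ext g h + reflect (ext g h)) := by
  rw [reflect_ext, ext]
  module

lemma oddExt_eq (g h : LpSpace p) : oddExt h = (2 : ℝ)⁻¹ • (ext g h - reflect (ext g h)) := by
  rw [reflect_ext, ext]
  module

lemma norm_le_norm_ext_left (g h : LpSpace p) : ‖g‖ ≤ ‖ext g h‖ := by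
  rw [← evenExt.norm_map g, evenExt_eq g h, norm_smul]
  have := norm_add_le (ext g h) (reflect (ext g h))
  rw [LinearIsometry.norm_map] at this
  norm_num
  linarith

lemma norm_le_norm_ext_right (g h : LpSpace p) : ‖h‖ ≤ ‖ext g h‖ := by
  rw [← oddExt.norm_map h, oddExt_eq g h, norm_smul]
  have := norm_sub_le (ext g h) (reflect (ext g h))
  rw [LinearIsometry.norm_map] at this
  norm_num
  linarith

lemma norm_ext_le (g h : LpSpace p) : ‖ext g h‖ ≤ ‖g‖ + ‖h‖ := by
  refine (norm_add_le _ _).trans_eq ?_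
  rw [LinearIsometry.norm_map, LinearIsometry.norm_map]

lemma map_coe_le :
    spaceMeasure.map (fun x : ℝ => (x : Circ)) ≤ (2 : ℝ≥0∞) • circMeasure := by
  have h1 := (AddCircle.measurePreserving_mk (2 : ℝ) (-1)).map_eq
  have h2 : ENNReal.ofReal 2 = 2 := by norm_num
  rw [AddCircle.volume_eq_smul_haarAddCircle, h2] at h1
  rw [circMeasure, ← h1]
  refine Measure.map_mono (Measure.restrict_mono (fun x hx => ?_) le_rfl) AddCircle.measurable_mk'
  exact ⟨by linarith [hx.1], by linarith [hx.2]⟩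

/-- Every function on the circle is the sum of an even and an odd one. -/
lemma exists_ext_eq (w : CircLp p) : ∃ g h : LpSpace p, ext g h = w := by
  have hres : ∀ w : CircLp p, MemLp (fun x : ℝ => w (x : Circ)) p spaceMeasure := fun w => by
    have h1 : MemLp w p (spaceMeasure.map (fun x : ℝ => (x : Circ))) :=
      (Lp.memLp w).of_measure_le_smul ENNReal.ofNat_ne_top map_coe_le
    exact h1.comp_of_map AddCircle.measurable_mk'.aemeasurable
  set r : LpSpace p := (hres w).toLp _ with hr
  set s : LpSpace p := (hres (reflect w)).toLp _ with hs
  have hra : r =ᵐ[spaceMeasure] fun x => w (x : Circ) := (hres w).coeFn_toLp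
  have hsa : s =ᵐ[spaceMeasure] fun x => w ((-x : ℝ) : Circ) := by
    have hq : Measure.QuasiMeasurePreserving (fun x : ℝ => (x : Circ)) spaceMeasure circMeasure :=
      ⟨AddCircle.measurable_mk', (Measure.absolutelyContinuous_of_le map_coe_le).trans
        Measure.smul_absolutelyContinuous⟩
    have h1 : ∀ᵐ x : ℝ ∂spaceMeasure, reflect w (x : Circ) = w (-(x : Circ)) :=
      hq.ae (reflect_ae (ae_eq_refl (w : Circ → ℝ)))
    filter_upwards [(hres (reflect w)).coeFn_toLp, h1] with x h2 h3
    rw [h2, h3, AddCircle.coe_neg]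
  refine ⟨(2 : ℝ)⁻¹ • (r + s), (2 : ℝ)⁻¹ • (r - s), ?_⟩
  have hg : ((2 : ℝ)⁻¹ • (r + s) : LpSpace p) =ᵐ[spaceMeasure]
      fun x => 2⁻¹ * (w (x : Circ) + w ((-x : ℝ) : Circ)) := by
    filter_upwards [Lp.coeFn_smul (2 : ℝ)⁻¹ (r + s), Lp.coeFn_add r s, hra, hsa] with x a1 a2 a3 a4
    rw [a1, Pi.smul_apply, a2, Pi.add_apply, a3, a4, smul_eq_mul]
  have hh : ((2 : ℝ)⁻¹ • (r - s) : LpSpace p) =ᵐ[spaceMeasure]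
      fun x => 2⁻¹ * (w (x : Circ) - w ((-x : ℝ) : Circ)) := by
    filter_upwards [Lp.coeFn_smul (2 : ℝ)⁻¹ (r - s), Lp.coeFn_sub r s, hra, hsa] with x a1 a2 a3 a4
    rw [a1, Pi.smul_apply, a2, Pi.sub_apply, a3, a4, smul_eq_mul]
  refine Lp.ext ?_
  filter_upwards [Lp.coeFn_add (evenExt ((2 : ℝ)⁻¹ • (r + s))) (oddExt ((2 : ℝ)⁻¹ • (r - s))),
    evenExt_ae hg, oddExt_ae hh, ae_norm_mem] with y a1 a2 a3 a4
  refine a1.trans ?_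
  rw [Pi.add_apply, a2, a3]
  rcases sgn_cases a4 with ⟨h1, h2⟩ | ⟨h1, h2⟩
  · rw [h2, ← h1]; ring
  · rw [h2, ← h1]; ring

lemma integral_circ_norm {G : Type*} [NormedAddCommGroup G] [NormedSpace ℝ G] (F : ℝ → G)
    (hF : AEStronglyMeasurable F spaceMeasure) :
    ∫ y : Circ, F ‖y‖ ∂circMeasure = ∫ x, F x ∂spaceMeasure := by
  rw [← measurePreserving_norm.map_eq, integral_map measurePreserving_norm.measurable.aemeasurable]
  rwa [measurePreserving_norm.map_eq]

lemma mean_ext (g h : LpSpace p) : mean (ext g h) = mean g := by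
  have h1 : ∀ f : CircLp p, mean (reflect f) = mean f := fun f => by
    rw [mean_apply, mean_apply, integral_congr_ae (reflect_ae (ae_eq_refl (f : Circ → ℝ))),
      integral_neg_eq_self (fun y => f y)]
  have h2 : mean (oddExt h) = 0 := by
    have := h1 (oddExt h)
    rw [reflect_oddExt, map_neg] at this
    linarith
  have h3 : mean (evenExt g) = mean g := by
    rw [mean_apply, mean_apply, integral_congr_ae (evenExt_ae (ae_eq_refl (g : ℝ → ℝ))),
      integral_circ_norm (fun x => g x) (Lp.aestronglyMeasurable g)]
  rw [ext, map_add, h2, h3, add_zero]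

lemma bddMeasurable_cos (n : ℤ) : BddMeasurable fun x : ℝ => Real.cos (Real.pi * n * x) :=
  BddMeasurable.of_continuous (by fun_prop) (C := 1) fun x => Real.abs_cos_le_one _

lemma bddMeasurable_sin (n : ℤ) : BddMeasurable fun x : ℝ => Real.sin (Real.pi * n * x) :=
  BddMeasurable.of_continuous (by fun_prop) (C := 1) fun x => Real.abs_sin_le_one _

/-- The cosine coefficients on `(0, 1)`. -/
def cosCoef (n : ℤ) : LpSpace p →L[ℝ] ℝ := pairing _ (bddMeasurable_cos n)

/-- The sine coefficients on `(0, 1)`. -/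
def sinCoef (n : ℤ) : LpSpace p →L[ℝ] ℝ := pairing _ (bddMeasurable_sin n)

lemma fourier_norm_or (n : ℤ) {y : Circ} (hy : ‖y‖ ∈ Ioo (0 : ℝ) 1) :
    fourier n y = Real.cos (Real.pi * n * ‖y‖) + sgn y * Real.sin (Real.pi * n * ‖y‖) * Complex.I := by
  rcases sgn_cases hy with ⟨h1, h2⟩ | ⟨h1, h2⟩
  · nth_rewrite 1 [h1]
    rw [fourier_coe, h2, Complex.exp_mul_I]
    simp
  · nth_rewrite 1 [h1]
    rw [fourier_coe, h2, Complex.exp_mul_I]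
    simp

lemma integral_sgn_mul (F : ℝ → ℂ) : ∫ y : Circ, (sgn y : ℂ) * F ‖y‖ ∂circMeasure = 0 := by
  have h := integral_neg_eq_self (fun y : Circ => (sgn y : ℂ) * F ‖y‖) circMeasure
  simp only [sgn_neg, norm_neg, Complex.ofReal_neg, neg_mul, integral_neg] at h
  exact self_eq_neg.1 h.symm

lemma fcoef_ext (n : ℤ) (g h : LpSpace p) :
    fcoef n (ext g h) = cosCoef n g + sinCoef n h * Complex.I := by
  have e : ∀ᵐ y ∂circMeasure, (ext g h y : ℂ) * fourier n y
      = ((g ‖y‖ * Real.cos (Real.pi * n * ‖y‖) : ℝ) + (h ‖y‖ * Real.sin (Real.pi * n * ‖y‖) : ℝ) * Complex.I)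
        + sgn y * ((g ‖y‖ * Real.sin (Real.pi * n * ‖y‖) : ℝ) * Complex.I
          + (h ‖y‖ * Real.cos (Real.pi * n * ‖y‖) : ℝ)) := by
    filter_upwards [Lp.coeFn_add (evenExt g) (oddExt h), evenExt_ae (ae_eq_refl (g : ℝ → ℝ)),
      oddExt_ae (ae_eq_refl (h : ℝ → ℝ)), ae_norm_mem] with y a1 a2 a3 a4
    have a5 : ext g h y = g ‖y‖ + sgn y * h ‖y‖ := by
      refine a1.trans ?_
      rw [Pi.add_apply, a2, a3]
    have a6 : (sgn y : ℂ) * sgn y = 1 := by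
      rcases sgn_cases a4 with h | h <;> simp [h.2]
    rw [a5, fourier_norm_or n a4]
    push_cast
    linear_combination ((h ‖y‖ : ℂ) * Complex.sin (Real.pi * n * ‖y‖) * Complex.I) * a6
  have ic : ∀ k : LpSpace p, Integrable (fun x => k x * Real.cos (Real.pi * n * x)) spaceMeasure :=
    fun k => integrable_pairing (𝕜 := ℝ) (bddMeasurable_cos n) k
  have is : ∀ k : LpSpace p, Integrable (fun x => k x * Real.sin (Real.pi * n * x)) spaceMeasure :=
    fun k => integrable_pairing (𝕜 := ℝ) (bddMeasurable_sin n) k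
  have i1 : Integrable (fun x => ((g x * Real.cos (Real.pi * n * x) : ℝ) : ℂ)
      + (h x * Real.sin (Real.pi * n * x) : ℝ) * Complex.I) spaceMeasure :=
    (ic g).ofReal.add ((is h).ofReal.mul_const _)
  have i2 : Integrable (fun x => ((g x * Real.sin (Real.pi * n * x) : ℝ) : ℂ) * Complex.I
      + (h x * Real.cos (Real.pi * n * x) : ℝ)) spaceMeasure :=
    ((is g).ofReal.mul_const _).add (ic h).ofReal
  have j1 : Integrable (fun y : Circ => ((g ‖y‖ * Real.cos (Real.pi * n * ‖y‖) : ℝ) : ℂ)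
      + (h ‖y‖ * Real.sin (Real.pi * n * ‖y‖) : ℝ) * Complex.I) circMeasure :=
    (measurePreserving_norm.integrable_comp i1.1).2 i1
  have j2 : Integrable (fun y : Circ => ((g ‖y‖ * Real.sin (Real.pi * n * ‖y‖) : ℝ) : ℂ) * Complex.I
      + (h ‖y‖ * Real.cos (Real.pi * n * ‖y‖) : ℝ)) circMeasure :=
    (measurePreserving_norm.integrable_comp i2.1).2 i2
  have j3 : Integrable (fun y : Circ => (sgn y : ℂ) * ((g ‖y‖ * Real.sin (Real.pi * n * ‖y‖) : ℝ) * Complex.I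
          + (h ‖y‖ * Real.cos (Real.pi * n * ‖y‖) : ℝ))) circMeasure := by
    refine j2.bdd_mul (c := 1)
      (Complex.measurable_ofReal.comp bddMeasurable_sgn.meas.measurable).aestronglyMeasurable ?_
    filter_upwards [ae_abs_sgn] with y hy
    rw [Complex.norm_real, Real.norm_eq_abs, hy]
  rw [fcoef_apply, integral_congr_ae e, integral_add j1 j3, integral_sgn_mul
    (fun x => ((g x * Real.sin (Real.pi * n * x) : ℝ) : ℂ) * Complex.I
      + (h x * Real.cos (Real.pi * n * x) : ℝ)), add_zero,
    integral_circ_norm (fun x => ((g x * Real.cos (Real.pi * n * x) : ℝ) : ℂ)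
      + (h x * Real.sin (Real.pi * n * x) : ℝ) * Complex.I) i1.1,
    integral_add (ic g).ofReal ((is h).ofReal.mul_const _), integral_mul_const]
  have k1 : ∫ x, ((g x * Real.cos (Real.pi * n * x) : ℝ) : ℂ) ∂spaceMeasure = (cosCoef n g : ℝ) :=
    integral_complex_ofReal
  have k2 : ∫ x, ((h x * Real.sin (Real.pi * n * x) : ℝ) : ℂ) ∂spaceMeasure = (sinCoef n h : ℝ) :=
    integral_complex_ofReal
  exact congrArg₂ (fun a b : ℂ => a + b * Complex.I) k1 k2

end Fold

/-! ### The evolution in terms of Fourier coefficients -/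

/-- A damping coefficient on the interval, defined everywhere and with values in `[0, M]`. -/
structure IsIntervalDamping (a : ℝ → ℝ → ℝ) (M : ℝ) : Prop where
  meas : Measurable (Function.uncurry a)
  nonneg : ∀ t x, 0 ≤ a t x
  le : ∀ t x, a t x ≤ M

section FourierSystem

variable {p : ℝ≥0∞} [hp1 : Fact (1 ≤ p)] {a : ℝ → ℝ → ℝ} {M : ℝ}

lemma IsIntervalDamping.isDamping (ha : IsIntervalDamping a M) :
    IsDamping (fun t y => a t ‖y‖) M :=
  ⟨ha.meas.comp (measurable_fst.prodMk (continuous_norm.measurable.comp measurable_snd)),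
    fun _ _ => ha.nonneg _ _, fun _ _ => ha.le _ _, fun _ _ => by rw [norm_neg]⟩

lemma IsIntervalDamping.abs_le (ha : IsIntervalDamping a M) (t x : ℝ) : |a t x| ≤ M := by
  rw [abs_of_nonneg (ha.nonneg t x)]; exact ha.le t x

lemma IsIntervalDamping.bddMeasurable (ha : IsIntervalDamping a M) (t : ℝ) :
    BddMeasurable (a t) :=
  ⟨(ha.meas.comp measurable_prodMk_left).stronglyMeasurable, M, ha.abs_le t⟩

/-- Multiplication by the damping coefficient. -/
def damp (ha : IsIntervalDamping a M) (t : ℝ) : LpSpace p →L[ℝ] LpSpace p :=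
  mulOp (a t) (ha.bddMeasurable t)

lemma coeFn_damp (ha : IsIntervalDamping a M) (t : ℝ) (f : LpSpace p) :
    damp ha t f =ᵐ[spaceMeasure] fun x => a t x * f x :=
  coeFn_mulOp _ (ha.bddMeasurable t) f

lemma isCoefficient_damp (hp : p ≠ ∞) (ha : IsIntervalDamping a M) :
    IsCoefficient (damp ha : ℝ → LpSpace p →L[ℝ] LpSpace p) M := by
  refine ⟨fun t => ContinuousLinearMap.opNorm_le_bound _ ((ha.nonneg 0 0).trans (ha.le 0 0))
    fun f => norm_mulOp_le _ (ha.abs_le t) f, fun f => ?_⟩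
  refine stronglyMeasurable_toLp hp (f := fun t x => a t x * f x) ?_
    fun t => coeFn_mulOp _ (ha.bddMeasurable t) f
  exact ha.meas.mul ((Lp.stronglyMeasurable f).measurable.comp measurable_snd)

/-- In terms of `uₓ` and `uₜ`, the operator `jump` is the damping `h ↦ a h` up to a multiple of the
identity. -/
lemma jump_ext (ha : IsIntervalDamping a M) (s : ℝ) (g h : LpSpace p) :
    jump ha.isDamping s (ext g h) = (M / 2) • ext g h - oddExt (damp ha s h) := by
  have h2 := oddExt_eq g h
  generalize ext g h = w at h2 ⊢
  have h3 : oddExt (damp ha s h) =ᵐ[circMeasure] fun y => sgn y * (a s ‖y‖ * h ‖y‖) :=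
    oddExt_ae (h := fun x => a s x * h x) (coeFn_damp ha s h)
  have h4 : oddExt h =ᵐ[circMeasure] fun y => sgn y * h ‖y‖ :=
    oddExt_ae (ae_eq_refl (h : ℝ → ℝ))
  have h1 : reflect w =ᵐ[circMeasure] fun y => w (-y) := reflect_ae (ae_eq_refl (w : Circ → ℝ))
  have h5 : jump ha.isDamping s w =ᵐ[circMeasure]
      fun y => (M - a s ‖y‖) / 2 * w y + a s ‖y‖ / 2 * w (-y) :=
    coeFn_jump ha.isDamping s (ae_eq_refl (w : Circ → ℝ))
  generalize jump ha.isDamping s w = j at h5 ⊢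
  generalize oddExt (damp ha s h) = d at h3 ⊢
  rw [h2] at h4
  generalize reflect w = r at h1 h4
  have h6 := Lp.coeFn_sub ((M / 2) • w) d
  have h7 := Lp.coeFn_smul (M / 2) w
  have h8 := Lp.coeFn_smul (2 : ℝ)⁻¹ (w - r)
  have h9 := Lp.coeFn_sub w r
  refine Lp.ext ?_
  filter_upwards [h1, h3, h4, h5, h6, h7, h8, h9] with y a1 a3 a4 a5 a6 a7 a8 a9
  rw [a8, Pi.smul_apply, a9, Pi.sub_apply, smul_eq_mul, a1] at a4
  rw [a5, a6, Pi.sub_apply, a7, Pi.smul_apply, smul_eq_mul, a3]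
  linear_combination (-a s ‖y‖) * a4

/-- The wave equation, tested against `cos (π n x)` and `sin (π n x)`: here `g` stands for `uₓ` and
`h` for `uₜ`. -/
structure IsFourierSolution (ha : IsIntervalDamping a M) (g h : ℝ → LpSpace p) : Prop where
  cos_eq : ∀ (n : ℤ) (t : ℝ), 0 ≤ t →
    cosCoef n (g t) = cosCoef n (g 0) + Real.pi * n * ∫ s in (0 : ℝ)..t, sinCoef n (h s)
  sin_eq : ∀ (n : ℤ) (t : ℝ), 0 ≤ t →
    sinCoef n (h t) = sinCoef n (h 0) - (Real.pi * n * (∫ s in (0 : ℝ)..t, cosCoef n (g s))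
      + ∫ s in (0 : ℝ)..t, sinCoef n (damp ha s (h s)))

/-- Multiplication of an integral equation by an exponential. -/
lemma exp_mul_eq_integral {f q : ℝ → ℂ} {f₀ : ℂ} (c : ℂ)
    (hq : ∀ t, 0 ≤ t → IntervalIntegrable q volume 0 t)
    (hf : ∀ t, 0 ≤ t → f t = f₀ + ∫ s in (0 : ℝ)..t, q s) {t : ℝ} (ht : 0 ≤ t) :
    Complex.exp (c * t) * f t
      = f₀ + ∫ s in (0 : ℝ)..t, Complex.exp (c * s) * (c * f s + q s) := by
  have hφ : ∀ x : ℝ, HasDerivAt (fun s : ℝ => Complex.exp (c * s)) (c * Complex.exp (c * x)) x :=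
    fun x => by
      have h1 : HasDerivAt (fun s : ℝ => c * (s : ℂ)) (c * 1) x :=
        (Complex.ofRealCLM.hasDerivAt (x := x)).const_mul c
      have := h1.cexp
      rwa [mul_one, mul_comm] at this
  have hcont : Continuous fun s : ℝ => Complex.exp (c * s) := by fun_prop
  have hφ' : Continuous fun s : ℝ => c * Complex.exp (c * s) := by fun_prop
  have h1 := integral_deriv_mul_primitive ht hφ hφ' (hq t ht)
  have hprim : ContinuousOn (fun s => ∫ r in (0 : ℝ)..s, q r) (uIcc 0 t) :=
    intervalIntegral.continuousOn_primitive_interval'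
      (hq t ht) left_mem_uIcc
  have h2 : ∫ s in (0 : ℝ)..t, Complex.exp (c * s) * (c * f s + q s)
      = (∫ s in (0 : ℝ)..t, (c * Complex.exp (c * s) * (∫ r in (0 : ℝ)..s, q r)
          + Complex.exp (c * s) * q s)) + ∫ s in (0 : ℝ)..t, c * Complex.exp (c * s) * f₀ := by
    have i1 : IntervalIntegrable (fun s => c * Complex.exp (c * s) * ∫ r in (0 : ℝ)..s, q r)
        volume 0 t := (hφ'.continuousOn.mul hprim).intervalIntegrable
    have i2 : IntervalIntegrable (fun s => Complex.exp (c * s) * q s) volume 0 t :=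
      (hq t ht).continuousOn_mul hcont.continuousOn
    have i3 : IntervalIntegrable (fun s : ℝ => c * Complex.exp (c * s) * f₀) volume 0 t :=
      (hφ'.mul continuous_const).intervalIntegrable _ _
    have i4 : IntervalIntegrable (fun s => c * Complex.exp (c * s) * (∫ r in (0 : ℝ)..s, q r)
        + Complex.exp (c * s) * q s) volume 0 t := i1.add i2
    rw [← intervalIntegral.integral_add i4 i3]
    refine intervalIntegral.integral_congr fun s hs => ?_
    rw [uIcc_of_le ht] at hs
    rw [hf s hs.1]
    ring
  rw [h2, h1, intervalIntegral.integral_mul_const,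
    intervalIntegral.integral_eq_sub_of_hasDerivAt (fun x _ => hφ x)
      (hφ'.intervalIntegrable _ _), hf t ht]
  simp
  ring

lemma continuousOn_ext {g h : ℝ → LpSpace p} (hg : ContinuousOn g (Ici 0))
    (hh : ContinuousOn h (Ici 0)) : ContinuousOn (fun t => ext (g t) (h t)) (Ici 0) :=
  (evenExt.continuous.comp_continuousOn hg).add (oddExt.continuous.comp_continuousOn hh)

lemma continuousOn_translate (hp : p ≠ ∞) {f : ℝ → CircLp p} {s : ℝ → ℝ}
    (hf : ContinuousOn f (Ici 0)) (hs : Continuous s) :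
    ContinuousOn (fun t => translate (s t) (f t)) (Ici 0) := by
  refine (continuous_translate hp (continuous_comp_max hf) hs).continuousOn.congr fun t ht => ?_
  simp only [max_eq_left (mem_Ici.1 ht)]

lemma integrable_coef (hp : p ≠ ∞) (ha : IsIntervalDamping a M) {F : Type*}
    [NormedAddCommGroup F] [NormedSpace ℝ F] [CompleteSpace F] (l : LpSpace p →L[ℝ] F)
    {h : ℝ → LpSpace p} (hh : ContinuousOn h (Ici 0)) {t : ℝ} (ht : 0 ≤ t) :
    IntervalIntegrable (fun s => l (h s)) volume 0 t ∧
      IntervalIntegrable (fun s => l (damp ha s (h s))) volume 0 t := by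
  have h1 : IntervalIntegrable h volume 0 t :=
    (hh.mono (by rw [uIcc_of_le ht]; exact Icc_subset_Ici_self)).intervalIntegrable
  have h2 := (isCoefficient_damp hp ha).intervalIntegrable hh le_rfl ht
  exact ⟨⟨l.integrable_comp h1.1, l.integrable_comp h1.2⟩,
    ⟨l.integrable_comp h2.1, l.integrable_comp h2.2⟩⟩

/-- The complex form of the Fourier system. -/
lemma fourier_iff (hp : p ≠ ∞) (ha : IsIntervalDamping a M) {g h : ℝ → LpSpace p}
    (hg : ContinuousOn g (Ici 0)) (hh : ContinuousOn h (Ici 0)) (n : ℤ) {t : ℝ} (ht : 0 ≤ t) :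
    (cosCoef n (g t) = cosCoef n (g 0) + Real.pi * n * (∫ s in (0 : ℝ)..t, sinCoef n (h s)) ∧
      sinCoef n (h t) = sinCoef n (h 0) - (Real.pi * n * (∫ s in (0 : ℝ)..t, cosCoef n (g s))
        + ∫ s in (0 : ℝ)..t, sinCoef n (damp ha s (h s)))) ↔
    fcoef n (ext (g t) (h t)) = fcoef n (ext (g 0) (h 0))
      + ∫ s in (0 : ℝ)..t, (-(Real.pi * n * Complex.I) * fcoef n (ext (g s) (h s))
        - sinCoef n (damp ha s (h s)) * Complex.I) := by
  have i1 := (integrable_coef hp ha (cosCoef n) hg ht).1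
  have i2 := (integrable_coef hp ha (sinCoef n) hh ht).1
  have i3 := (integrable_coef hp ha (sinCoef n) hh ht).2
  have e : ∫ s in (0 : ℝ)..t, (-(Real.pi * n * Complex.I) * fcoef n (ext (g s) (h s))
        - sinCoef n (damp ha s (h s)) * Complex.I)
      = ((Real.pi * n * ∫ s in (0 : ℝ)..t, sinCoef n (h s) : ℝ) : ℂ)
        - ((Real.pi * n * (∫ s in (0 : ℝ)..t, cosCoef n (g s))
        + ∫ s in (0 : ℝ)..t, sinCoef n (damp ha s (h s)) : ℝ) : ℂ) * Complex.I := by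
    have h1 : ∀ s, (-(Real.pi * n * Complex.I) * fcoef n (ext (g s) (h s))
        - sinCoef n (damp ha s (h s)) * Complex.I)
        = ((Real.pi * n * sinCoef n (h s) : ℝ) : ℂ)
          - ((Real.pi * n * cosCoef n (g s) + sinCoef n (damp ha s (h s)) : ℝ) : ℂ) * Complex.I := by
      intro s
      rw [fcoef_ext]
      push_cast
      linear_combination (-(Real.pi * n * sinCoef n (h s)) : ℂ) * Complex.I_mul_I
    simp_rw [h1]
    rw [intervalIntegral.integral_sub, intervalIntegral.integral_mul_const,
      intervalIntegral.integral_ofReal, intervalIntegral.integral_ofReal,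
      intervalIntegral.integral_const_mul, intervalIntegral.integral_add (i1.const_mul _) i3,
      intervalIntegral.integral_const_mul]
    · exact ⟨(i2.const_mul _).1.ofReal, (i2.const_mul _).2.ofReal⟩
    · have := (i1.const_mul (Real.pi * n)).add i3
      have q : IntervalIntegrable (fun s => ((Real.pi * n * cosCoef n (g s)
        + sinCoef n (damp ha s (h s)) : ℝ) : ℂ)) volume 0 t := ⟨this.1.ofReal, this.2.ofReal⟩
      exact q.mul_const _
  rw [e, fcoef_ext, fcoef_ext, Complex.ext_iff]
  simp only [Complex.add_re, Complex.add_im, Complex.sub_re, Complex.sub_im, Complex.mul_re,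
    Complex.mul_im, Complex.ofReal_re, Complex.ofReal_im, Complex.I_re, Complex.I_im]
  constructor
  · rintro ⟨h1, h2⟩
    constructor <;> [rw [h1]; rw [h2]] <;> ring
  · rintro ⟨h1, h2⟩
    constructor <;> linarith

/-- The change of frame that turns solutions of the wave equation into solutions of the evolution
equation with generator `gen`. -/
def frame (M : ℝ) (g h : ℝ → LpSpace p) (t : ℝ) : CircLp p :=
  Real.exp (M / 2 * t) • translate (-t) (ext (g t) (h t))

lemma fcoef_frame (M : ℝ) (n : ℤ) (g h : ℝ → LpSpace p) (t : ℝ) :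
    fcoef n (frame M g h t)
      = Complex.exp ((M / 2 + Real.pi * n * Complex.I) * t) * fcoef n (ext (g t) (h t)) := by
  rw [frame, map_smul, fcoef_translate, Complex.real_smul, Complex.ofReal_exp, ← mul_assoc,
    ← Complex.exp_add]
  congr 2
  push_cast
  ring

lemma fcoef_gen_frame (ha : IsIntervalDamping a M) (n : ℤ) (g h : ℝ → LpSpace p) (s : ℝ) :
    fcoef n (gen ha.isDamping s (frame M g h s))
      = Complex.exp ((M / 2 + Real.pi * n * Complex.I) * s)
        * (M / 2 * fcoef n (ext (g s) (h s)) - sinCoef n (damp ha s (h s)) * Complex.I) := by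
  have h1 : fcoef n (oddExt (damp ha s (h s))) = sinCoef n (damp ha s (h s)) * Complex.I := by
    have := fcoef_ext n (0 : LpSpace p) (damp ha s (h s))
    rw [ext, map_zero, map_zero, zero_add] at this
    rw [this, Complex.ofReal_zero, zero_add]
  rw [frame, map_smul, gen_apply, translate_trans_neg, jump_ext ha, map_smul, fcoef_translate, map_sub,
    map_smul, h1, Complex.real_smul, Complex.real_smul, Complex.ofReal_exp, ← mul_assoc,
    ← Complex.exp_add]
  congr 2
  · push_cast; ring
  · push_cast; ring

lemma continuousOn_frame (hp : p ≠ ∞) (M : ℝ) {g h : ℝ → LpSpace p}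
    (hg : ContinuousOn g (Ici 0)) (hh : ContinuousOn h (Ici 0)) :
    ContinuousOn (frame M g h) (Ici 0) :=
  (by fun_prop : Continuous fun t : ℝ => Real.exp (M / 2 * t)).continuousOn.smul
    (continuousOn_translate hp (continuousOn_ext hg hh) continuous_neg)

lemma frame_zero (M : ℝ) (g h : ℝ → LpSpace p) : frame M g h 0 = ext (g 0) (h 0) := by
  simp [frame, translate_zero]

/-- The evolution equation on the circle is equivalent to the wave equation tested against the
trigonometric functions. -/
lemma isEvolution_frame_iff (hp : p ≠ ∞) (ha : IsIntervalDamping a M) {g h : ℝ → LpSpace p}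
    (hg : ContinuousOn g (Ici 0)) (hh : ContinuousOn h (Ici 0)) :
    IsEvolution (gen ha.isDamping) (ext (g 0) (h 0)) (frame M g h) ↔ IsFourierSolution ha g h := by
  have hA := isCoefficient_gen (p := p) hp ha.isDamping
  have hfc := continuousOn_frame hp M hg hh
  have hec := continuousOn_ext hg hh
  have hi : ∀ (n : ℤ) (t : ℝ), 0 ≤ t → IntervalIntegrable (fun s =>
      (sinCoef n (damp ha s (h s)) : ℂ) * Complex.I) volume 0 t := fun n t ht => by
    have := (integrable_coef hp ha (sinCoef n) hh ht).2
    have q : IntervalIntegrable (fun s => (sinCoef n (damp ha s (h s)) : ℂ)) volume 0 t :=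
      ⟨this.1.ofReal, this.2.ofReal⟩
    exact q.mul_const _
  have hm : ∀ (n : ℤ) (t : ℝ), 0 ≤ t → IntervalIntegrable (fun s =>
      fcoef n (ext (g s) (h s))) volume 0 t := fun n t ht =>
    (((fcoef n).continuous.comp_continuousOn hec).mono
      (by rw [uIcc_of_le ht]; exact Icc_subset_Ici_self)).intervalIntegrable
  have key : (∀ t, 0 ≤ t → frame M g h t
        = ext (g 0) (h 0) + ∫ s in (0 : ℝ)..t, gen ha.isDamping s (frame M g h s)) ↔
      ∀ (n : ℤ) (t : ℝ), 0 ≤ t → fcoef n (frame M g h t) = fcoef n (ext (g 0) (h 0))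
        + ∫ s in (0 : ℝ)..t, fcoef n (gen ha.isDamping s (frame M g h s)) := by
    have hcomm : ∀ (n : ℤ) (t : ℝ), 0 ≤ t →
        ∫ s in (0 : ℝ)..t, fcoef n (gen ha.isDamping s (frame M g h s))
          = fcoef n (∫ s in (0 : ℝ)..t, gen ha.isDamping s (frame M g h s)) := fun n t ht =>
      (fcoef n).intervalIntegral_comp_comm (hA.intervalIntegrable hfc le_rfl ht)
    constructor
    · intro H n t ht
      rw [hcomm n t ht, ← map_add, ← H t ht]
    · intro H t ht
      rw [← sub_eq_zero]
      refine eq_zero_of_fcoef _ fun n => ?_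
      rw [map_sub, map_add, ← hcomm n t ht, H n t ht, sub_self]
  have key2 : ∀ n : ℤ, (∀ t : ℝ, 0 ≤ t → fcoef n (frame M g h t) = fcoef n (ext (g 0) (h 0))
        + ∫ s in (0 : ℝ)..t, fcoef n (gen ha.isDamping s (frame M g h s))) ↔
      ∀ t : ℝ, 0 ≤ t → fcoef n (ext (g t) (h t)) = fcoef n (ext (g 0) (h 0))
      + ∫ s in (0 : ℝ)..t, (-(Real.pi * n * Complex.I) * fcoef n (ext (g s) (h s))
        - sinCoef n (damp ha s (h s)) * Complex.I) := by
    intro n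
    simp only [fcoef_frame, fcoef_gen_frame ha]
    set c : ℂ := M / 2 + Real.pi * n * Complex.I with hc
    constructor
    · intro H t ht
      have := exp_mul_eq_integral (-c) (fun t ht =>
        (((hm n t ht).const_mul (M / 2 : ℂ)).sub (hi n t ht)).continuousOn_mul
          (by fun_prop : Continuous fun s : ℝ => Complex.exp (c * s)).continuousOn) H ht
      rw [← mul_assoc, ← Complex.exp_add, neg_mul, neg_add_cancel, Complex.exp_zero, one_mul] at this
      rw [this]
      congr 1
      refine intervalIntegral.integral_congr fun s _ => ?_
      have e : Complex.exp (-(c * s)) * Complex.exp (c * s) = 1 := by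
        rw [← Complex.exp_add, neg_add_cancel, Complex.exp_zero]
      simp only [neg_mul]
      linear_combination (-c * fcoef n (ext (g s) (h s)) + (M / 2 * fcoef n (ext (g s) (h s))
        - sinCoef n (damp ha s (h s)) * Complex.I)) * e - fcoef n (ext (g s) (h s)) * hc
    · intro H t ht
      rw [exp_mul_eq_integral c (fun t ht =>
        ((hm n t ht).const_mul (-(Real.pi * n * Complex.I) : ℂ)).sub (hi n t ht)) H ht]
      congr 1
      refine intervalIntegral.integral_congr fun s _ => ?_
      linear_combination Complex.exp (c * s) * fcoef n (ext (g s) (h s)) * hc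
  constructor
  · intro H
    have h1 := fun n => (key2 n).1 (key.1 H.eq n)
    exact ⟨fun n t ht => ((fourier_iff hp ha hg hh n ht).2 (h1 n t ht)).1,
      fun n t ht => ((fourier_iff hp ha hg hh n ht).2 (h1 n t ht)).2⟩
  · intro H
    exact ⟨hfc, key.2 fun n => (key2 n).2 fun t ht =>
      (fourier_iff hp ha hg hh n ht).1 ⟨H.cos_eq n t ht, H.sin_eq n t ht⟩⟩

end FourierSystem

/-! ### Primitives and weak derivatives on the interval -/

section Primitive

variable {p : ℝ≥0∞} [hp1 : Fact (1 ≤ p)]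

lemma integral_Ioo_eq_interval {F : Type*} [NormedAddCommGroup F] [NormedSpace ℝ F] (f : ℝ → F) :
    ∫ x in Ioo (0 : ℝ) 1, f x = ∫ x in (0 : ℝ)..1, f x := by
  rw [intervalIntegral.integral_of_le zero_le_one, integral_Ioc_eq_integral_Ioo]

/-- The primitive `x ↦ ∫₀ˣ g` of `g ∈ L^p(0, 1)`, where `g` is extended by zero. -/
def primFun (g : LpSpace p) (x : ℝ) : ℝ := ∫ y in (0 : ℝ)..x, (Ioo (0 : ℝ) 1).indicator g y

lemma integrable_indicator (g : LpSpace p) : Integrable ((Ioo (0 : ℝ) 1).indicator g) volume :=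
  (integrable_indicator_iff measurableSet_Ioo).2 (integrable_of_lp g)

lemma continuous_primFun (g : LpSpace p) : Continuous (primFun g) :=
  (integrable_indicator g).continuous_primitive 0

lemma primFun_zero (g : LpSpace p) : primFun g 0 = 0 := intervalIntegral.integral_same

lemma primFun_one (g : LpSpace p) : primFun g 1 = mean g := by
  rw [primFun, mean_apply, ← integral_Ioo_eq_interval]
  exact setIntegral_congr_fun measurableSet_Ioo fun x hx => indicator_of_mem hx _

lemma abs_primFun_le (g : LpSpace p) (x : ℝ) : |primFun g x| ≤ ‖g‖ := by
  rw [primFun, ← Real.norm_eq_abs]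
  refine intervalIntegral.norm_integral_le_integral_norm_uIoc.trans
    (le_trans ?_ (integral_norm_le_norm g))
  calc ∫ y in uIoc 0 x, ‖(Ioo (0 : ℝ) 1).indicator g y‖
      ≤ ∫ y, ‖(Ioo (0 : ℝ) 1).indicator g y‖ :=
        setIntegral_le_integral (integrable_indicator g).norm
          (Eventually.of_forall fun _ => norm_nonneg _)
    _ = ∫ y in Ioo (0 : ℝ) 1, ‖g y‖ := by
        rw [← integral_indicator measurableSet_Ioo]
        refine integral_congr_ae (Eventually.of_forall fun y => ?_)
        exact norm_indicator_eq_indicator_norm _ _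

lemma memLp_primFun (g : LpSpace p) : MemLp (primFun g) p spaceMeasure :=
  MemLp.of_bound (continuous_primFun g).aestronglyMeasurable ‖g‖
    (Eventually.of_forall (abs_primFun_le g))

lemma primFun_add (f g : LpSpace p) (x : ℝ) : primFun (f + g) x = primFun f x + primFun g x := by
  rw [primFun, primFun, primFun, ← intervalIntegral.integral_add
    (integrable_indicator f).intervalIntegrable (integrable_indicator g).intervalIntegrable]
  refine intervalIntegral.integral_congr_ae ?_
  filter_upwards [(ae_restrict_iff' measurableSet_Ioo).1 (Lp.coeFn_add f g)] with y hy _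
  by_cases h : y ∈ Ioo (0 : ℝ) 1
  · simp only [indicator_of_mem h]; exact hy h
  · simp [indicator_of_notMem h]

lemma primFun_smul (c : ℝ) (g : LpSpace p) (x : ℝ) : primFun (c • g) x = c * primFun g x := by
  rw [primFun, primFun, ← intervalIntegral.integral_const_mul]
  refine intervalIntegral.integral_congr_ae ?_
  filter_upwards [(ae_restrict_iff' measurableSet_Ioo).1 (Lp.coeFn_smul c g)] with y hy _
  by_cases h : y ∈ Ioo (0 : ℝ) 1
  · simp only [indicator_of_mem h]; exact hy h
  · simp [indicator_of_notMem h]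

/-- The Volterra operator `g ↦ ∫₀ˣ g` on `L^p(0, 1)`. -/
def prim : LpSpace p →L[ℝ] LpSpace p :=
  LinearMap.mkContinuous
    { toFun := fun g => (memLp_primFun g).toLp (primFun g)
      map_add' := fun f g => by
        rw [← MemLp.toLp_add]
        exact MemLp.toLp_congr _ _ (Eventually.of_forall fun x => primFun_add f g x)
      map_smul' := fun c g => by
        rw [RingHom.id_apply, ← MemLp.toLp_const_smul]
        exact MemLp.toLp_congr _ _ (Eventually.of_forall fun x => primFun_smul c g x) }
    1 fun g => by
      refine (Lp.norm_le_of_ae_bound (C := ‖g‖) (norm_nonneg g) ?_).trans ?_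
      · filter_upwards [(memLp_primFun g).coeFn_toLp] with x hx
        exact (congrArg norm hx).trans_le (abs_primFun_le g x)
      · simp [measureUnivNNReal]

lemma coeFn_prim (g : LpSpace p) : prim g =ᵐ[spaceMeasure] primFun g :=
  (memLp_primFun g).coeFn_toLp

/-- Integration by parts. -/
lemma integral_prim_mul (g : LpSpace p) {φ φ' : ℝ → ℝ} (hφ : ∀ x, HasDerivAt φ (φ' x) x)
    (hφ' : Continuous φ') :
    ∫ x in Ioo (0 : ℝ) 1, prim g x * φ' x
      = φ 1 * mean g - ∫ x in Ioo (0 : ℝ) 1, g x * φ x := by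
  have hc : Continuous φ := continuous_iff_continuousAt.2 fun x => (hφ x).continuousAt
  have h := integral_deriv_mul_primitive zero_le_one hφ hφ'
    (integrable_indicator g).intervalIntegrable
  have i1 : IntervalIntegrable (fun x => φ' x * primFun g x) volume 0 1 :=
    (hφ'.mul (continuous_primFun g)).intervalIntegrable _ _
  have i2 : IntervalIntegrable (fun x => φ x * (Ioo (0 : ℝ) 1).indicator g x) volume 0 1 :=
    (integrable_indicator g).intervalIntegrable.continuousOn_mul hc.continuousOn
  have h' : (∫ x in (0 : ℝ)..1, φ' x * primFun g x)
      + ∫ x in (0 : ℝ)..1, φ x * (Ioo (0 : ℝ) 1).indicator g x = φ 1 * mean g := by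
    rw [← intervalIntegral.integral_add i1 i2, ← primFun_one]
    exact h
  have e1 : ∫ x in Ioo (0 : ℝ) 1, prim g x * φ' x = ∫ x in (0 : ℝ)..1, φ' x * primFun g x := by
    rw [← integral_Ioo_eq_interval]
    refine integral_congr_ae ?_
    filter_upwards [coeFn_prim g] with x hx
    rw [hx, mul_comm]
  have e2 : ∫ x in Ioo (0 : ℝ) 1, g x * φ x
      = ∫ x in (0 : ℝ)..1, φ x * (Ioo (0 : ℝ) 1).indicator g x := by
    rw [← integral_Ioo_eq_interval]
    refine setIntegral_congr_fun measurableSet_Ioo fun x hx => ?_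
    simp only [indicator_of_mem hx, mul_comm]
  rw [e1, e2, ← h']
  ring

lemma integral_one_mul {φ φ' : ℝ → ℝ} (hφ : ∀ x, HasDerivAt φ (φ' x) x) (hφ' : Continuous φ') :
    ∫ x in Ioo (0 : ℝ) 1, (one : LpSpace p) x * φ' x = φ 1 - φ 0 := by
  rw [← intervalIntegral.integral_eq_sub_of_hasDerivAt (fun x _ => hφ x)
    (hφ'.intervalIntegrable _ _), ← integral_Ioo_eq_interval]
  refine integral_congr_ae ?_
  filter_upwards [coeFn_one (μ := spaceMeasure) (p := p)] with x hx
  rw [hx, one_mul]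

lemma IsSpaceTest.hasDerivAt {φ : ℝ → ℝ} (h : IsSpaceTest φ) (x : ℝ) :
    HasDerivAt φ (deriv φ x) x :=
  ((h.1.differentiable one_ne_zero) x).hasDerivAt

lemma IsSpaceTest.eq_zero {φ : ℝ → ℝ} (h : IsSpaceTest φ) {x : ℝ} (hx : x ∉ Ioo (0 : ℝ) 1) :
    φ x = 0 :=
  image_eq_zero_of_notMem_tsupport fun h' => hx (h.2.2 h')

lemma IsSpaceTest.continuous_deriv {φ : ℝ → ℝ} (h : IsSpaceTest φ) : Continuous (deriv φ) :=
  h.1.continuous_deriv le_rfl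

lemma IsSpaceTest.bddMeasurable {φ : ℝ → ℝ} (h : IsSpaceTest φ) : BddMeasurable φ :=
  let ⟨_, hC⟩ := h.2.1.exists_bound_of_continuous h.1.continuous
  BddMeasurable.of_continuous h.1.continuous hC

lemma IsSpaceTest.bddMeasurable_deriv {φ : ℝ → ℝ} (h : IsSpaceTest φ) :
    BddMeasurable (deriv φ) :=
  let ⟨_, hC⟩ := h.2.1.deriv.exists_bound_of_continuous h.continuous_deriv
  BddMeasurable.of_continuous h.continuous_deriv hC

/-- Weak derivatives are primitives up to constants. -/
lemma isWeakDeriv_iff_prim {f g : LpSpace p} :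
    IsWeakDeriv f g ↔ ∃ c : ℝ, f = c • one + prim g := by
  constructor
  · intro H
    have hint : Integrable (fun x => f x - primFun g x) spaceMeasure :=
      (integrable_of_lp f).sub ((memLp_primFun g).integrable hp1.out)
    obtain ⟨c, hc⟩ := ae_eq_const_of_integral_mul_deriv_eq_zero (k := fun x => f x - primFun g x)
      isOpen_Ioo ordConnected_Ioo (IntegrableOn.locallyIntegrableOn hint) fun φ h1 h2 h3 => by
        have hφ : IsSpaceTest φ := ⟨h1.of_le (by exact_mod_cast le_top), h2, h3⟩
        have e0 : ∫ x, (f x - primFun g x) * deriv φ x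
            = ∫ x in Ioo (0 : ℝ) 1, (f x - primFun g x) * deriv φ x := by
          refine (setIntegral_eq_integral_of_forall_compl_eq_zero fun x hx => ?_).symm
          rw [image_eq_zero_of_notMem_tsupport (f := deriv φ)
            fun h' => hx (h3 (tsupport_deriv_subset h')), mul_zero]
        have e1 : ∫ x in Ioo (0 : ℝ) 1, primFun g x * deriv φ x
            = - ∫ x in Ioo (0 : ℝ) 1, g x * φ x := by
          have := integral_prim_mul g hφ.hasDerivAt hφ.continuous_deriv
          rw [hφ.eq_zero (by simp : (1 : ℝ) ∉ Ioo (0 : ℝ) 1), zero_mul, zero_sub] at this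
          rw [← this]
          refine integral_congr_ae ?_
          filter_upwards [coeFn_prim g] with x hx
          rw [hx]
        have i1 : Integrable (fun x => f x * deriv φ x) spaceMeasure :=
          integrable_pairing (𝕜 := ℝ) hφ.bddMeasurable_deriv f
        have i2 : Integrable (fun x => primFun g x * deriv φ x) spaceMeasure := by
          refine (integrable_pairing (𝕜 := ℝ) hφ.bddMeasurable_deriv (prim g)).congr ?_
          filter_upwards [coeFn_prim g] with x hx
          rw [hx]; rfl
        rw [e0]
        simp_rw [sub_mul]
        rw [integral_sub i1 i2, e1, H φ hφ, sub_self]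
    refine ⟨c, Lp.ext ?_⟩
    filter_upwards [(ae_restrict_iff' measurableSet_Ioo).2 hc, Lp.coeFn_add (c • one) (prim g),
      Lp.coeFn_smul c (one : LpSpace p), coeFn_one (μ := spaceMeasure) (p := p), coeFn_prim g]
      with x h1 h2 h3 h4 h5
    rw [h2, Pi.add_apply, h3, Pi.smul_apply, h4, h5, smul_eq_mul]
    linarith
  · rintro ⟨c, rfl⟩ φ hφ
    have h1 := pairing_real_apply (deriv φ) hφ.bddMeasurable_deriv (c • one + prim g)
    rw [← h1, map_add, map_smul, pairing_real_apply, pairing_real_apply,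
      integral_one_mul hφ.hasDerivAt hφ.continuous_deriv,
      integral_prim_mul g hφ.hasDerivAt hφ.continuous_deriv,
      hφ.eq_zero (by simp : (1 : ℝ) ∉ Ioo (0 : ℝ) 1), hφ.eq_zero (by simp : (0 : ℝ) ∉ Ioo (0 : ℝ) 1)]
    simp

/-- The elements of `W^{1,p}_0(0, 1)` are the primitives of functions of mean zero. -/
lemma mem_W0_iff {f g : LpSpace p} : (f, g) ∈ W0 p ↔ mean g = 0 ∧ f = prim g := by
  constructor
  · rintro ⟨h1, F, hF, h0, hF1, hfF⟩
    obtain ⟨c, hc⟩ := isWeakDeriv_iff_prim.1 h1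
    change f = c • one + prim g at hc
    have hae : (fun x => c + primFun g x) =ᵐ[volume.restrict (Ioo (0 : ℝ) 1)] F := by
      refine EventuallyEq.trans ?_ hfF
      change _ =ᵐ[spaceMeasure] (f : ℝ → ℝ)
      rw [hc]
      filter_upwards [Lp.coeFn_add (c • one) (prim g),
        Lp.coeFn_smul c (one : LpSpace p), coeFn_one (μ := spaceMeasure) (p := p), coeFn_prim g]
        with x h2 h3 h4 h5
      rw [h2, Pi.add_apply, h3, Pi.smul_apply, h4, h5, smul_eq_mul, mul_one]
    rw [restrict_Ioo_eq_restrict_Icc] at hae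
    have heq := Measure.eqOn_Icc_of_ae_eq volume zero_ne_one hae
      (continuous_const.add (continuous_primFun g)).continuousOn hF
    have e0 := heq (left_mem_Icc.2 zero_le_one)
    have e1 := heq (right_mem_Icc.2 zero_le_one)
    simp only [primFun_zero, primFun_one, h0, hF1] at e0 e1
    have hc0 : c = 0 := by linarith
    exact ⟨by linarith, by rw [hc, hc0, zero_smul, zero_add]⟩
  · rintro ⟨h1, rfl⟩
    exact ⟨isWeakDeriv_iff_prim.2 ⟨0, by rw [zero_smul, zero_add]⟩, primFun g,
      (continuous_primFun g).continuousOn, primFun_zero g, (primFun_one g).trans h1, coeFn_prim g⟩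

lemma hasDerivAt_sin_mul (b x : ℝ) :
    HasDerivAt (fun x => Real.sin (b * x)) (b * Real.cos (b * x)) x := by
  have := ((hasDerivAt_id x).const_mul b).sin
  simpa [mul_comm] using this

lemma hasDerivAt_cos_mul (b x : ℝ) :
    HasDerivAt (fun x => Real.cos (b * x)) (-(b * Real.sin (b * x))) x := by
  have := ((hasDerivAt_id x).const_mul b).cos
  simpa [mul_comm] using this

lemma cosCoef_prim (n : ℤ) (g : LpSpace p) : Real.pi * n * cosCoef n (prim g) = -sinCoef n g := by
  have h := integral_prim_mul g (hasDerivAt_sin_mul (Real.pi * n)) (by fun_prop)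
  rw [mul_one, mul_comm Real.pi, Real.sin_int_mul_pi, zero_mul, zero_sub] at h
  rw [cosCoef, sinCoef, pairing_real_apply, pairing_real_apply, ← integral_const_mul,
    mul_comm Real.pi, ← h]
  refine integral_congr_ae (Eventually.of_forall fun x => ?_)
  simp only
  ring

lemma sinCoef_prim (n : ℤ) {g : LpSpace p} (hg : mean g = 0) :
    Real.pi * n * sinCoef n (prim g) = cosCoef n g := by
  have h := integral_prim_mul g (hasDerivAt_cos_mul (Real.pi * n)) (by fun_prop)
  rw [hg, mul_zero, zero_sub, eq_neg_iff_add_eq_zero, add_comm, ← eq_neg_iff_add_eq_zero,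
    ← integral_neg] at h
  rw [cosCoef, sinCoef, pairing_real_apply, pairing_real_apply, ← integral_const_mul, h]
  refine integral_congr_ae (Eventually.of_forall fun x => ?_)
  simp only
  ring

lemma cosCoef_one {n : ℤ} (hn : n ≠ 0) : cosCoef n (one : LpSpace p) = 0 := by
  have hb : Real.pi * n ≠ 0 := mul_ne_zero Real.pi_ne_zero (Int.cast_ne_zero.2 hn)
  have h := integral_one_mul (p := p) (hasDerivAt_sin_mul (Real.pi * n)) (by fun_prop)
  rw [mul_one, mul_zero, Real.sin_zero, mul_comm Real.pi, Real.sin_int_mul_pi, sub_zero,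
    mul_comm] at h
  refine (mul_eq_zero.1 (?_ : Real.pi * n * cosCoef n (one : LpSpace p) = 0)).resolve_left hb
  rw [cosCoef, pairing_real_apply, ← integral_const_mul, ← h]
  refine integral_congr_ae (Eventually.of_forall fun x => ?_)
  simp only
  ring

lemma cosCoef_zero (g : LpSpace p) : cosCoef 0 g = mean g := by
  rw [cosCoef, pairing_real_apply, mean_apply]
  simp

lemma sinCoef_zero (g : LpSpace p) : sinCoef 0 g = 0 := by
  rw [sinCoef, pairing_real_apply]
  simp

lemma eq_zero_of_cosCoef {g : LpSpace p} (h : ∀ n, cosCoef n g = 0) : g = 0 := by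
  have h0 : ext g 0 = 0 := eq_zero_of_fcoef _ fun n => by rw [fcoef_ext, h n, map_zero]; simp
  have := norm_le_norm_ext_left g 0
  rw [h0, norm_zero] at this
  exact norm_le_zero_iff.1 this

lemma eq_zero_of_sinCoef {g : LpSpace p} (h : ∀ n, n ≠ 0 → sinCoef n g = 0) : g = 0 := by
  have h0 : ext 0 g = 0 := eq_zero_of_fcoef _ fun n => by
    have : sinCoef n g = 0 := by
      rcases eq_or_ne n 0 with rfl | hn
      · exact sinCoef_zero g
      · exact h n hn
    rw [fcoef_ext, this, map_zero]; simp
  have := norm_le_norm_ext_right 0 g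
  rw [h0, norm_zero] at this
  exact norm_le_zero_iff.1 this

/-- The functions `sin (π n x)` suffice as test functions for weak derivatives. -/
lemma isWeakDeriv_iff_coef {f g : LpSpace p} :
    IsWeakDeriv f g ↔ ∀ n : ℤ, Real.pi * n * cosCoef n f = -sinCoef n g := by
  rw [isWeakDeriv_iff_prim]
  constructor
  · rintro ⟨c, rfl⟩ n
    rw [map_add, map_smul, mul_add, cosCoef_prim]
    rcases eq_or_ne n 0 with rfl | hn
    · simp
    · rw [cosCoef_one hn]; simp
  · intro H
    refine ⟨mean (f - prim g), ?_⟩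
    rw [← sub_eq_zero, ← sub_sub, sub_right_comm]
    refine eq_zero_of_cosCoef fun n => ?_
    rcases eq_or_ne n 0 with rfl | hn
    · rw [map_sub, map_smul, cosCoef_zero, cosCoef_zero, mean_one, smul_eq_mul, mul_one, sub_self]
    · rw [map_sub, map_smul, cosCoef_one hn, smul_zero, sub_zero]
      have hb : Real.pi * n ≠ 0 := mul_ne_zero Real.pi_ne_zero (Int.cast_ne_zero.2 hn)
      refine (mul_eq_zero.1 (?_ : Real.pi * n * cosCoef n (f - prim g) = 0)).resolve_left hb
      rw [map_sub, mul_sub, H n, cosCoef_prim, sub_self]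

end Primitive

/-! ### Distributions in time -/

section Time

lemma IsTimeTest.deriv {φ : ℝ → ℝ} (h : IsTimeTest φ) : IsTimeTest (deriv φ) :=
  ⟨((contDiff_infty_iff_deriv).1 h.1).2, h.2.1.deriv,
    (tsupport_deriv_subset).trans h.2.2⟩

lemma IsTimeTest.hasDerivAt {φ : ℝ → ℝ} (h : IsTimeTest φ) (t : ℝ) :
    HasDerivAt φ (_root_.deriv φ t) t :=
  ((contDiff_infty_iff_deriv).1 h.1).1.differentiableAt.hasDerivAt

lemma IsTimeTest.exists_eq_zero {φ : ℝ → ℝ} (h : IsTimeTest φ) :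
    ∃ T, 0 ≤ T ∧ ∀ t, t ∉ Ioo 0 T → φ t = 0 := by
  obtain ⟨R, hR⟩ := h.2.1.isBounded.bddAbove
  refine ⟨max (R + 1) 0, le_max_right _ _, fun t ht => ?_⟩
  refine image_eq_zero_of_notMem_tsupport fun h' => ht ⟨h.2.2 h', ?_⟩
  exact lt_of_lt_of_le (by linarith [hR h']) (le_max_left _ _)

lemma integral_Ioi_eq_interval {φ k : ℝ → ℝ} {T : ℝ} (hT : 0 ≤ T)
    (hφ : ∀ t, t ∉ Ioo 0 T → φ t = 0) :
    ∫ t in Ioi (0 : ℝ), φ t * k t = ∫ t in (0 : ℝ)..T, φ t * k t := by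
  rw [intervalIntegral.integral_of_le hT]
  refine setIntegral_eq_of_subset_of_forall_sdiff_eq_zero measurableSet_Ioi
    (fun t ht => ht.1) fun t ht => ?_
  rw [hφ t fun h => ht.2 ⟨h.1, h.2.le⟩, zero_mul]

/-- The distributional derivative of a primitive. -/
lemma IsTimeTest.integral_deriv_mul {φ q : ℝ → ℝ} (h : IsTimeTest φ)
    (hq : ∀ t, 0 ≤ t → IntervalIntegrable q volume 0 t) (c : ℝ) :
    ∫ t in Ioi (0 : ℝ), _root_.deriv φ t * (c + ∫ s in (0 : ℝ)..t, q s)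
      = -∫ t in Ioi (0 : ℝ), φ t * q t := by
  obtain ⟨T, hT, h0⟩ := h.exists_eq_zero
  obtain ⟨S, hS, h1⟩ := h.deriv.exists_eq_zero
  set R := max T S
  have hR : 0 ≤ R := hT.trans (le_max_left _ _)
  have h0' : ∀ t, t ∉ Ioo 0 R → φ t = 0 := fun t ht =>
    h0 t fun h => ht ⟨h.1, h.2.trans_le (le_max_left _ _)⟩
  have h1' : ∀ t, t ∉ Ioo 0 R → _root_.deriv φ t = 0 := fun t ht =>
    h1 t fun h => ht ⟨h.1, h.2.trans_le (le_max_right _ _)⟩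
  have hc : Continuous (_root_.deriv φ) := h.deriv.1.continuous
  rw [integral_Ioi_eq_interval hR h0', integral_Ioi_eq_interval hR h1']
  have hprim : ContinuousOn (fun s => ∫ r in (0 : ℝ)..s, q r) (uIcc 0 R) :=
    intervalIntegral.continuousOn_primitive_interval' (hq R hR) left_mem_uIcc
  have i1 : IntervalIntegrable (fun t => _root_.deriv φ t * ∫ s in (0 : ℝ)..t, q s) volume 0 R :=
    (hc.continuousOn.mul hprim).intervalIntegrable
  have i2 : IntervalIntegrable (fun t => φ t * q t) volume 0 R :=
    (hq R hR).continuousOn_mul h.1.continuous.continuousOn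
  have i3 : IntervalIntegrable (fun t => _root_.deriv φ t * c) volume 0 R :=
    (hc.mul continuous_const).intervalIntegrable _ _
  have e1 := integral_deriv_mul_primitive hR h.hasDerivAt hc (hq R hR)
  rw [intervalIntegral.integral_add i1 i2, h0' R (by simp), zero_mul] at e1
  have e2 : ∫ t in (0 : ℝ)..R, _root_.deriv φ t * c = 0 := by
    rw [intervalIntegral.integral_mul_const, intervalIntegral.integral_eq_sub_of_hasDerivAt
      (fun t _ => h.hasDerivAt t) (hc.intervalIntegrable _ _), h0' R (by simp), h0' 0 (by simp),
      sub_zero, zero_mul]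
  simp_rw [mul_add]
  rw [intervalIntegral.integral_add i3 i1, e2]
  linarith

lemma IsTimeTest.integral_add {φ k₁ k₂ : ℝ → ℝ} (h : IsTimeTest φ)
    (h₁ : ∀ t, 0 ≤ t → IntervalIntegrable k₁ volume 0 t)
    (h₂ : ∀ t, 0 ≤ t → IntervalIntegrable k₂ volume 0 t) :
    ∫ t in Ioi (0 : ℝ), φ t * (k₁ t + k₂ t)
      = (∫ t in Ioi (0 : ℝ), φ t * k₁ t) + ∫ t in Ioi (0 : ℝ), φ t * k₂ t := by
  obtain ⟨T, hT, h0⟩ := h.exists_eq_zero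
  rw [integral_Ioi_eq_interval hT h0, integral_Ioi_eq_interval hT h0,
    integral_Ioi_eq_interval hT h0, ← intervalIntegral.integral_add
      ((h₁ T hT).continuousOn_mul h.1.continuous.continuousOn)
      ((h₂ T hT).continuousOn_mul h.1.continuous.continuousOn)]
  simp_rw [mul_add]

/-- A continuous function on `[0, ∞)` that is constant in the sense of distributions is
constant. -/
lemma forall_integral_deriv_mul_eq_zero_iff {k : ℝ → ℝ} (hk : ContinuousOn k (Ici 0))
    (hk0 : k 0 = 0) :
    (∀ φ, IsTimeTest φ → ∫ t in Ioi (0 : ℝ), deriv φ t * k t = 0) ↔ ∀ t, 0 ≤ t → k t = 0 := by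
  constructor
  · intro H
    obtain ⟨c, hc⟩ := ae_eq_const_of_integral_mul_deriv_eq_zero (k := k) isOpen_Ioi ordConnected_Ioi
      ((hk.mono Ioi_subset_Ici_self).locallyIntegrableOn measurableSet_Ioi) fun φ h1 h2 h3 => by
        rw [← H φ ⟨h1, h2, h3⟩]
        simp_rw [mul_comm]
        refine (setIntegral_eq_integral_of_forall_compl_eq_zero fun t ht => ?_).symm
        rw [image_eq_zero_of_notMem_tsupport (f := deriv φ)
          fun h' => ht (h3 (tsupport_deriv_subset h')), mul_zero]
    have key : ∀ T, 0 < T → ∀ t ∈ Icc 0 T, k t = c := by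
      intro T hT t ht
      have hae : k =ᵐ[volume.restrict (Icc (0 : ℝ) T)] fun _ => c := by
        rw [← restrict_Ioo_eq_restrict_Icc]
        refine (ae_restrict_iff' measurableSet_Ioo).2 ?_
        filter_upwards [hc] with x hx h using hx h.1
      exact Measure.eqOn_Icc_of_ae_eq volume hT.ne hae
        (hk.mono Icc_subset_Ici_self) continuousOn_const ht
    have hc0 : c = 0 := by rw [← hk0, key 1 one_pos 0 ⟨le_rfl, zero_le_one⟩]
    intro t ht
    rw [key (t + 1) (by linarith) t ⟨ht, by linarith⟩, hc0]
  · intro H φ _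
    refine setIntegral_eq_zero_of_forall_eq_zero fun t ht => ?_
    rw [H t (le_of_lt ht), mul_zero]

/-- The equation `m'' + κ = 0` in the sense of distributions on `(0, ∞)`, integrated once. -/
lemma distribution_iff {m l κ : ℝ → ℝ} (hl : ContinuousOn l (Ici 0))
    (hm : ∀ t, 0 ≤ t → m t = m 0 + ∫ s in (0 : ℝ)..t, l s)
    (hκ : ∀ t, 0 ≤ t → IntervalIntegrable κ volume 0 t) :
    (∀ ψ, IsTimeTest ψ → (∫ t in Ioi (0 : ℝ), deriv (deriv ψ) t * m t)
      + ∫ t in Ioi (0 : ℝ), ψ t * κ t = 0) ↔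
    ∀ t, 0 ≤ t → l t - l 0 + ∫ s in (0 : ℝ)..t, κ s = 0 := by
  have hli : ∀ t, 0 ≤ t → IntervalIntegrable l volume 0 t := fun t ht =>
    (hl.mono (by rw [uIcc_of_le ht]; exact Icc_subset_Ici_self)).intervalIntegrable
  have hK : ContinuousOn (fun t => ∫ s in (0 : ℝ)..t, κ s) (Ici 0) := by
    intro t ht
    have ht : (0 : ℝ) ≤ t := ht
    have h := intervalIntegral.continuousOn_primitive_interval' (hκ (t + 1) (by linarith))
      left_mem_uIcc
    rw [uIcc_of_le (by linarith : (0 : ℝ) ≤ t + 1)] at h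
    refine (h t ⟨ht, by linarith⟩).mono_of_mem_nhdsWithin ?_
    rw [← Ici_inter_Iic]
    exact inter_mem_nhdsWithin _ (Iic_mem_nhds (by linarith))
  have hKc : ContinuousOn (fun t => -l 0 + ∫ s in (0 : ℝ)..t, κ s) (Ici 0) :=
    continuousOn_const.add hK
  have hk : ContinuousOn (fun t => l t + (-l 0 + ∫ s in (0 : ℝ)..t, κ s)) (Ici 0) := hl.add hKc
  have e : ∀ ψ, IsTimeTest ψ → (∫ t in Ioi (0 : ℝ), deriv (deriv ψ) t * m t)
      + ∫ t in Ioi (0 : ℝ), ψ t * κ t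
      = -∫ t in Ioi (0 : ℝ), deriv ψ t * (l t + (-l 0 + ∫ s in (0 : ℝ)..t, κ s)) := by
    intro ψ hψ
    have h1 : ∫ t in Ioi (0 : ℝ), deriv (deriv ψ) t * m t
        = ∫ t in Ioi (0 : ℝ), deriv (deriv ψ) t * (m 0 + ∫ s in (0 : ℝ)..t, l s) :=
      setIntegral_congr_fun measurableSet_Ioi fun t ht => by
        rw [hm t (le_of_lt ht)]
    rw [h1, hψ.deriv.integral_deriv_mul hli, hψ.deriv.integral_add hli fun t ht =>
      (hKc.mono (by rw [uIcc_of_le ht]; exact Icc_subset_Ici_self)).intervalIntegrable,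
      hψ.integral_deriv_mul hκ]
    ring
  have e2 := forall_integral_deriv_mul_eq_zero_iff hk (by simp)
  have e3 : (∀ t, 0 ≤ t → l t - l 0 + ∫ s in (0 : ℝ)..t, κ s = 0) ↔
      ∀ t, 0 ≤ t → l t + (-l 0 + ∫ s in (0 : ℝ)..t, κ s) = 0 := by
    simp_rw [← add_assoc, ← sub_eq_add_neg]
  rw [e3, ← e2]
  exact forall₂_congr fun ψ hψ => by rw [e ψ hψ, neg_eq_zero]

end Time

/-! ### Weak solutions and the evolution on the circle -/

section C1

variable {E : Type*} [NormedAddCommGroup E] [NormedSpace ℝ E] [CompleteSpace E]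

/-- The fundamental theorem of calculus on `[0, ∞)`, with one-sided derivatives at `0`. -/
lemma eq_add_integral_derivWithin {f : ℝ → E} (hf : ContDiffOn ℝ 1 f (Ici 0)) {t : ℝ}
    (ht : 0 ≤ t) : f t = f 0 + ∫ s in (0 : ℝ)..t, derivWithin f (Ici 0) s := by
  have hc : ContinuousOn (derivWithin f (Ici 0)) (Ici 0) :=
    hf.continuousOn_derivWithin (uniqueDiffOn_Ici 0) le_rfl
  rw [intervalIntegral.integral_eq_sub_of_hasDeriv_right_of_le ht
    (hf.continuousOn.mono Icc_subset_Ici_self) (fun x hx => ?_)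
    (hc.mono (by rw [uIcc_of_le ht]; exact Icc_subset_Ici_self)).intervalIntegrable]
  · abel
  · exact ((hf.differentiableOn one_ne_zero x hx.1.le).hasDerivWithinAt).mono
      fun y hy => hx.1.le.trans (le_of_lt hy)

lemma contDiffOn_and_derivWithin {f h : ℝ → E} (hh : ContinuousOn h (Ici 0))
    (hf : ∀ t, 0 ≤ t → f t = f 0 + ∫ s in (0 : ℝ)..t, h s) :
    ContDiffOn ℝ 1 f (Ici 0) ∧ ∀ t, 0 ≤ t → derivWithin f (Ici 0) t = h t := by
  have hc := continuous_comp_max hh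
  set F : ℝ → E := fun t => f 0 + ∫ s in (0 : ℝ)..t, h (max s 0) with hF
  have hder : ∀ t, HasDerivAt F (h (max t 0)) t := fun t =>
    (intervalIntegral.integral_hasDerivAt_right (hc.intervalIntegrable _ _)
      (hc.stronglyMeasurableAtFilter _ _) hc.continuousAt).const_add _
  have hfF : EqOn f F (Ici 0) := fun t ht => by
    rw [hf t ht, hF]
    congr 1
    refine intervalIntegral.integral_congr fun s hs => ?_
    rw [uIcc_of_le ht] at hs
    simp only [max_eq_left hs.1]
  constructor
  · refine ContDiffOn.congr (ContDiff.contDiffOn ?_) hfF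
    refine contDiff_one_iff_deriv.2 ⟨fun t => (hder t).differentiableAt, ?_⟩
    rwa [show deriv F = fun t => h (max t 0) from funext fun t => (hder t).deriv]
  · intro t ht
    rw [derivWithin_congr hfF (hfF ht),
      (hder t).hasDerivWithinAt.derivWithin (uniqueDiffOn_Ici 0 t ht), max_eq_left ht]

end C1

section Weak

variable {p : ℝ≥0∞} [hp1 : Fact (1 ≤ p)] {a : Lp ℝ ∞ spaceTimeMeasure} {b : ℝ → ℝ → ℝ} {M : ℝ}

lemma mean_dx (w : W0 p) : mean (dx w) = 0 := (mem_W0_iff.1 w.2).1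

lemma fn_eq_prim (w : W0 p) : fn w = prim (dx w) := (mem_W0_iff.1 w.2).2

lemma W0_ext {v w : W0 p} (h : dx v = dx w) : v = w :=
  Subtype.ext (Prod.ext (by
    change fn v = fn w
    rw [fn_eq_prim, fn_eq_prim, h]) h)

/-- The weak formulation, integrated once in time and tested against `sin (π n x)`. -/
lemma weak_eq_iff (hp : p ≠ ∞) (hb : IsIntervalDamping b M)
    (hab : ∀ᵐ t ∂volume.restrict (Ioi (0 : ℝ)), ∀ᵐ x ∂spaceMeasure, a (t, x) = b t x)
    {u : ℝ → W0 p} (hg : ContinuousOn (fun t => dx (u t)) (Ici 0))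
    (hh : ContinuousOn (timeDeriv u) (Ici 0))
    (hu : ∀ t, 0 ≤ t → fn (u t) = fn (u 0) + ∫ s in (0 : ℝ)..t, timeDeriv u s) :
    (∀ v : ℝ → ℝ, IsSpaceTest v → ∀ ψ : ℝ → ℝ, IsTimeTest ψ →
      (∫ t in Ioi (0 : ℝ), deriv (deriv ψ) t * ∫ x in Ioo (0 : ℝ) 1, fn (u t) x * v x)
      + (∫ t in Ioi (0 : ℝ), ψ t * ∫ x in Ioo (0 : ℝ) 1, dx (u t) x * deriv v x)
      + (∫ t in Ioi (0 : ℝ), ψ t * ∫ x in Ioo (0 : ℝ) 1, a (t, x) * timeDeriv u t x * v x) = 0) ↔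
    ∀ (n : ℤ) (t : ℝ), 0 ≤ t →
      sinCoef n (timeDeriv u t) = sinCoef n (timeDeriv u 0)
        - (Real.pi * n * (∫ s in (0 : ℝ)..t, cosCoef n (dx (u s)))
          + ∫ s in (0 : ℝ)..t, sinCoef n (damp hb s (timeDeriv u s))) := by
  have hgi : ∀ t, 0 ≤ t → IntervalIntegrable (fun s => dx (u s)) volume 0 t := fun t ht =>
    (hg.mono (by rw [uIcc_of_le ht]; exact Icc_subset_Ici_self)).intervalIntegrable
  have hhi : ∀ t, 0 ≤ t → IntervalIntegrable (timeDeriv u) volume 0 t := fun t ht =>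
    (hh.mono (by rw [uIcc_of_le ht]; exact Icc_subset_Ici_self)).intervalIntegrable
  have hdi : ∀ t, 0 ≤ t → IntervalIntegrable (fun s => damp hb s (timeDeriv u s)) volume 0 t :=
    fun t ht => (isCoefficient_damp hp hb).intervalIntegrable hh le_rfl ht
  have step : ∀ v : ℝ → ℝ, IsSpaceTest v → ((∀ ψ : ℝ → ℝ, IsTimeTest ψ →
      (∫ t in Ioi (0 : ℝ), deriv (deriv ψ) t * ∫ x in Ioo (0 : ℝ) 1, fn (u t) x * v x)
      + (∫ t in Ioi (0 : ℝ), ψ t * ∫ x in Ioo (0 : ℝ) 1, dx (u t) x * deriv v x)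
      + (∫ t in Ioi (0 : ℝ), ψ t * ∫ x in Ioo (0 : ℝ) 1, a (t, x) * timeDeriv u t x * v x) = 0) ↔
      ∀ t, 0 ≤ t → ∫ x in Ioo (0 : ℝ) 1, (∫ s in (0 : ℝ)..t, dx (u s) : LpSpace p) x * deriv v x
        = -∫ x in Ioo (0 : ℝ) 1, (timeDeriv u t - timeDeriv u 0
          + ∫ s in (0 : ℝ)..t, damp hb s (timeDeriv u s) : LpSpace p) x * v x) := by
    intro v hv
    have h1 : ∀ f : LpSpace p, ∫ x in Ioo (0 : ℝ) 1, f x * v x = pairing v hv.bddMeasurable f :=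
      fun f => (pairing_real_apply _ _ f).symm
    have h2 : ∀ f : LpSpace p, ∫ x in Ioo (0 : ℝ) 1, f x * deriv v x
        = pairing (deriv v) hv.bddMeasurable_deriv f := fun f => (pairing_real_apply _ _ f).symm
    have h3 : ∀ ψ : ℝ → ℝ,
        ∫ t in Ioi (0 : ℝ), ψ t * ∫ x in Ioo (0 : ℝ) 1, a (t, x) * timeDeriv u t x * v x
        = ∫ t in Ioi (0 : ℝ), ψ t * pairing v hv.bddMeasurable (damp hb t (timeDeriv u t)) := by
      intro ψ
      refine integral_congr_ae ?_
      filter_upwards [hab] with t ht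
      rw [pairing_real_apply]
      congr 1
      refine integral_congr_ae ?_
      filter_upwards [ht, coeFn_damp hb t (timeDeriv u t)] with x a1 a2
      rw [a1, a2]
    set V : LpSpace p →L[ℝ] ℝ := pairing v hv.bddMeasurable with hV
    set W : LpSpace p →L[ℝ] ℝ := pairing (deriv v) hv.bddMeasurable_deriv with hW
    have i1 : ∀ t, 0 ≤ t → IntervalIntegrable (fun s => W (dx (u s))) volume 0 t := fun t ht =>
      ⟨W.integrable_comp (hgi t ht).1, W.integrable_comp (hgi t ht).2⟩
    have i2 : ∀ t, 0 ≤ t → IntervalIntegrable (fun s => V (damp hb s (timeDeriv u s))) volume 0 t :=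
      fun t ht => ⟨V.integrable_comp (hdi t ht).1, V.integrable_comp (hdi t ht).2⟩
    have i3 : ∀ t, 0 ≤ t → IntervalIntegrable
        (fun s => W (dx (u s)) + V (damp hb s (timeDeriv u s))) volume 0 t :=
      fun t ht => (i1 t ht).add (i2 t ht)
    have hd := distribution_iff (m := fun t => V (fn (u t))) (l := fun t => V (timeDeriv u t))
      (κ := fun t => W (dx (u t)) + V (damp hb t (timeDeriv u t)))
      (V.continuous.comp_continuousOn hh) (fun t ht => by
        rw [hu t ht, map_add, V.intervalIntegral_comp_comm (hhi t ht)]) i3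
    simp only [h1, h2, h3, map_add, map_sub]
    refine Iff.trans (forall₂_congr fun ψ hψ => ?_) (hd.trans (forall₂_congr fun t ht => ?_))
    · rw [hψ.integral_add i1 i2, add_assoc]
    · rw [intervalIntegral.integral_add (i1 t ht) (i2 t ht),
        W.intervalIntegral_comp_comm (hgi t ht), V.intervalIntegral_comp_comm (hdi t ht)]
      constructor <;> intro h <;> linarith
  have swap : (∀ v : ℝ → ℝ, IsSpaceTest v → ∀ ψ : ℝ → ℝ, IsTimeTest ψ →
      (∫ t in Ioi (0 : ℝ), deriv (deriv ψ) t * ∫ x in Ioo (0 : ℝ) 1, fn (u t) x * v x)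
      + (∫ t in Ioi (0 : ℝ), ψ t * ∫ x in Ioo (0 : ℝ) 1, dx (u t) x * deriv v x)
      + (∫ t in Ioi (0 : ℝ), ψ t * ∫ x in Ioo (0 : ℝ) 1, a (t, x) * timeDeriv u t x * v x) = 0) ↔
      ∀ t, 0 ≤ t → IsWeakDeriv (∫ s in (0 : ℝ)..t, dx (u s) : LpSpace p)
        (timeDeriv u t - timeDeriv u 0
          + ∫ s in (0 : ℝ)..t, damp hb s (timeDeriv u s) : LpSpace p) :=
    (forall₂_congr step).trans ⟨fun H t ht v hv => H v hv t ht, fun H v hv t ht => H t ht v hv⟩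
  rw [swap]
  simp only [isWeakDeriv_iff_coef]
  refine Iff.trans ⟨fun H n t ht => H t ht n, fun H t ht n => H n t ht⟩
    (forall_congr' fun n => forall₂_congr fun t ht => ?_)
  rw [map_add, map_sub, (cosCoef n).intervalIntegral_comp_comm (hgi t ht),
    (sinCoef n).intervalIntegral_comp_comm (hdi t ht)]
  constructor <;> intro h <;> linarith

/-- The conservation law `∂ₜ uₓ = ∂ₓ uₜ`, tested against `cos (π n x)`. -/
lemma cosCoef_dx_iff {u : ℝ → W0 p} {h : ℝ → LpSpace p} (hh : ContinuousOn h (Ici 0)) {t : ℝ}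
    (ht : 0 ≤ t) : fn (u t) = fn (u 0) + (∫ s in (0 : ℝ)..t, h s) ↔
    ∀ n : ℤ, cosCoef n (dx (u t))
      = cosCoef n (dx (u 0)) + Real.pi * n * ∫ s in (0 : ℝ)..t, sinCoef n (h s) := by
  have hhi : IntervalIntegrable h volume 0 t :=
    (hh.mono (by rw [uIcc_of_le ht]; exact Icc_subset_Ici_self)).intervalIntegrable
  have e : ∀ n : ℤ, cosCoef n (dx (u t)) - (cosCoef n (dx (u 0))
      + Real.pi * n * ∫ s in (0 : ℝ)..t, sinCoef n (h s))
      = Real.pi * n * sinCoef n (fn (u t) - (fn (u 0) + ∫ s in (0 : ℝ)..t, h s)) := by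
    intro n
    rw [(sinCoef n).intervalIntegral_comp_comm hhi, map_sub, map_add, ← sinCoef_prim n (mean_dx _),
      ← sinCoef_prim n (mean_dx _), ← fn_eq_prim, ← fn_eq_prim]
    ring
  constructor
  · intro H n
    rw [← sub_eq_zero, e n, H, sub_self, map_zero, mul_zero]
  · intro H
    rw [← sub_eq_zero]
    refine eq_zero_of_sinCoef fun n hn => ?_
    have hb : Real.pi * n ≠ 0 := mul_ne_zero Real.pi_ne_zero (Int.cast_ne_zero.2 hn)
    refine (mul_eq_zero.1 ?_).resolve_left hb
    rw [← e n, H n, sub_self]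

lemma continuous_dx : Continuous (dx : W0 p → LpSpace p) :=
  continuous_snd.comp continuous_subtype_val

lemma IsWeakSolution.continuousOn_dx {u₀ : W0 p} {u₁ : LpSpace p} {u : ℝ → W0 p}
    (hu : IsWeakSolution a u₀ u₁ u) : ContinuousOn (fun t => dx (u t)) (Ici 0) :=
  continuous_dx.comp_continuousOn hu.continuousOn

lemma IsWeakSolution.continuousOn_timeDeriv {u₀ : W0 p} {u₁ : LpSpace p} {u : ℝ → W0 p}
    (hu : IsWeakSolution a u₀ u₁ u) : ContinuousOn (timeDeriv u) (Ici 0) :=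
  hu.contDiffOn.continuousOn_derivWithin (uniqueDiffOn_Ici 0) le_rfl

/-- In the moving frame, a weak solution solves the evolution equation on the circle. -/
lemma IsWeakSolution.isEvolution (hp : p ≠ ∞) (hb : IsIntervalDamping b M)
    (hab : ∀ᵐ t ∂volume.restrict (Ioi (0 : ℝ)), ∀ᵐ x ∂spaceMeasure, a (t, x) = b t x)
    {u₀ : W0 p} {u₁ : LpSpace p} {u : ℝ → W0 p} (hu : IsWeakSolution a u₀ u₁ u) :
    IsEvolution (gen hb.isDamping) (ext (dx u₀) u₁) (frame M (fun t => dx (u t)) (timeDeriv u)) := by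
  have hg := hu.continuousOn_dx
  have hh := hu.continuousOn_timeDeriv
  have hfn : ∀ t, 0 ≤ t → fn (u t) = fn (u 0) + ∫ s in (0 : ℝ)..t, timeDeriv u s :=
    fun t ht => eq_add_integral_derivWithin hu.contDiffOn ht
  have h := (isEvolution_frame_iff hp hb hg hh).2 ⟨
    fun n t ht => (cosCoef_dx_iff hh ht).1 (hfn t ht) n,
    (weak_eq_iff hp hb hab hg hh hfn).1 hu.weak_eq⟩
  simpa only [hu.init, hu.init_deriv] using h

lemma ext_injective {g g' h h' : LpSpace p} (H : ext g h = ext g' h') : g = g' ∧ h = h' :=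
  ⟨evenExt.injective (by rw [evenExt_eq g h, evenExt_eq g' h', H]),
    oddExt.injective (by rw [oddExt_eq g h, oddExt_eq g' h', H])⟩

lemma translate_frame (M : ℝ) (g h : ℝ → LpSpace p) (t : ℝ) :
    Real.exp (-(M / 2 * t)) • translate t (frame M g h t) = ext (g t) (h t) := by
  rw [frame, map_smul, translate_trans_neg, smul_smul, ← Real.exp_add, neg_add_cancel,
    Real.exp_zero, one_smul]

lemma IsWeakSolution.unique (hp : p ≠ ∞) (hb : IsIntervalDamping b M)
    (hab : ∀ᵐ t ∂volume.restrict (Ioi (0 : ℝ)), ∀ᵐ x ∂spaceMeasure, a (t, x) = b t x)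
    {u₀ : W0 p} {u₁ : LpSpace p} {u w : ℝ → W0 p} (hu : IsWeakSolution a u₀ u₁ u)
    (hw : IsWeakSolution a u₀ u₁ w) : EqOn w u (Ici 0) := fun t ht => by
  have h := (hw.isEvolution hp hb hab).unique (isCoefficient_gen hp hb.isDamping)
    (hu.isEvolution hp hb hab) ht
  refine W0_ext (ext_injective (h := timeDeriv w t) (h' := timeDeriv u t) ?_).1
  have h1 := translate_frame M (fun t => dx (w t)) (timeDeriv w) t
  have h2 := translate_frame M (fun t => dx (u t)) (timeDeriv u) t
  rw [← h1, ← h2, h]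

/-- A weak solution is controlled by the semigroup on the circle. -/
lemma IsWeakSolution.norm_le (hp : p ≠ ∞) (hb : IsIntervalDamping b M)
    (hab : ∀ᵐ t ∂volume.restrict (Ioi (0 : ℝ)), ∀ᵐ x ∂spaceMeasure, a (t, x) = b t x)
    {u₀ : W0 p} {u₁ : LpSpace p} {u : ℝ → W0 p} (hu : IsWeakSolution a u₀ u₁ u) {t : ℝ}
    (ht : 0 ≤ t) : ‖timeDeriv u t‖ + ‖dx (u t)‖
      ≤ 2 * ‖semi hp hb.isDamping t (ext (dx u₀) u₁)‖ := by
  have h1 := translate_frame M (fun t => dx (u t)) (timeDeriv u) t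
  have h2 : ‖semi hp hb.isDamping t (ext (dx u₀) u₁)‖ = ‖ext (dx (u t)) (timeDeriv u t)‖ := by
    rw [semi_eq hp hb.isDamping (hu.isEvolution hp hb hab) ht, ← h1, norm_smul, norm_smul,
      LinearIsometry.norm_map]
  rw [h2]
  linarith [norm_le_norm_ext_left (dx (u t)) (timeDeriv u t),
    norm_le_norm_ext_right (dx (u t)) (timeDeriv u t)]

/-- Existence: a solution `z` of the evolution equation, seen from the fixed frame, is split into an
even part `uₓ` and an odd part `uₜ`. -/
lemma exists_isWeakSolution (hp : p ≠ ∞) (hb : IsIntervalDamping b M)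
    (hab : ∀ᵐ t ∂volume.restrict (Ioi (0 : ℝ)), ∀ᵐ x ∂spaceMeasure, a (t, x) = b t x)
    (u₀ : W0 p) (u₁ : LpSpace p) : ∃ u, IsWeakSolution a u₀ u₁ u := by
  obtain ⟨z, hz⟩ := exists_isEvolution (isCoefficient_gen hp hb.isDamping) (ext (dx u₀) u₁)
  choose g h hgh using fun t => exists_ext_eq (Real.exp (-(M / 2 * t)) • translate t (z t))
  have hwc : ContinuousOn (fun t => ext (g t) (h t)) (Ici 0) := by
    simp only [hgh]
    exact (by fun_prop : Continuous fun t : ℝ => Real.exp (-(M / 2 * t))).continuousOn.smul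
      (continuousOn_translate hp hz.cont continuous_id)
  have hg : ContinuousOn g (Ici 0) := by
    rw [evenExt.isometry.isUniformInducing.isInducing.continuousOn_iff]
    have hc : Continuous fun w : CircLp p => (2 : ℝ)⁻¹ • (w + reflect w) :=
      (continuous_id.add reflect.continuous).const_smul (2 : ℝ)⁻¹
    exact (hc.comp_continuousOn hwc).congr fun t _ => evenExt_eq (g t) (h t)
  have hh : ContinuousOn h (Ici 0) := by
    rw [oddExt.isometry.isUniformInducing.isInducing.continuousOn_iff]
    have hc : Continuous fun w : CircLp p => (2 : ℝ)⁻¹ • (w - reflect w) :=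
      (continuous_id.sub reflect.continuous).const_smul (2 : ℝ)⁻¹
    exact (hc.comp_continuousOn hwc).congr fun t _ => oddExt_eq (g t) (h t)
  have hfr : frame M g h = z := funext fun t => by
    rw [frame, hgh, map_smul, translate_neg_trans, smul_smul, ← Real.exp_add, add_neg_cancel,
      Real.exp_zero, one_smul]
  have hz0 : z 0 = ext (dx u₀) u₁ := by
    rw [hz.eq 0 le_rfl, intervalIntegral.integral_same, add_zero]
  have hgh0 : ext (g 0) (h 0) = ext (dx u₀) u₁ := by rw [← frame_zero M, hfr, hz0]
  obtain ⟨hg0, hh0⟩ := ext_injective hgh0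
  have hF : IsFourierSolution hb g h :=
    (isEvolution_frame_iff hp hb hg hh).1 (by rw [hfr, hgh0]; exact hz)
  -- The mean value is the cosine coefficient with `n = 0`, so it is conserved.
  have hmean : ∀ t, 0 ≤ t → mean (g t) = 0 := fun t ht => by
    have := hF.cos_eq 0 t ht
    rwa [Int.cast_zero, mul_zero, zero_mul, add_zero, cosCoef_zero, cosCoef_zero, hg0,
      mean_dx] at this
  -- `mean (g t) = 0` is known for `0 ≤ t` only, hence the cut-off of negative times.
  let u : ℝ → W0 p := fun t => ⟨(prim (g (max t 0)), g (max t 0)),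
    mem_W0_iff.2 ⟨hmean _ (le_max_right _ _), rfl⟩⟩
  have hdx : ∀ t, 0 ≤ t → dx (u t) = g t := fun t ht => congrArg g (max_eq_left ht)
  have hgc : Continuous fun t => g (max t 0) := continuous_comp_max hg
  have huc : Continuous u :=
    Continuous.subtype_mk ((prim.continuous.comp hgc).prodMk hgc) _
  have hfn : ∀ t, 0 ≤ t → fn (u t) = fn (u 0) + ∫ s in (0 : ℝ)..t, h s := fun t ht =>
    (cosCoef_dx_iff hh ht).2 fun n => by
      rw [hdx t ht, hdx 0 le_rfl]
      exact hF.cos_eq n t ht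
  obtain ⟨hC1, hder⟩ := contDiffOn_and_derivWithin hh hfn
  have htd : EqOn (timeDeriv u) h (Ici 0) := fun t ht => hder t ht
  have hcong : ∀ t, 0 ≤ t → EqOn (timeDeriv u) h (uIcc 0 t) := fun t ht =>
    htd.mono (by rw [uIcc_of_le ht]; exact Icc_subset_Ici_self)
  refine ⟨u, huc.continuousOn, hC1, W0_ext ((hdx 0 le_rfl).trans hg0),
    (htd (mem_Ici.2 le_rfl)).trans hh0, ?_⟩
  refine (weak_eq_iff hp hb hab (continuous_dx.comp huc).continuousOn (hh.congr htd)
    fun t ht => ?_).2 fun n t ht => ?_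
  · rw [hfn t ht, intervalIntegral.integral_congr (hcong t ht)]
  · rw [htd ht, htd (mem_Ici.2 le_rfl), hF.sin_eq n t ht]
    have e1 : ∫ s in (0 : ℝ)..t, cosCoef n (dx (u s)) = ∫ s in (0 : ℝ)..t, cosCoef n (g s) :=
      intervalIntegral.integral_congr fun s hs => by
        rw [uIcc_of_le ht] at hs
        simp only [hdx s hs.1]
    have e2 : ∫ s in (0 : ℝ)..t, sinCoef n (damp hb s (timeDeriv u s))
        = ∫ s in (0 : ℝ)..t, sinCoef n (damp hb s (h s)) :=
      intervalIntegral.integral_congr fun s hs => by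
        simp only [hcong t ht hs]
    rw [e1, e2]

end Weak

/-! ### Pointwise representatives of the damping coefficient -/

section Representative

/-- A bounded damping coefficient that is given almost everywhere has a representative that obeys
its bounds everywhere. -/
lemma exists_isIntervalDamping {M ε₀ lam : ℝ} (hε₀ : 0 < ε₀) (hlam : 0 < lam)
    (a : Lp ℝ ∞ spaceTimeMeasure) (ha : ‖a‖ = M) (hnonneg : ∀ᵐ z ∂spaceTimeMeasure, 0 ≤ a z)
    {x₀ : ℝ} (hsub : Ioo (x₀ - ε₀) (x₀ + ε₀) ⊆ Ioo 0 1)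
    (hlow : ∀ᵐ z ∂spaceTimeMeasure, z.2 ∈ Ioo (x₀ - ε₀) (x₀ + ε₀) → lam ≤ a z) :
    ∃ b : ℝ → ℝ → ℝ, IsIntervalDamping b M ∧
      (∀ t, ∀ x ∈ Ioo (x₀ - ε₀) (x₀ + ε₀), lam ≤ b t x) ∧
      ∀ᵐ t ∂volume.restrict (Ioi (0 : ℝ)), ∀ᵐ x ∂spaceMeasure, a (t, x) = b t x := by
  set I := Ioo (x₀ - ε₀) (x₀ + ε₀) with hI
  have hle : ∀ᵐ z ∂spaceTimeMeasure, a z ≤ M := by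
    filter_upwards [enorm_ae_le_eLpNormEssSup a spaceTimeMeasure] with z hz
    rw [← eLpNorm_exponent_top, ← Lp.enorm_def, enorm_le_iff_norm_le, ha] at hz
    exact (le_abs_self _).trans hz
  -- The region where `lam ≤ a` has positive measure.
  have hlM : lam ≤ M := by
    by_contra hcon
    have h1 : ∀ᵐ z ∂spaceTimeMeasure, z ∉ Ioi (0 : ℝ) ×ˢ I := by
      filter_upwards [hle, hlow] with z h1 h2 h3
      exact hcon ((h2 h3.2).trans h1)
    have h2 := measure_eq_zero_iff_ae_notMem.2 h1
    rw [Measure.restrict_apply (measurableSet_Ioi.prod measurableSet_Ioo), Set.inter_eq_left.2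
      (prod_mono_right hsub), Measure.volume_eq_prod, Measure.prod_prod, Real.volume_Ioi,
      Real.volume_Ioo, mul_eq_zero] at h2
    rcases h2 with h2 | h2
    · exact ENNReal.top_ne_zero h2
    · rw [ENNReal.ofReal_eq_zero] at h2; linarith
  refine ⟨fun t x => max (I.indicator (fun _ => lam) x) (min (a (t, x)) M),
    ⟨?_, fun t x => ?_, fun t x => ?_⟩, fun t x hx => ?_, ?_⟩
  · exact ((measurable_const.indicator measurableSet_Ioo).comp measurable_snd).max
      ((Lp.stronglyMeasurable a).measurable.min measurable_const)
  · exact le_max_of_le_left (indicator_nonneg (fun _ _ => hlam.le) x)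
  · refine max_le ?_ (min_le_right _ _)
    by_cases hx : x ∈ I
    · rwa [indicator_of_mem hx]
    · rw [indicator_of_notMem hx]; linarith
  · exact le_max_of_le_left (by rw [indicator_of_mem hx])
  · have h : ∀ᵐ z ∂spaceTimeMeasure,
        a z = max (I.indicator (fun _ => lam) z.2) (min (a z) M) := by
      filter_upwards [hnonneg, hle, hlow] with z h1 h2 h3
      rw [min_eq_left h2, max_eq_right]
      by_cases hx : z.2 ∈ I
      · rw [indicator_of_mem hx]; exact h3 hx
      · rwa [indicator_of_notMem hx]
    have hm : spaceTimeMeasure = (volume.restrict (Ioi (0 : ℝ))).prod spaceMeasure := by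
      rw [Measure.prod_restrict, ← Measure.volume_eq_prod]
    generalize (a : ℝ × ℝ → ℝ) = f at h ⊢
    rw [hm] at h
    exact Measure.ae_ae_of_ae_prod h

end Representative

end DampedWave

end

theorem theorem1 (p : ℝ≥0∞) [Fact (1 ≤ p)] (hp : 1 < p) (hp' : p < ∞)
    (M ε₀ lam : ℝ) (hε₀ : 0 < ε₀) (hlam : 0 < lam) :
    ∃ C γ : ℝ, 0 < C ∧ 0 < γ ∧
      ∀ a : Lp ℝ ∞ DampedWave.spaceTimeMeasure, ‖a‖ = M →
      (∀ᵐ z ∂DampedWave.spaceTimeMeasure, 0 ≤ a z) →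
      ∀ x₀ ∈ Ioo (0 : ℝ) 1, Ioo (x₀ - ε₀) (x₀ + ε₀) ⊆ Ioo 0 1 →
      (∀ᵐ z ∂DampedWave.spaceTimeMeasure, z.2 ∈ Ioo (x₀ - ε₀) (x₀ + ε₀) → lam ≤ a z) →
      ∀ (u₀ : DampedWave.W0 p) (u₁ : DampedWave.LpSpace p),
        ∃ u : ℝ → DampedWave.W0 p,
          DampedWave.IsWeakSolution a u₀ u₁ u ∧
          (∀ w : ℝ → DampedWave.W0 p,
            DampedWave.IsWeakSolution a u₀ u₁ w → EqOn w u (Ici 0)) ∧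
          ∀ t : ℝ, 0 ≤ t →
            ‖DampedWave.timeDeriv u t‖ + ‖DampedWave.dx (u t)‖
              ≤ C * Real.exp (-γ * t) * (‖u₁‖ + ‖DampedWave.dx u₀‖) := by
  obtain ⟨C, γ, hC, hγ, H⟩ := DampedWave.exists_decay M (lt_min hε₀ one_pos) (min_le_right ε₀ 1) hlam
  refine ⟨2 * C, γ, by positivity, hγ, fun a ha hnonneg x₀ hx₀ hsub hlow u₀ u₁ => ?_⟩
  obtain ⟨b, hb, hblow, hab⟩ :=
    DampedWave.exists_isIntervalDamping hε₀ hlam a ha hnonneg hsub hlow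
  obtain ⟨u, hu⟩ := DampedWave.exists_isWeakSolution hp'.ne hb hab u₀ u₁
  refine ⟨u, hu, fun w hw => hu.unique hp'.ne hb hab hw, fun t ht => ?_⟩
  have hnorm : ‖(x₀ : DampedWave.Circ)‖ = x₀ := by
    rw [DampedWave.norm_coe_of_mem ⟨by linarith [hx₀.1], hx₀.2.le⟩, abs_of_pos hx₀.1]
  have hlow' : ∀ (t : ℝ) (x : DampedWave.Circ), ‖x - (x₀ : DampedWave.Circ)‖ < min ε₀ 1 →
      lam ≤ b t ‖x‖ := fun t x hx => by
    have h1 := (abs_norm_sub_norm_le x (x₀ : DampedWave.Circ)).trans_lt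
      (hx.trans_le (min_le_left _ _))
    rw [hnorm, abs_lt] at h1
    exact hblow t _ ⟨by linarith [h1.1], by linarith [h1.2]⟩
  have h1 := H p hp'.ne _ hb.isDamping x₀ hlow' (DampedWave.ext (DampedWave.dx u₀) u₁)
    (by rw [DampedWave.mean_ext, DampedWave.mean_dx]) t ht
  have h2 := DampedWave.norm_ext_le (DampedWave.dx u₀) u₁
  have h3 : 0 ≤ C * Real.exp (-γ * t) := by positivity
  calc _ ≤ 2 * ‖DampedWave.semi hp'.ne hb.isDamping t
          (DampedWave.ext (DampedWave.dx u₀) u₁)‖ := hu.norm_le hp'.ne hb hab ht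
    _ ≤ 2 * (C * Real.exp (-γ * t) * (‖DampedWave.dx u₀‖ + ‖u₁‖)) := by
        have := h1.trans (mul_le_mul_of_nonneg_left h2 h3)
        linarith
    _ = _ := by ring
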